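/- **Setting.** Let $\Sigma$ be a compact smooth $n$-manifold ($n\ge 1$) with non-empty boundary and a smooth positive density $d^nx$. The fields are $z=(z^A)$, finitely many real functions on $\Sigma$, smooth up to the boundary. *Local function* means a smooth function of $t$, $x$, the $z^A$ and finitely many of their spatial derivatives; *local functional* means $F(t,z)=\int_\Sigma f\,d^nx$ with $f$ local; a *variation* is $\delta_Q z^A=Q^A(t,z)$ with $Q^A$ local, and $[\delta_Q,\delta_R]z^A=\delta_QR^A-\delta_RQ^A$. For a local current (a field-dependent vector field) $K^i(t,z)$, $\oint_{\partial\Sigma}(d^{n-1}x)_iK^i$ is its flux through $\partial\Sigma$, i.e. $\int_\Sigma \mathrm{div}K\,d^nx$. The functional derivative $\delta F/\delta z^A$ is defined by $\delta F=\int_\Sigma\frac{\delta F}{\delta z^A}\delta z^A\,d^nx$ for variations supported away from $\partial\Sigma$; for general variations one writes $\delta F=\int_\Sigma\frac{\delta F}{\delta z^A}\delta z^A\,d^nx+\oint\Theta_F[\delta z]$. Let $\sigma^{AB}$ be a constant antisymmetric invertible matrix with inverse $\sigma_{AB}$, put $\delta_Fz^A=\sigma^{AB}\frac{\delta F}{\delta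 z^B}$, $\{F,G\}=\int_\Sigma\frac{\delta F}{\delta z^A}\sigma^{AB}\frac{\delta G}{\delta z^B}d^nx$ and $$\{F,G\}_\zeta=\{F,G\}+\oint\Theta_F[\delta_Gz]-\oint\Theta_G[\delta_Fz].$$ Let $H$ be a local functional, $S[z]=\int dt\left(\int_\Sigma\frac12 z^A\sigma_{AB}\dot z^B d^nx-H\right)$, and let $\chi_I^\alpha(z)$ be local functions, independent of $t$, defining the internal boundary conditions $\chi_I^\alpha|_{\partial\Sigma}=\zeta^\alpha$ with sources $\zeta^\alpha$. With $\delta_t=\partial_t+\delta_H$, the external boundary conditions are $\chi_E^{k,\alpha}|_{\partial\Sigma}=(d_t-\delta_t)^k\chi_I^\alpha|_{\partial\Sigma}=0$ for all $k>0$; along a history they amount to $d_t(\delta_t^k\chi_I^\alpha)=\delta_t^{k+1}\chi_I^\alpha$ on $\partial\Sigma$ for all $k\ge0$, a condition on $(t,z,\dot z)$ at each instant, and not on $z$ alone. A variation $\delta$ *preserves the external boundary conditions* if $\delta\chi_E|_{\partial\Sigma}=0$ whenever $\chi_E|_{\partial\Sigma}=0$; it *preserves the internal boundary conditions* if moreover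 $\delta\chi_I^\alpha|_{\partial\Sigma}=0$. Assume that $\delta H=\int_\Sigma\frac{\delta H}{\delta z^A}\delta z^A d^nx$ for all $\delta$ preserving the internal boundary conditions (the action is well-defined), and that every infinitesimal variation $h$ of a configuration $z$ at time $t$ at fixed sources (i.e. annihilating $\delta_t^k\chi_I^\alpha|_{\partial\Sigma}$ for all $k\ge0$ at $(t,z)$) is the value at $(t,z)$ of a variation preserving the internal boundary conditions. A variation $\delta_Q$ *acts on the sources* if it preserves the external boundary conditions and $[\delta,\delta_Q]\chi_I^\alpha|_{\partial\Sigma}=0$ for all $\delta$ preserving the internal boundary conditions. A local functional $G$ is *generalized differentiable* if $\delta G=\int_\Sigma\frac{\delta G}{\delta z^A}\delta z^Ad^nx$ for all such $\delta$ and $\delta_G$ acts on the sources. An *external symmetry* is a variation $\delta_Q$ acting on the sources such that, for a local $U$ and a local current $V$ with $\delta\oint_{\partial\Sigma}(d^{n-1}x)_iV^i=0$ for all $\delta$ preserving the internal boundary conditions, $$\delta_QS=\int dt\Big\{\tfrac{d}{dt}\int_\Sigma U(t,z)\,d^nx+\oint_{\partial\Sigma}(d^{n-1}x)_iV^i(t,z)\Big\}$$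 as an equality of integrands at each instant, for all $(t,z,\dot z)$ compatible with the external boundary conditions. A generalized differentiable $G$ is a *generator* of it if $Q^A=\sigma^{AB}\frac{\delta G}{\delta z^B}$ and $\partial_tG+\{G,H\}_\zeta=\oint_{\partial\Sigma}(d^{n-1}x)_iV^i$ for some local current $V$ with $\delta\oint_{\partial\Sigma}(d^{n-1}x)_iV^i=0$ for all $\delta$ preserving the internal boundary conditions. **Theorem.** The external symmetries form a real Lie algebra $\mathcal G$ under the commutator; write $\delta_{[1,2]}=[\delta_1,\delta_2]$. If $G_1,G_2$ are generators of $\delta_1,\delta_2\in\mathcal G$, then $\{G_2,G_1\}_\zeta$ is a generator of $\delta_{[1,2]}$. Generators can be chosen to depend linearly on the element of $\mathcal G$, and each such choice is an extended representation of $\mathcal G$: there are local currents $K_{1,2}$, one for each $\delta_1,\delta_2\in\mathcal G$, such that $$\{G_2,G_1\}_\zeta=G_{[1,2]}+\oint_{\partial\Sigma}(d^{n-1}x)_iK^i_{1,2}(t,z),$$ the boundary term is invariant under all variations preserving the internal boundary conditions, $K^i_{1,2}=-K^i_{2,1}$, and for all $\delta_1,\delta_2,\delta_3\in\mathcal G$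 $$\oint_{\partial\Sigma}(d^{n-1}x)_iK^i_{1,[2,3]}+\delta_3\oint_{\partial\Sigma}(d^{n-1}x)_iK^i_{1,2}+\text{cyclic}=0 .$$ -/

import Mathlib

open scoped Manifold ContDiff
open MeasureTheory

noncomputable section

namespace BoundarySources

section Geometry

variable (n : ℕ) [NeZero n] (M : Type*) [TopologicalSpace M]
  [ChartedSpace (EuclideanHalfSpace n) M]

/-- Real-valued functions on the manifold with boundary `M`, smooth up to the boundary. -/
abbrev SmoothFn := C^∞⟮𝓡∂ n, M; 𝓘(ℝ, ℝ), ℝ⟯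

variable [IsManifold (𝓡∂ n) ∞ M]

/-- Smooth vector fields on `M`. -/
abbrev VField :=
  Cₛ^∞⟮𝓡∂ n; EuclideanSpace ℝ (Fin n), (TangentSpace (𝓡∂ n) : M → Type _)⟯

variable {n M}

/-- The derivative `X g` of a smooth function along a vector field. -/
def VField.apply (X : VField n M) (g : SmoothFn n M) : SmoothFn n M :=
  ⟨fun x => mfderiv (𝓡∂ n) 𝓘(ℝ, ℝ) g x (X x), by
    have h1 : ContMDiff (𝓡∂ n).tangent 𝓘(ℝ, ℝ).tangent ∞ (tangentMap (𝓡∂ n) 𝓘(ℝ, ℝ) g) :=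
      g.contMDiff.contMDiff_tangentMap (by simp)
    exact (contMDiff_snd_tangentBundle_modelSpace ℝ 𝓘(ℝ, ℝ)).comp (h1.comp X.contMDiff)⟩

/-- `d` is the divergence of `X` relative to the measure `μ`. -/
def IsDivergence [MeasurableSpace M] (μ : Measure M) (X : VField n M) (d : SmoothFn n M) : Prop :=
  ∀ g : SmoothFn n M, tsupport g ⊆ (𝓡∂ n).interior M →
    ∫ x, X.apply g x ∂μ = -∫ x, d x * g x ∂μ

open Classical in
/-- The divergence of `X`. For a smooth density it exists and is unique. -/
def divergence [MeasurableSpace M] (μ : Measure M) (X : VField n M) : SmoothFn n M :=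
  if h : ∃ d, IsDivergence μ X d then h.choose else 0

/-- The boundary integral `∮_{∂M} (dⁿ⁻¹x)_i Xⁱ`, the integral over `∂M` of the `(n-1)`-form
`ι_X μ`. By Stokes' theorem it is the integral over `M` of `d (ι_X μ) = (div X) μ`. -/
def boundaryIntegral [MeasurableSpace M] (μ : Measure M) (X : VField n M) : ℝ :=
  ∫ x, divergence μ X x ∂μ

open Classical in
/-- A function on `M` regarded as a smooth function. It is only used for functions which are smooth,
cf. `dirDeriv_apply`. -/
def ofFun (f : M → ℝ) : SmoothFn n M :=
  if h : ContMDiff (𝓡∂ n) 𝓘(ℝ, ℝ) ∞ f then ⟨f, h⟩ else 0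

theorem ofFun_apply {f : M → ℝ} (h : ContMDiff (𝓡∂ n) 𝓘(ℝ, ℝ) ∞ f) (x : M) :
    ofFun (n := n) f x = f x := by
  have : ofFun (n := n) f = ⟨f, h⟩ := dif_pos h
  rw [this]
  rfl

/-- The function `φ(g₁, …, g_m)`. -/
def compFn {m : ℕ} (φ : (Fin m → ℝ) → ℝ) (hφ : ContDiff ℝ ∞ φ) (g : Fin m → SmoothFn n M) :
    SmoothFn n M :=
  ⟨fun x => φ fun i => g i x,
    hφ.contMDiff.comp (contMDiff_pi_space.2 fun i => (g i).contMDiff)⟩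

/-- A smooth density: in the coordinates `x` of every chart the measure is `ρ(x) dⁿx` with `ρ`
positive and smooth up to the boundary. -/
def IsSmoothDensity [MeasurableSpace M] (μ : Measure M) : Prop :=
  ∀ p : M, ∃ ρ : EuclideanSpace ℝ (Fin n) → ℝ,
    ContDiffOn ℝ ∞ ρ (extChartAt (𝓡∂ n) p).target ∧
    (∀ x ∈ (extChartAt (𝓡∂ n) p).target, 0 < ρ x) ∧
    (μ.restrict (extChartAt (𝓡∂ n) p).source).map (extChartAt (𝓡∂ n) p) =
      (volume.restrict (extChartAt (𝓡∂ n) p).target).withDensity fun x => ENNReal.ofReal (ρ x)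

end Geometry

section Fields

variable (n : ℕ) [NeZero n] (M : Type*) [TopologicalSpace M]
  [ChartedSpace (EuclideanHalfSpace n) M] [IsManifold (𝓡∂ n) ∞ M] (ι : Type*)

/-- Field configurations `z^A(x)` at a fixed time. -/
abbrev Config := ι → SmoothFn n M

/-- (Possibly time-dependent) maps from configurations to functions on `M`. -/
abbrev Density := ℝ → Config n M ι → SmoothFn n M

/-- (Possibly time-dependent) functionals. -/
abbrev Functional := ℝ → Config n M ι → ℝ

/-- Variations `δ z^A = Q^A(t, z)` of the fields. -/
abbrev Variation := ℝ → Config n M ι → Config n M ι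

/-- Field-dependent vector fields `K^i(t, z)` on `M`. -/
abbrev Current := ℝ → Config n M ι → VField n M

variable {n M ι}

/-- Local functions: smooth functions of `t`, of the point `x`, of the fields `z^A` and of finitely
many of their spatial derivatives. -/
inductive IsLocal : Density n M ι → Prop
  | time : IsLocal fun t _ => algebraMap ℝ (SmoothFn n M) t
  | point (a : SmoothFn n M) : IsLocal fun _ _ => a
  | field (A : ι) : IsLocal fun _ z => z A
  | deriv (X : VField n M) (L : Density n M ι) (hL : IsLocal L) :
      IsLocal fun t z => X.apply (L t z)
  | comp {m : ℕ} (φ : (Fin m → ℝ) → ℝ) (hφ : ContDiff ℝ ∞ φ) (L : Fin m → Density n M ι)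
      (hL : ∀ i, IsLocal (L i)) : IsLocal fun t z => compFn φ hφ fun i => L i t z

/-- Local variations of the fields (evolutionary vector fields). -/
def IsLocalVariation (Q : Variation n M ι) : Prop :=
  ∀ A, IsLocal fun t z => Q t z A

/-- Local currents: finite sums of vector fields on `M` with local functions as coefficients. -/
def IsLocalCurrent (K : Current n M ι) : Prop :=
  ∃ (m : ℕ) (c : Fin m → Density n M ι) (X : Fin m → VField n M), (∀ j, IsLocal (c j)) ∧
    ∀ t z x, K t z x = ∑ j, c j t z x • X j x

/-- Local functionals `F[z] = ∫ f(t, x, z, ∂z, …) dⁿx`. -/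
def IsLocalFunctional [MeasurableSpace M] (μ : Measure M) (F : Functional n M ι) : Prop :=
  ∃ f : Density n M ι, IsLocal f ∧ ∀ t z, F t z = ∫ x, f t z x ∂μ

/-- The derivative of the local function `L` at `(t, z)` in the direction `(τ, v)`. -/
def dirDeriv (L : Density n M ι) (t : ℝ) (z : Config n M ι) (τ : ℝ) (v : Config n M ι) :
    SmoothFn n M :=
  ofFun fun x => deriv (fun s : ℝ => L (t + s * τ) (z + s • v) x) 0

theorem contMDiff_partial_snd {F : ℝ × M → ℝ}
    (hF : ContMDiff (𝓘(ℝ, ℝ).prod (𝓡∂ n)) 𝓘(ℝ, ℝ) ∞ F) (X : VField n M) :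
    ContMDiff (𝓘(ℝ, ℝ).prod (𝓡∂ n)) 𝓘(ℝ, ℝ) ∞ fun p : ℝ × M =>
      (mfderiv (𝓡∂ n) 𝓘(ℝ, ℝ) (fun y => F (p.1, y)) p.2 (X p.2) : ℝ) := by
  have h1 : ContMDiff (𝓘(ℝ, ℝ).prod (𝓡∂ n)).tangent 𝓘(ℝ, ℝ).tangent ∞
      (tangentMap (𝓘(ℝ, ℝ).prod (𝓡∂ n)) 𝓘(ℝ, ℝ) F) := hF.contMDiff_tangentMap (by simp)
  have h2 : ContMDiff (𝓘(ℝ, ℝ).prod (𝓡∂ n)) (𝓘(ℝ, ℝ).prod (𝓡∂ n)).tangent ∞ fun p : ℝ × M =>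
      (equivTangentBundleProd 𝓘(ℝ, ℝ) ℝ (𝓡∂ n) M).symm
        (Bundle.zeroSection ℝ (TangentSpace 𝓘(ℝ, ℝ) : ℝ → Type) p.1, ⟨p.2, X p.2⟩) :=
    (contMDiff_equivTangentBundleProd_symm (n := ∞)).comp
      (((Bundle.contMDiff_zeroSection ℝ (TangentSpace 𝓘(ℝ, ℝ) : ℝ → Type)).comp
        contMDiff_fst).prodMk (X.contMDiff.comp contMDiff_snd))
  have h3 := (contMDiff_snd_tangentBundle_modelSpace (n := ∞) ℝ 𝓘(ℝ, ℝ)).comp (h1.comp h2)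
  refine h3.congr fun p => ?_
  have hc : mfderiv (𝓡∂ n) 𝓘(ℝ, ℝ) (fun y => F (p.1, y)) p.2 =
      (mfderiv (𝓘(ℝ, ℝ).prod (𝓡∂ n)) 𝓘(ℝ, ℝ) F (p.1, p.2)).comp
        (mfderiv (𝓡∂ n) (𝓘(ℝ, ℝ).prod (𝓡∂ n)) (fun y => (p.1, y)) p.2) :=
    mfderiv_comp p.2 (hF.mdifferentiableAt (by simp))
      ((contMDiff_const.prodMk contMDiff_id).mdifferentiableAt (n := ∞) (by simp))
  rw [hc, mfderiv_prod_right]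
  rfl

theorem contMDiff_partial_fst {F : ℝ × M → ℝ}
    (hF : ContMDiff (𝓘(ℝ, ℝ).prod (𝓡∂ n)) 𝓘(ℝ, ℝ) ∞ F) :
    ContMDiff (𝓡∂ n) 𝓘(ℝ, ℝ) ∞ fun x : M => deriv (fun s => F (s, x)) 0 := by
  have h1 : ContMDiff (𝓘(ℝ, ℝ).prod (𝓡∂ n)).tangent 𝓘(ℝ, ℝ).tangent ∞
      (tangentMap (𝓘(ℝ, ℝ).prod (𝓡∂ n)) 𝓘(ℝ, ℝ) F) := hF.contMDiff_tangentMap (by simp)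
  have h2 : ContMDiff (𝓡∂ n) (𝓘(ℝ, ℝ).prod (𝓡∂ n)).tangent ∞ fun x : M =>
      (equivTangentBundleProd 𝓘(ℝ, ℝ) ℝ (𝓡∂ n) M).symm
        ((⟨0, (1 : ℝ)⟩ : TangentBundle 𝓘(ℝ, ℝ) ℝ),
          Bundle.zeroSection (EuclideanSpace ℝ (Fin n)) (TangentSpace (𝓡∂ n) : M → Type _) x) :=
    (contMDiff_equivTangentBundleProd_symm (n := ∞)).comp
      (contMDiff_const.prodMk (Bundle.contMDiff_zeroSection ℝ (TangentSpace (𝓡∂ n) : M → Type _)))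
  have h3 := (contMDiff_snd_tangentBundle_modelSpace (n := ∞) ℝ 𝓘(ℝ, ℝ)).comp (h1.comp h2)
  refine h3.congr fun x => ?_
  have hc : mfderiv 𝓘(ℝ, ℝ) 𝓘(ℝ, ℝ) (fun s => F (s, x)) 0 =
      (mfderiv (𝓘(ℝ, ℝ).prod (𝓡∂ n)) 𝓘(ℝ, ℝ) F (0, x)).comp
        (mfderiv 𝓘(ℝ, ℝ) (𝓘(ℝ, ℝ).prod (𝓡∂ n)) (fun s : ℝ => (s, x)) 0) :=
    mfderiv_comp (0 : ℝ) (hF.mdifferentiableAt (by simp))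
      ((contMDiff_id.prodMk contMDiff_const).mdifferentiableAt (n := ∞) (by simp))
  rw [← fderiv_apply_one_eq_deriv, ← mfderiv_eq_fderiv, hc, mfderiv_prod_left]
  rfl

theorem IsLocal.contMDiff_line {L : Density n M ι} (hL : IsLocal L) (t : ℝ) (z : Config n M ι)
    (τ : ℝ) (v : Config n M ι) :
    ContMDiff (𝓘(ℝ, ℝ).prod (𝓡∂ n)) 𝓘(ℝ, ℝ) ∞
      fun p : ℝ × M => L (t + p.1 * τ) (z + p.1 • v) p.2 := by
  induction hL with
  | time =>
    have : ContMDiff (𝓘(ℝ, ℝ).prod (𝓡∂ n)) 𝓘(ℝ, ℝ) ∞ fun p : ℝ × M => t + p.1 * τ :=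
      contMDiff_const.add (contMDiff_fst.mul contMDiff_const)
    exact this
  | point a => exact a.contMDiff.comp contMDiff_snd
  | field A =>
    have : ContMDiff (𝓘(ℝ, ℝ).prod (𝓡∂ n)) 𝓘(ℝ, ℝ) ∞ fun p : ℝ × M => z A p.2 + p.1 * v A p.2 :=
      ((z A).contMDiff.comp contMDiff_snd).add
        (contMDiff_fst.mul ((v A).contMDiff.comp contMDiff_snd))
    exact this
  | deriv X L hL ih => exact contMDiff_partial_snd ih X
  | comp φ hφ L hL ih => exact hφ.contMDiff.comp (contMDiff_pi_space.2 ih)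

/-- The derivative of a local function is smooth on `M`. -/
theorem dirDeriv_apply {L : Density n M ι} (hL : IsLocal L) (t : ℝ) (z : Config n M ι)
    (τ : ℝ) (v : Config n M ι) (x : M) :
    dirDeriv L t z τ v x = deriv (fun s : ℝ => L (t + s * τ) (z + s • v) x) 0 := by
  have h := contMDiff_partial_fst (hL.contMDiff_line t z τ v)
  exact ofFun_apply h x

/-- The total time derivative `d_t L` at `(t, z)` when the velocity of the field is `v`. -/
def totalDeriv (L : Density n M ι) (t : ℝ) (z v : Config n M ι) : SmoothFn n M :=
  dirDeriv L t z 1 v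

/-- The variation `δ_Q L` of a local function at fixed time. -/
def vary (Q : Variation n M ι) (L : Density n M ι) : Density n M ι :=
  fun t z => dirDeriv L t z 0 (Q t z)

/-- The variation `δ_Q F` of a functional at fixed time. -/
def varyFunctional (Q : Variation n M ι) (F : Functional n M ι) : Functional n M ι :=
  fun t z => deriv (fun s : ℝ => F t (z + s • Q t z)) 0

/-- The commutator `[δ_Q, δ_R] z^A = δ_Q R^A - δ_R Q^A`. -/
def commutator (Q R : Variation n M ι) : Variation n M ι :=
  fun t z A => vary Q (fun t z => R t z A) t z - vary R (fun t z => Q t z A) t z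

variable [MeasurableSpace M] (μ : Measure M)

/-- The functional `z ↦ ∮ K^i(t, z) (dⁿ⁻¹x)_i`. -/
def boundaryTerm (K : Current n M ι) : Functional n M ι :=
  fun t z => boundaryIntegral μ (K t z)

variable [Fintype ι]

/-- The integral `∫ E_A(x) h^A(x) dⁿx`. -/
def pairing (E h : Config n M ι) : ℝ := ∑ A, ∫ x, E A x * h A x ∂μ

/-- `E` is the functional derivative `δF/δz^A`: it describes the variation of `F` under all
variations of the fields supported away from the boundary. -/
def HasFunctionalDeriv (F : Functional n M ι) (E : Variation n M ι) : Prop :=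
  IsLocalVariation E ∧
  ∀ t (z h : Config n M ι), (∀ A, tsupport (h A) ⊆ (𝓡∂ n).interior M) →
    HasDerivAt (fun s : ℝ => F t (z + s • h)) (pairing μ (E t z) h) 0

open Classical in
/-- The functional derivative `δF/δz^A`. Every local functional has exactly one. -/
def funcDeriv (F : Functional n M ι) : Variation n M ι :=
  if h : ∃ E, HasFunctionalDeriv μ F E then h.choose else 0

/-- The boundary term `∮ Θ_F[h]` in the variation of `F`:
`δF = ∫ (δF/δz^A) h^A dⁿx + ∮ Θ_F[h]` for `δz = h`. -/
def boundaryVariation (F : Functional n M ι) (t : ℝ) (z h : Config n M ι) : ℝ :=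
  deriv (fun s : ℝ => F t (z + s • h)) 0 - pairing μ (funcDeriv μ F t z) h

/-- The transformation `δ_F z^A = σ^{AB} δF/δz^B` generated by `F`. -/
def hamVariation (σ : Matrix ι ι ℝ) (F : Functional n M ι) : Variation n M ι :=
  fun t z A => ∑ B, σ A B • funcDeriv μ F t z B

/-- The Poisson bracket `{F, G} = ∫ (δF/δz^A) σ^{AB} (δG/δz^B) dⁿx`. -/
def poissonBracket (σ : Matrix ι ι ℝ) (F G : Functional n M ι) : Functional n M ι :=
  fun t z => pairing μ (funcDeriv μ F t z) (hamVariation μ σ G t z)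

/-- The modified bracket `{F, G}_ζ = {F, G} + ∮ Θ_F[δ_G z] - ∮ Θ_G[δ_F z]`. -/
def modifiedBracket (σ : Matrix ι ι ℝ) (F G : Functional n M ι) : Functional n M ι :=
  fun t z => poissonBracket μ σ F G t z
    + boundaryVariation μ F t z (hamVariation μ σ G t z)
    - boundaryVariation μ G t z (hamVariation μ σ F t z)

end Fields

section Systems

variable {n : ℕ} [NeZero n] {M : Type*} [TopologicalSpace M]
  [ChartedSpace (EuclideanHalfSpace n) M] [IsManifold (𝓡∂ n) ∞ M] {ι κ : Type*}

/-- The data of a Hamiltonian field theory with boundary sources `ζ^α`: the Poisson matrix `σ^{AB}`,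
the Hamiltonian `H` and the operators `χ_I^α` of the internal boundary conditions
`χ_I^α(z)|_{∂M} = ζ^α`. -/
structure System (n : ℕ) [NeZero n] (M : Type*) [TopologicalSpace M]
    [ChartedSpace (EuclideanHalfSpace n) M] [IsManifold (𝓡∂ n) ∞ M] (ι κ : Type*) where
  σ : Matrix ι ι ℝ
  H : Functional n M ι
  χ : κ → Config n M ι → SmoothFn n M

variable [MeasurableSpace M] (μ : Measure M) [Fintype ι] (S : System n M ι κ)

/-- The operators `δ_t^k χ_I^α`, where `δ_t = ∂/∂t + δ_H`. -/
def System.chi : ℕ → κ → Density n M ι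
  | 0, α => fun _ z => S.χ α z
  | k + 1, α => fun t z => dirDeriv (System.chi k α) t z 1 (hamVariation μ S.σ S.H t z)

/-- The fields `z` at time `t` with velocity `v` satisfy the external boundary conditions
`χ_E|_{∂M} = 0`. These conditions, `(d_t - δ_t)^k χ_I = 0` on `∂M` at all times and for all `k > 0`,
hold along a history if and only if `d_t (δ_t^k χ_I) = δ_t^{k+1} χ_I` on `∂M` at all times
and for all `k ≥ 0`, and the latter only involves the fields and their velocities. -/
def System.ExternalBC (t : ℝ) (z v : Config n M ι) : Prop :=
  ∀ (k : ℕ) (α : κ), ∀ y ∈ (𝓡∂ n).boundary M,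
    totalDeriv (S.chi μ k α) t z v y = S.chi μ (k + 1) α t z y

/-- `δ_Q χ_E|_{∂M} = 0` for all fields with `χ_E|_{∂M} = 0`: the variation of the
external boundary conditions `d_t (δ_t^k χ_I) = δ_t^{k+1} χ_I` vanishes. -/
def System.PreservesExternal (Q : Variation n M ι) : Prop :=
  ∀ t z v, S.ExternalBC μ t z v → ∀ (k : ℕ) (α : κ), ∀ y ∈ (𝓡∂ n).boundary M,
    totalDeriv (vary Q (S.chi μ k α)) t z v y = vary Q (S.chi μ (k + 1) α) t z y

/-- Variations preserving the internal boundary conditions: `δ χ_I|_{∂M} = 0` and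
`δ χ_E|_{∂M} = 0`. -/
def System.PreservesInternal (δ : Variation n M ι) : Prop :=
  IsLocalVariation δ ∧
  (∀ (α : κ) t z, ∀ y ∈ (𝓡∂ n).boundary M, vary δ (S.chi μ 0 α) t z y = 0) ∧
  S.PreservesExternal μ δ

/-- `δ_Q χ_E|_{∂M} = 0`, and `[δ, δ_Q] χ_I|_{∂M} = 0` for all variations `δ` preserving the internal
boundary conditions: the sources transform among themselves. -/
def System.ActsOnSources (Q : Variation n M ι) : Prop :=
  S.PreservesExternal μ Q ∧
  ∀ δ, S.PreservesInternal μ δ → ∀ (α : κ) t z, ∀ y ∈ (𝓡∂ n).boundary M,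
    vary δ (vary Q (S.chi μ 0 α)) t z y - vary Q (vary δ (S.chi μ 0 α)) t z y = 0

/-- The functional `F` is invariant under all variations preserving the internal boundary
conditions. -/
def System.InternallyInvariant (F : Functional n M ι) : Prop :=
  ∀ δ, S.PreservesInternal μ δ → ∀ t z,
    HasDerivAt (fun s : ℝ => F t (z + s • δ t z)) 0 0

/-- `δF = ∫ (δF/δz^A) δz^A dⁿx` for all variations preserving the internal boundary conditions. -/
def System.HasNoBoundaryVariation (F : Functional n M ι) : Prop :=
  ∀ δ, S.PreservesInternal μ δ → ∀ t z,
    HasDerivAt (fun s : ℝ => F t (z + s • δ t z)) (pairing μ (funcDeriv μ F t z) (δ t z)) 0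

/-- Generalized differentiable functionals. -/
def System.IsGenDifferentiable (G : Functional n M ι) : Prop :=
  IsLocalFunctional μ G ∧ S.HasNoBoundaryVariation μ G ∧
  S.ActsOnSources μ (hamVariation μ S.σ G)

/-- The integrand of the action `S[z] = ∫ dt {∫ ½ z^A σ_{AB} ż^B dⁿx - H(t, z)}`, at the fields `z`
with velocity `v`; here `σ_{AB}` is the inverse of `σ^{AB}`. -/
def System.lagrangian [DecidableEq ι] (t : ℝ) (z v : Config n M ι) : ℝ :=
  (∑ A, ∑ B, ∫ x, (1 / 2 : ℝ) * z A x * S.σ⁻¹ A B * v B x ∂μ) - S.H t z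

/-- External symmetries of the action. The equality
`δ_Q S = ∫ dt {d/dt ∫ U(t, z) dⁿx + ∮ V^i(t, z) (dⁿ⁻¹x)_i}` on every interval of time is the equality
of the integrands at each instant, for fields and velocities that satisfy the external boundary
conditions. The variation of the velocity `v` is `d_t Q`. -/
def System.IsExternalSymmetry [DecidableEq ι] (Q : Variation n M ι) : Prop :=
  IsLocalVariation Q ∧ S.ActsOnSources μ Q ∧
  ∃ (U : Density n M ι) (V : Current n M ι), IsLocal U ∧ IsLocalCurrent V ∧
    S.InternallyInvariant μ (boundaryTerm μ V) ∧
    ∀ t z v, S.ExternalBC μ t z v →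
      HasDerivAt
        (fun s : ℝ => S.lagrangian μ t (z + s • Q t z)
          (v + s • fun A => totalDeriv (fun t z => Q t z A) t z v))
        (deriv (fun s : ℝ => ∫ x, U (t + s) (z + s • v) x ∂μ) 0 + boundaryTerm μ V t z) 0

/-- `G` is a generalized differentiable generator of the external symmetry `δ_Q`:
`Q^A = σ^{AB} δG/δz^B` and `∂_t G + {G, H}_ζ = ∮ V^i (dⁿ⁻¹x)_i`, where the right-hand side is
invariant under all variations preserving the internal boundary conditions. -/
def System.IsGenerator (Q : Variation n M ι) (G : Functional n M ι) : Prop :=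
  S.IsGenDifferentiable μ G ∧ Q = hamVariation μ S.σ G ∧
  ∃ V : Current n M ι, IsLocalCurrent V ∧ S.InternallyInvariant μ (boundaryTerm μ V) ∧
    ∀ t z, deriv (fun s : ℝ => G s z) t + modifiedBracket μ S.σ G S.H t z = boundaryTerm μ V t z

/-- The standing assumptions on the system. -/
structure System.IsRegular [DecidableEq ι] : Prop where
  skew : S.σ.transpose = -S.σ
  invertible : IsUnit S.σ.det
  local_H : IsLocalFunctional μ S.H
  local_χ : ∀ α, IsLocal fun _ z => S.χ α z
  /-- The action is well-defined under variations preserving the internal boundary conditions. -/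
  action_wellDefined : S.HasNoBoundaryVariation μ S.H
  /-- The variations at fixed sources (infinitesimal variations `h` of a configuration which
  preserve `ζ^α` and all its time derivatives) are the same as the variations preserving the internal
  boundary conditions of all configurations. -/
  fixed_sources : ∀ t z h,
    (∀ (k : ℕ) (α : κ), ∀ y ∈ (𝓡∂ n).boundary M, dirDeriv (S.chi μ k α) t z 0 h y = 0) →
    ∃ δ, S.PreservesInternal μ δ ∧ δ t z = h

end Systems

end BoundarySources

end

/-!
The proof separates the calculus of local functionals, in which no boundary conditions occur, from
the algebra of the modified bracket.

**Calculus.** A local function is a smooth function of finitely many jet coordinates `X₁ ⋯ X_k z^A`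
(`IsLocal.exists_jetCoord`), so the derivations `τ ∂_t + δ_Q` commute with spatial derivatives, and
the commutator of two of them is again a variation (`IsLocal.dvary_comm`). Integrating by parts in
the first variation of a local functional produces a local functional derivative, up to the
divergence of a local current which is linear in the variation
(`IsSmoothDensity.exists_eulerLagrange`). The fundamental lemma of the calculus of variations gives
uniqueness. The homotopy `z ↦ s z` then shows that a local functional without functional derivative
is the flux of a local current (`IsSmoothDensity.exists_boundaryTerm_of_funcDeriv_eq_zero`). Its
value at `z = 0` is a number depending on `t`, and it is here that a non-empty boundary is needed:
some vector field has a non-zero flux (`IsSmoothDensity.exists_boundaryIntegral_ne_zero`), and its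
multiples account for that number.

**Boundary conditions.** A velocity at `(t, z)` satisfies the external boundary conditions exactly if
it is `δ_H z + h`, with `h` annihilating all `δ_t^k χ_I` on the boundary
(`System.IsRegular.externalBC_iff`). The assumption on the variations at fixed sources therefore makes
"preserving the internal boundary conditions" a pointwise condition on the variation
(`System.IsRegular.preservesInternal_iff`). If `δ_Q` preserves the external boundary conditions, its
commutators with `∂_t + δ_H` and with the variations preserving the internal boundary conditions
preserve the internal ones; in particular `δ_Q` acts on the sources.

**Symmetries and generators.** Inserting the velocities `δ_H z + h` into the invariance of the action
proves Noether's theorem: `δ_Q` is an external symmetry if and only if it has a generator, namely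
`½ ∫ z^A σ_{AB} Q^B dⁿx - ∫ U dⁿx` (`System.IsRegular.isExternalSymmetry_iff`). The bracket can be
written as `{F, G}_ζ = δ_G F - δ_F G + ∫ (δG/δz^A) δ_F z^A dⁿx`. Together with the statements on
commutators this yields its variation along internal variations
(`IsSmoothDensity.dvaryF_modifiedBracket`), hence its functional derivative, and its rate of change
(`System.IsRegular.rate_modifiedBracket`), so that the bracket of two generators generates the
commutator (`System.IsRegular.isGenerator_modifiedBracket`). Consequently the external symmetries are
closed under commutators, and generators may be chosen linearly by prescribing them on a basis.

**The extension.** Two generators of the same symmetry have the same functional derivative and differ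
by the flux of a local current (`System.IsRegular.exists_boundaryTerm_of_isGenerator`). Applied to
`{G₂, G₁}_ζ` and `G_[1,2]` this gives the currents `K_{1,2}`; since the fluxes are antisymmetric the
currents can be antisymmetrized. The modified bracket does not satisfy the Jacobi identity without
boundary terms, but a cyclic identity in which variations and brackets occur together
(`IsSmoothDensity.modifiedBracket_cyclic`). With the Jacobi identity of the commutator it becomes the
cocycle condition (`System.IsRegular.cocycle`).
-/

set_option linter.unusedSectionVars false

noncomputable section

namespace BoundarySources

/-! ### Calculus of smooth functions -/

section Calculus

variable {n : ℕ} [NeZero n] {M : Type*} [TopologicalSpace M]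
  [ChartedSpace (EuclideanHalfSpace n) M] [IsManifold (𝓡∂ n) ∞ M] {ι : Type*}

@[simp] theorem smoothFn_add_apply (f g : SmoothFn n M) (x : M) : (f + g) x = f x + g x := rfl

@[simp] theorem smoothFn_sub_apply (f g : SmoothFn n M) (x : M) : (f - g) x = f x - g x := rfl

@[simp] theorem smoothFn_mul_apply (f g : SmoothFn n M) (x : M) : (f * g) x = f x * g x := rfl

@[simp] theorem smoothFn_smul_apply (r : ℝ) (f : SmoothFn n M) (x : M) : (r • f) x = r * f x := rfl

@[simp] theorem smoothFn_zero_apply (x : M) : (0 : SmoothFn n M) x = 0 := rfl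

@[simp] theorem smoothFn_algebraMap_apply (r : ℝ) (x : M) :
    (algebraMap ℝ (SmoothFn n M) r) x = r := rfl

@[simp] theorem smoothFn_sum_apply {J : Type*} (s : Finset J) (f : J → SmoothFn n M) (x : M) :
    (∑ j ∈ s, f j) x = ∑ j ∈ s, f j x :=
  map_sum (ContMDiffMap.evalRingHom (I := 𝓡∂ n) (n := ∞) (R := ℝ) (I' := 𝓘(ℝ, ℝ)) x) f s

/-- The `i`-th partial derivative of `φ`. -/
def pderiv {J : Type} [Fintype J] (φ : (J → ℝ) → ℝ) (i : J) : (J → ℝ) → ℝ := by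
  classical exact fun y => fderiv ℝ φ y (Pi.single i 1)

theorem contDiff_pderiv {J : Type} [Fintype J] {φ : (J → ℝ) → ℝ} (hφ : ContDiff ℝ ∞ φ) (i : J) :
    ContDiff ℝ ∞ (pderiv φ i) :=
  (hφ.fderiv_right (m := ∞) (by simp)).clm_apply contDiff_const

theorem fderiv_eq_sum_pderiv {J : Type} [Fintype J] (φ : (J → ℝ) → ℝ) (y v : J → ℝ) :
    fderiv ℝ φ y v = ∑ i, pderiv φ i y * v i := by
  classical
  conv_lhs => rw [pi_eq_sum_univ' v, map_sum]
  refine Finset.sum_congr rfl fun i _ => ?_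
  rw [map_smul, smul_eq_mul, mul_comm]
  simp [pderiv]

theorem pderiv_comm {J : Type} [Fintype J] {φ : (J → ℝ) → ℝ} (hφ : ContDiff ℝ ∞ φ) (i j : J) :
    pderiv (pderiv φ i) j = pderiv (pderiv φ j) i := by
  classical
  ext y
  have hd : ∀ y, DifferentiableAt ℝ (fderiv ℝ φ) y := fun y =>
    (hφ.fderiv_right (m := ∞) (by simp)).differentiable (by simp) y
  have key : ∀ k l, pderiv (pderiv φ k) l y =
      fderiv ℝ (fderiv ℝ φ) y (Pi.single l 1) (Pi.single k 1) := by
    intro k l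
    have : HasFDerivAt (pderiv φ k) _ y :=
      (hd y).hasFDerivAt.clm_apply (hasFDerivAt_const (Pi.single k 1 : J → ℝ) y)
    change fderiv ℝ (pderiv φ k) y (Pi.single l 1) = _
    rw [this.fderiv]
    simp
  rw [key, key]
  exact second_derivative_symmetric (fun z => (hφ.differentiable (by simp) z).hasFDerivAt)
    (hd y).hasFDerivAt _ _

/-- The function `φ(g₁, …, g_m)`, with an arbitrary finite type of arguments. -/
def smoothComp {J : Type} [Fintype J] (φ : (J → ℝ) → ℝ) (hφ : ContDiff ℝ ∞ φ)
    (g : J → SmoothFn n M) : SmoothFn n M :=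
  ⟨fun x => φ fun i => g i x,
    hφ.contMDiff.comp (contMDiff_pi_space.2 fun i => (g i).contMDiff)⟩

@[simp] theorem smoothComp_apply {J : Type} [Fintype J] (φ : (J → ℝ) → ℝ) (hφ : ContDiff ℝ ∞ φ)
    (g : J → SmoothFn n M) (x : M) : smoothComp φ hφ g x = φ fun i => g i x := rfl

/-- The differential of `g` at `x` in the preferred chart at `x`. -/
def chartDeriv (g : SmoothFn n M) (x : M) : EuclideanSpace ℝ (Fin n) →L[ℝ] ℝ :=
  mfderiv (𝓡∂ n) 𝓘(ℝ, ℝ) g x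

/-- The value of a vector field at `x`, as a vector in the model space of the preferred chart. -/
def VField.vec (X : VField n M) (x : M) : EuclideanSpace ℝ (Fin n) := X x

theorem VField.apply_apply (X : VField n M) (g : SmoothFn n M) (x : M) :
    X.apply g x = chartDeriv g x (X.vec x) := rfl

theorem hasFDerivWithinAt_chart (g : SmoothFn n M) (x : M) :
    HasFDerivWithinAt (g ∘ (extChartAt (𝓡∂ n) x).symm) (chartDeriv g x) (Set.range (𝓡∂ n))
      (extChartAt (𝓡∂ n) x x) :=
  (g.contMDiff.mdifferentiableAt (by simp)).hasMFDerivAt.2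

theorem VField.apply_eq (X : VField n M) (g : SmoothFn n M) (x : M)
    (L : EuclideanSpace ℝ (Fin n) →L[ℝ] ℝ)
    (hL : HasFDerivWithinAt (g ∘ (extChartAt (𝓡∂ n) x).symm) L (Set.range (𝓡∂ n))
      (extChartAt (𝓡∂ n) x x)) : X.apply g x = L (X.vec x) := by
  have : chartDeriv g x = L :=
    UniqueDiffWithinAt.eq ((𝓡∂ n).uniqueDiffOn _ (Set.mem_range_self _))
      (hasFDerivWithinAt_chart g x) hL
  rw [← this]
  rfl

theorem VField.apply_smoothComp (X : VField n M) {J : Type} [Fintype J] (φ : (J → ℝ) → ℝ)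
    (hφ : ContDiff ℝ ∞ φ) (g : J → SmoothFn n M) :
    X.apply (smoothComp φ hφ g) =
      ∑ i, smoothComp (pderiv φ i) (contDiff_pderiv hφ i) g * X.apply (g i) := by
  ext x
  have h1 := hasFDerivWithinAt_pi.2 fun i => hasFDerivWithinAt_chart (g i) x
  have h2 : HasFDerivAt φ (fderiv ℝ φ fun i => g i x)
      (fun i => (g i ∘ (extChartAt (𝓡∂ n) x).symm) (extChartAt (𝓡∂ n) x x)) := by
    simp only [Function.comp_apply, extChartAt_to_inv]
    exact (hφ.differentiable (by simp) fun i => g i x).hasFDerivAt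
  have h3 := HasFDerivAt.comp_hasFDerivWithinAt
    (f := fun u i => (g i ∘ (extChartAt (𝓡∂ n) x).symm) u) (extChartAt (𝓡∂ n) x x) h2 h1
  rw [X.apply_eq (smoothComp φ hφ g) x _ h3,
    ContinuousLinearMap.comp_apply, fderiv_eq_sum_pderiv]
  simp only [smoothFn_sum_apply, smoothFn_mul_apply, smoothComp_apply]
  rfl

theorem VField.apply_add (X : VField n M) (f g : SmoothFn n M) :
    X.apply (f + g) = X.apply f + X.apply g := by
  ext x
  rw [X.apply_eq (f + g) x _ ((hasFDerivWithinAt_chart f x).add (hasFDerivWithinAt_chart g x))]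
  rfl

theorem VField.apply_smul (X : VField n M) (r : ℝ) (f : SmoothFn n M) :
    X.apply (r • f) = r • X.apply f := by
  ext x
  rw [X.apply_eq (r • f) x _ ((hasFDerivWithinAt_chart f x).const_smul r)]
  rfl

theorem VField.apply_mul (X : VField n M) (f g : SmoothFn n M) :
    X.apply (f * g) = X.apply f * g + f * X.apply g := by
  ext x
  rw [X.apply_eq (f * g) x _ ((hasFDerivWithinAt_chart f x).mul (hasFDerivWithinAt_chart g x))]
  simp only [Function.comp_apply, extChartAt_to_inv, add_apply,
    smul_apply, smul_eq_mul, smoothFn_add_apply, smoothFn_mul_apply,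
    VField.apply_apply]
  ring

theorem VField.apply_algebraMap (X : VField n M) (r : ℝ) :
    X.apply (algebraMap ℝ (SmoothFn n M) r) = 0 := by
  ext x
  rw [X.apply_eq _ x 0 (hasFDerivWithinAt_const r _ _)]
  rfl

/-- The derivative along a vector field as a linear map. -/
def VField.applyₗ (X : VField n M) : SmoothFn n M →ₗ[ℝ] SmoothFn n M where
  toFun := X.apply
  map_add' := X.apply_add
  map_smul' := X.apply_smul

theorem VField.apply_sum (X : VField n M) {J : Type*} (s : Finset J) (f : J → SmoothFn n M) :
    X.apply (∑ j ∈ s, f j) = ∑ j ∈ s, X.apply (f j) :=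
  map_sum X.applyₗ f s

theorem VField.apply_sub (X : VField n M) (f g : SmoothFn n M) :
    X.apply (f - g) = X.apply f - X.apply g :=
  map_sub X.applyₗ f g

theorem VField.apply_zero (X : VField n M) : X.apply 0 = 0 :=
  map_zero X.applyₗ

theorem VField.apply_eq_zero_of_eqOn (X : VField n M) {f : SmoothFn n M} {U : Set M}
    (hU : IsOpen U) (hf : ∀ x ∈ U, f x = 0) : ∀ x ∈ U, X.apply f x = 0 := by
  intro x hx
  have h : (f : M → ℝ) =ᶠ[nhds x] fun _ => 0 := by
    filter_upwards [hU.mem_nhds hx] with y hy using hf y hy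
  have : chartDeriv f x = 0 := by
    unfold chartDeriv
    rw [h.mfderiv_eq, mfderiv_const]
    rfl
  rw [X.apply_apply, this]; rfl

end Calculus

/-! ### Local functions and their derivatives -/

section LocalCalculus

variable {n : ℕ} [NeZero n] {M : Type*} [TopologicalSpace M]
  [ChartedSpace (EuclideanHalfSpace n) M] [IsManifold (𝓡∂ n) ∞ M] {ι : Type*}

theorem IsLocal.smoothComp {J : Type} [Fintype J] (φ : (J → ℝ) → ℝ) (hφ : ContDiff ℝ ∞ φ)
    {L : J → Density n M ι} (hL : ∀ j, IsLocal (L j)) :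
    IsLocal fun t z => smoothComp φ hφ fun j => L j t z := by
  let e := Fintype.equivFin J
  have hφ' : ContDiff ℝ ∞ fun y : Fin (Fintype.card J) → ℝ => φ fun j => y (e j) :=
    hφ.comp (contDiff_pi.2 fun j => contDiff_apply ℝ ℝ (e j))
  convert IsLocal.comp _ hφ' (fun i => L (e.symm i)) (fun i => hL _) using 3 with t z
  ext x
  change _ = φ fun j => L (e.symm (e j)) t z x
  simp

theorem IsLocal.const (r : ℝ) :
    IsLocal (fun _ _ => algebraMap ℝ (SmoothFn n M) r : Density n M ι) := IsLocal.point _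

theorem IsLocal.zero : IsLocal (0 : Density n M ι) := IsLocal.point 0

theorem IsLocal.sum {J : Type} [Fintype J] {L : J → Density n M ι} (hL : ∀ j, IsLocal (L j)) :
    IsLocal fun t z => ∑ j, L j t z := by
  convert IsLocal.smoothComp (fun y : J → ℝ => ∑ j, y j)
    (ContDiff.sum fun j _ => contDiff_apply ℝ ℝ j) hL using 3
  ext x
  simp

theorem IsLocal.mul {L L' : Density n M ι} (hL : IsLocal L) (hL' : IsLocal L') :
    IsLocal fun t z => L t z * L' t z := by
  have h : ∀ b : Bool, IsLocal ((fun b => bif b then L else L') b) := by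
    rintro (_ | _) <;> assumption
  convert IsLocal.smoothComp (fun y : Bool → ℝ => y true * y false)
    ((contDiff_apply ℝ ℝ true).mul (contDiff_apply ℝ ℝ false)) h using 3
  ext x; rfl

theorem IsLocal.add {L L' : Density n M ι} (hL : IsLocal L) (hL' : IsLocal L') :
    IsLocal fun t z => L t z + L' t z := by
  have h : ∀ b : Bool, IsLocal ((fun b => bif b then L else L') b) := by
    rintro (_ | _) <;> assumption
  convert IsLocal.smoothComp (fun y : Bool → ℝ => y true + y false)
    ((contDiff_apply ℝ ℝ true).add (contDiff_apply ℝ ℝ false)) h using 3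
  ext x; rfl

theorem IsLocal.smul {L : Density n M ι} (r : ℝ) (hL : IsLocal L) :
    IsLocal fun t z => r • L t z := by
  convert (IsLocal.const r).mul hL using 3
  ext x; rfl

theorem IsLocal.neg {L : Density n M ι} (hL : IsLocal L) : IsLocal fun t z => -L t z := by
  convert hL.smul (-1) using 3
  ext x; simp

theorem IsLocal.sub {L L' : Density n M ι} (hL : IsLocal L) (hL' : IsLocal L') :
    IsLocal fun t z => L t z - L' t z := by
  convert hL.add hL'.neg using 3
  ext x; simp [sub_eq_add_neg]

theorem IsLocal.sum_finset {J : Type*} [Fintype J] {L : J → Density n M ι}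
    (hL : ∀ j, IsLocal (L j)) : IsLocal fun t z => ∑ j, L j t z := by
  let e := Fintype.equivFin J
  convert IsLocal.sum (L := fun i => L (e.symm i)) (fun i => hL _) using 3 with t z
  exact (Equiv.sum_comp e.symm fun j => L j t z).symm

theorem IsLocal.hasDerivAt {L : Density n M ι} (hL : IsLocal L) (t : ℝ) (z : Config n M ι)
    (τ : ℝ) (v : Config n M ι) (x : M) :
    HasDerivAt (fun s : ℝ => L (t + s * τ) (z + s • v) x) (dirDeriv L t z τ v x) 0 := by
  rw [dirDeriv_apply hL]
  have h1 : ContMDiff 𝓘(ℝ, ℝ) 𝓘(ℝ, ℝ) ∞ fun s : ℝ => L (t + s * τ) (z + s • v) x :=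
    (hL.contMDiff_line t z τ v).comp (contMDiff_id.prodMk contMDiff_const)
  exact (h1.contDiff.differentiable (by simp) 0).hasDerivAt

theorem IsLocal.dirDeriv_eq {L : Density n M ι} (hL : IsLocal L) {t : ℝ} {z : Config n M ι}
    {τ : ℝ} {v : Config n M ι} {g : SmoothFn n M}
    (h : ∀ x, HasDerivAt (fun s : ℝ => L (t + s * τ) (z + s • v) x) (g x) 0) :
    dirDeriv L t z τ v = g := by
  ext x
  exact (hL.hasDerivAt t z τ v x).unique (h x)

/-- The derivative along the line `s ↦ (t + s τ, z + s v)` at an arbitrary value of `s`. -/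
theorem IsLocal.hasDerivAt_line {L : Density n M ι} (hL : IsLocal L) (t : ℝ) (z : Config n M ι)
    (τ : ℝ) (v : Config n M ι) (x : M) (s : ℝ) :
    HasDerivAt (fun s : ℝ => L (t + s * τ) (z + s • v) x)
      (dirDeriv L (t + s * τ) (z + s • v) τ v x) s := by
  have h := hL.hasDerivAt (t + s * τ) (z + s • v) τ v x
  rw [← sub_self s] at h
  refine (h.comp_sub_const s s).congr_of_eventuallyEq (Filter.Eventually.of_forall fun r => ?_)
  dsimp only
  rw [show t + s * τ + (r - s) * τ = t + r * τ by ring,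
    show z + s • v + (r - s) • v = z + r • v by rw [sub_smul]; abel]

theorem dirDeriv_time (t : ℝ) (z : Config n M ι) (τ : ℝ) (v : Config n M ι) :
    dirDeriv (fun t _ => algebraMap ℝ (SmoothFn n M) t) t z τ v = algebraMap ℝ _ τ := by
  refine IsLocal.time.dirDeriv_eq fun x => ?_
  simpa using ((hasDerivAt_id (0 : ℝ)).mul_const τ).const_add t

theorem dirDeriv_point (a : SmoothFn n M) (t : ℝ) (z : Config n M ι) (τ : ℝ)
    (v : Config n M ι) : dirDeriv (fun _ _ => a) t z τ v = 0 :=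
  (IsLocal.point a).dirDeriv_eq fun _ => hasDerivAt_const _ _

theorem dirDeriv_field (A : ι) (t : ℝ) (z : Config n M ι) (τ : ℝ) (v : Config n M ι) :
    dirDeriv (fun _ z => z A) t z τ v = v A := by
  refine (IsLocal.field A).dirDeriv_eq fun x => ?_
  have := ((hasDerivAt_id (0 : ℝ)).mul_const (v A x)).const_add (z A x)
  simpa using this

theorem dirDeriv_smoothComp {J : Type} [Fintype J] (φ : (J → ℝ) → ℝ) (hφ : ContDiff ℝ ∞ φ)
    {L : J → Density n M ι} (hL : ∀ j, IsLocal (L j)) (t : ℝ) (z : Config n M ι) (τ : ℝ)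
    (v : Config n M ι) :
    dirDeriv (fun t z => smoothComp φ hφ fun j => L j t z) t z τ v =
      ∑ i, (smoothComp (pderiv φ i) (contDiff_pderiv hφ i) fun j => L j t z) *
        dirDeriv (L i) t z τ v := by
  refine (IsLocal.smoothComp φ hφ hL).dirDeriv_eq fun x => ?_
  have h1 := hasDerivAt_pi.2 fun j => (hL j).hasDerivAt t z τ v x
  have h2 := (hφ.differentiable (by simp) fun j => L j (t + 0 * τ) (z + (0 : ℝ) • v) x).hasFDerivAt
  have h3 := h2.comp_hasDerivAt (0 : ℝ) h1
  refine h3.congr_deriv ?_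
  rw [fderiv_eq_sum_pderiv]
  simp

theorem dirDeriv_add_fn {L L' : Density n M ι} (hL : IsLocal L) (hL' : IsLocal L') (t : ℝ)
    (z : Config n M ι) (τ : ℝ) (v : Config n M ι) :
    dirDeriv (fun t z => L t z + L' t z) t z τ v = dirDeriv L t z τ v + dirDeriv L' t z τ v :=
  (hL.add hL').dirDeriv_eq fun x => (hL.hasDerivAt t z τ v x).add (hL'.hasDerivAt t z τ v x)

theorem dirDeriv_sub_fn {L L' : Density n M ι} (hL : IsLocal L) (hL' : IsLocal L') (t : ℝ)
    (z : Config n M ι) (τ : ℝ) (v : Config n M ι) :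
    dirDeriv (fun t z => L t z - L' t z) t z τ v = dirDeriv L t z τ v - dirDeriv L' t z τ v :=
  (hL.sub hL').dirDeriv_eq fun x => (hL.hasDerivAt t z τ v x).sub (hL'.hasDerivAt t z τ v x)

theorem dirDeriv_smul_fn {L : Density n M ι} (r : ℝ) (hL : IsLocal L) (t : ℝ)
    (z : Config n M ι) (τ : ℝ) (v : Config n M ι) :
    dirDeriv (fun t z => r • L t z) t z τ v = r • dirDeriv L t z τ v :=
  (hL.smul r).dirDeriv_eq fun x => (hL.hasDerivAt t z τ v x).const_mul r

theorem dirDeriv_mul_fn {L L' : Density n M ι} (hL : IsLocal L) (hL' : IsLocal L') (t : ℝ)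
    (z : Config n M ι) (τ : ℝ) (v : Config n M ι) :
    dirDeriv (fun t z => L t z * L' t z) t z τ v =
      dirDeriv L t z τ v * L' t z + L t z * dirDeriv L' t z τ v := by
  refine (hL.mul hL').dirDeriv_eq fun x => ?_
  exact ((hL.hasDerivAt t z τ v x).mul (hL'.hasDerivAt t z τ v x)).congr_deriv (by simp)

theorem dirDeriv_sum_fn {J : Type*} [Fintype J] {L : J → Density n M ι}
    (hL : ∀ j, IsLocal (L j)) (t : ℝ) (z : Config n M ι) (τ : ℝ) (v : Config n M ι) :
    dirDeriv (fun t z => ∑ j, L j t z) t z τ v = ∑ j, dirDeriv (L j) t z τ v := by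
  refine (IsLocal.sum_finset hL).dirDeriv_eq fun x => ?_
  simpa using HasDerivAt.fun_sum (u := Finset.univ) fun j _ => (hL j).hasDerivAt t z τ v x

/-! The derivative in the direction of `(τ, v)` commutes with the derivatives along vector fields.
This is shown on functions `φ(a₁, …, a_m)` of jet coordinates, where it amounts to the symmetry
of the second derivatives of `φ`; every local function has this form. -/

/-- The iterated derivatives `X₁ ⋯ X_k z^A` of the fields. -/
inductive IsJet : Density n M ι → Prop
  | field (A : ι) : IsJet fun _ z => z A
  | deriv (X : VField n M) (L : Density n M ι) (hL : IsJet L) : IsJet fun t z => X.apply (L t z)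

/-- The jet coordinates: the time, the functions on `M`, and the iterated derivatives of the
fields. -/
inductive IsJetCoord : Density n M ι → Prop
  | time : IsJetCoord fun t _ => algebraMap ℝ (SmoothFn n M) t
  | point (a : SmoothFn n M) : IsJetCoord fun _ _ => a
  | jet (L : Density n M ι) (hL : IsJet L) : IsJetCoord L

theorem IsJet.isLocal {L : Density n M ι} (hL : IsJet L) : IsLocal L := by
  induction hL with
  | field A => exact .field A
  | deriv X L hL ih => exact .deriv X L ih

theorem IsJetCoord.isLocal {L : Density n M ι} (hL : IsJetCoord L) : IsLocal L := by
  cases hL with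
  | time => exact .time
  | point a => exact .point a
  | jet _ hL => exact hL.isLocal

theorem IsJet.line {L : Density n M ι} (hL : IsJet L) (t t' : ℝ) (z v : Config n M ι) (s : ℝ) :
    L t (z + s • v) = L t' z + s • L t' v := by
  induction hL with
  | field A => rfl
  | deriv X L hL ih => simp only [ih, X.apply_add, X.apply_smul]

theorem IsJet.dirDeriv {L : Density n M ι} (hL : IsJet L) (t : ℝ) (z : Config n M ι) (τ : ℝ)
    (v : Config n M ι) : dirDeriv L t z τ v = L t v := by
  refine hL.isLocal.dirDeriv_eq fun x => ?_
  simp only [hL.line _ t z v]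
  simpa using ((hasDerivAt_id (0 : ℝ)).mul_const (L t v x)).const_add (L t z x)

theorem IsJetCoord.apply {L : Density n M ι} (hL : IsJetCoord L) (X : VField n M) :
    IsJetCoord fun t z => X.apply (L t z) := by
  cases hL with
  | time => simpa only [X.apply_algebraMap] using IsJetCoord.point 0
  | point a => exact .point _
  | jet _ hL => exact .jet _ (.deriv X _ hL)

theorem IsJetCoord.dirDeriv_apply {L : Density n M ι} (hL : IsJetCoord L) (X : VField n M) (t : ℝ)
    (z : Config n M ι) (τ : ℝ) (v : Config n M ι) :
    dirDeriv (fun t z => X.apply (L t z)) t z τ v = X.apply (dirDeriv L t z τ v) := by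
  cases hL with
  | time => simp only [X.apply_algebraMap, dirDeriv_time, dirDeriv_point]
  | point a => simp only [dirDeriv_point, X.apply_zero]
  | jet _ hL => rw [hL.dirDeriv, (IsJet.deriv X _ hL).dirDeriv]

/-- Every local function is a smooth function of finitely many jet coordinates. Derivatives along
vector fields can be eliminated because they act on the jet coordinates by the chain rule. -/
theorem IsLocal.exists_jetCoord {L : Density n M ι} (hL : IsLocal L) :
    ∃ (J : Type) (_ : Fintype J) (φ : (J → ℝ) → ℝ) (hφ : ContDiff ℝ ∞ φ) (a : J → Density n M ι),
      (∀ j, IsJetCoord (a j)) ∧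
        L = fun t z => BoundarySources.smoothComp φ hφ fun j => a j t z := by
  have key : ∀ L : Density n M ι, IsJetCoord L → ∃ (J : Type) (_ : Fintype J) (φ : (J → ℝ) → ℝ)
      (hφ : ContDiff ℝ ∞ φ) (a : J → Density n M ι), (∀ j, IsJetCoord (a j)) ∧
        L = fun t z => BoundarySources.smoothComp φ hφ fun j => a j t z := fun L h =>
    ⟨Unit, inferInstance, fun y => y (), contDiff_apply ℝ ℝ (), fun _ => L, fun _ => h, rfl⟩
  induction hL with
  | time => exact key _ .time
  | point a => exact key _ (.point a)
  | field A => exact key _ (.jet _ (.field A))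
  | deriv X L hL ih =>
    obtain ⟨J, _, φ, hφ, a, ha, rfl⟩ := ih
    refine ⟨J ⊕ J, inferInstance,
      fun y => ∑ i, pderiv φ i (fun j => y (Sum.inl j)) * y (Sum.inr i),
      ContDiff.sum fun i _ => ((contDiff_pderiv hφ i).comp
        (contDiff_pi.2 fun j => contDiff_apply ℝ ℝ (Sum.inl j))).mul
          (contDiff_apply ℝ ℝ (Sum.inr i)),
      Sum.elim a fun j t z => X.apply (a j t z), ?_, ?_⟩
    · rintro (j | j)
      · exact ha j
      · exact (ha j).apply X
    · ext t z x
      simp [X.apply_smoothComp]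
  | @comp m φ hφ L hL ih =>
    choose J _ ψ hψ a ha h using ih
    refine ⟨Σ i, J i, inferInstance, fun y => φ fun i => ψ i fun j => y ⟨i, j⟩,
      hφ.comp (contDiff_pi.2 fun i => (hψ i).comp
        (contDiff_pi.2 fun j => contDiff_apply ℝ ℝ (⟨i, j⟩ : Σ i, J i))),
      fun p => a p.1 p.2, fun p => ha _ _, ?_⟩
    ext t z x
    change (φ fun i => L i t z x) = _
    simp only [h]
    rfl

/-- The variation of the fields commutes with the spatial derivatives. By the chain rule this
reduces to the symmetry of the second derivatives of a function of jet coordinates. -/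
theorem IsLocal.dirDeriv_vfield {L : Density n M ι} (hL : IsLocal L) (X : VField n M) (t : ℝ)
    (z : Config n M ι) (τ : ℝ) (v : Config n M ι) :
    dirDeriv (fun t z => X.apply (L t z)) t z τ v = X.apply (dirDeriv L t z τ v) := by
  obtain ⟨J, _, φ, hφ, a, ha, rfl⟩ := hL.exists_jetCoord
  have hl := fun j => (ha j).isLocal
  have hp := fun i => IsLocal.smoothComp (pderiv φ i) (contDiff_pderiv hφ i) hl
  have hX := fun i => ((ha i).apply X).isLocal
  simp only [X.apply_smoothComp, dirDeriv_smoothComp φ hφ hl, X.apply_sum, X.apply_mul,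
    dirDeriv_sum_fn fun i => (hp i).mul (hX i), dirDeriv_mul_fn (hp _) (hX _),
    dirDeriv_smoothComp _ (contDiff_pderiv hφ _) hl, (ha _).dirDeriv_apply X,
    Finset.sum_add_distrib, Finset.sum_mul]
  congr 1
  rw [Finset.sum_comm]
  refine Finset.sum_congr rfl fun i _ => Finset.sum_congr rfl fun j _ => ?_
  ext x
  simp only [smoothFn_mul_apply, smoothComp_apply, pderiv_comm hφ i j]
  ring

theorem dirDeriv_compFn {m : ℕ} (φ : (Fin m → ℝ) → ℝ) (hφ : ContDiff ℝ ∞ φ)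
    {L : Fin m → Density n M ι} (hL : ∀ j, IsLocal (L j)) (t : ℝ) (z : Config n M ι) (τ : ℝ)
    (v : Config n M ι) :
    dirDeriv (fun t z => compFn φ hφ fun j => L j t z) t z τ v =
      ∑ i, (compFn (pderiv φ i) (contDiff_pderiv hφ i) fun j => L j t z) *
        dirDeriv (L i) t z τ v :=
  dirDeriv_smoothComp φ hφ hL t z τ v

theorem IsLocal.dirDeriv_add {L : Density n M ι} (hL : IsLocal L) (t : ℝ) (z : Config n M ι)
    (τ τ' : ℝ) (v v' : Config n M ι) :
    dirDeriv L t z (τ + τ') (v + v') = dirDeriv L t z τ v + dirDeriv L t z τ' v' := by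
  induction hL with
  | time => simp only [dirDeriv_time, map_add]
  | point a => simp only [dirDeriv_point, add_zero]
  | field A => simp only [dirDeriv_field, Pi.add_apply]
  | deriv X L hL ih => simp only [hL.dirDeriv_vfield, ih, X.apply_add]
  | comp φ hφ L hL ih =>
    simp only [dirDeriv_compFn φ hφ hL, ih, mul_add, Finset.sum_add_distrib]

theorem IsLocal.dirDeriv_smul {L : Density n M ι} (hL : IsLocal L) (t : ℝ) (z : Config n M ι)
    (r τ : ℝ) (v : Config n M ι) :
    dirDeriv L t z (r * τ) (r • v) = r • dirDeriv L t z τ v := by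
  induction hL with
  | time => ext x; simp [dirDeriv_time]
  | point a => simp only [dirDeriv_point, smul_zero]
  | field A => simp only [dirDeriv_field, Pi.smul_apply]
  | deriv X L hL ih => simp only [hL.dirDeriv_vfield, ih, X.apply_smul]
  | comp φ hφ L hL ih =>
    simp only [dirDeriv_compFn φ hφ hL, ih, mul_smul_comm, Finset.smul_sum]

theorem IsLocal.dirDeriv_sub {L : Density n M ι} (hL : IsLocal L) (t : ℝ) (z : Config n M ι)
    (τ τ' : ℝ) (v v' : Config n M ι) :
    dirDeriv L t z (τ - τ') (v - v') = dirDeriv L t z τ v - dirDeriv L t z τ' v' := by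
  have h := hL.dirDeriv_add t z (τ - τ') τ' (v - v') v'
  simp only [sub_add_cancel] at h
  rw [h, add_sub_cancel_right]

theorem IsLocal.dirDeriv_zero {L : Density n M ι} (hL : IsLocal L) (t : ℝ) (z : Config n M ι) :
    dirDeriv L t z 0 0 = 0 := by
  simpa using hL.dirDeriv_smul t z 0 0 0

/-- The derivative of a local function vanishes wherever the variation of the fields vanishes. -/
theorem IsLocal.dirDeriv_eq_zero_of_eqOn {L : Density n M ι} (hL : IsLocal L) (t : ℝ)
    (z h : Config n M ι) {U : Set M} (hU : IsOpen U) (hh : ∀ A, ∀ x ∈ U, h A x = 0) :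
    ∀ x ∈ U, dirDeriv L t z 0 h x = 0 := by
  induction hL with
  | time => simp [dirDeriv_time]
  | point a => simp [dirDeriv_point]
  | field A => simpa [dirDeriv_field] using hh A
  | deriv X L hL ih =>
    rw [hL.dirDeriv_vfield]
    exact X.apply_eq_zero_of_eqOn hU ih
  | comp φ hφ L hL ih =>
    intro x hx
    rw [dirDeriv_compFn φ hφ hL, smoothFn_sum_apply]
    exact Finset.sum_eq_zero fun i _ => by rw [smoothFn_mul_apply, ih i x hx, mul_zero]

/-- The derivation `τ ∂_t + δ_Q` of the local functions. -/
def dvary (τ : ℝ) (Q : Variation n M ι) (L : Density n M ι) : Density n M ι :=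
  fun t z => dirDeriv L t z τ (Q t z)

theorem vary_eq_dvary (Q : Variation n M ι) (L : Density n M ι) : vary Q L = dvary 0 Q L := rfl

theorem IsLocal.dvary (τ : ℝ) {Q : Variation n M ι} (hQ : IsLocalVariation Q) {L : Density n M ι}
    (hL : IsLocal L) : IsLocal (dvary τ Q L) := by
  unfold BoundarySources.dvary
  induction hL with
  | time => simpa only [dirDeriv_time] using IsLocal.const τ
  | point a => simpa only [dirDeriv_point] using IsLocal.point 0
  | field A => simpa only [dirDeriv_field] using hQ A
  | deriv X L hL ih =>
    simp only [hL.dirDeriv_vfield]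
    exact .deriv X _ ih
  | comp φ hφ L hL ih =>
    simp only [dirDeriv_compFn φ hφ hL]
    exact IsLocal.sum fun i => (IsLocal.comp _ (contDiff_pderiv hφ i) L hL).mul (ih i)

theorem isLocalVariation_const (v : Config n M ι) : IsLocalVariation fun _ _ => v :=
  fun A => .point (v A)

/-- The derivation `τ ∂_t + δ_Q` acting on the components of a variation. -/
def dvaryV (τ : ℝ) (Q R : Variation n M ι) : Variation n M ι :=
  fun t z A => dirDeriv (fun t z => R t z A) t z τ (Q t z)

theorem IsLocalVariation.dvaryV (τ : ℝ) {Q R : Variation n M ι} (hQ : IsLocalVariation Q)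
    (hR : IsLocalVariation R) : IsLocalVariation (dvaryV τ Q R) :=
  fun A => (hR A).dvary τ hQ

theorem IsLocalVariation.add {Q R : Variation n M ι} (hQ : IsLocalVariation Q)
    (hR : IsLocalVariation R) : IsLocalVariation (Q + R) := fun A => (hQ A).add (hR A)

theorem IsLocalVariation.sub {Q R : Variation n M ι} (hQ : IsLocalVariation Q)
    (hR : IsLocalVariation R) : IsLocalVariation (Q - R) := fun A => (hQ A).sub (hR A)

theorem IsLocalVariation.smul (r : ℝ) {Q : Variation n M ι} (hQ : IsLocalVariation Q) :
    IsLocalVariation (r • Q) := fun A => (hQ A).smul r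

theorem commutator_eq (Q R : Variation n M ι) :
    commutator Q R = dvaryV 0 Q R - dvaryV 0 R Q := rfl

/-- The commutator of two derivations `τ ∂_t + δ_Q` and `τ' ∂_t + δ_R` is a variation. -/
theorem IsLocal.dvary_comm {L : Density n M ι} (hL : IsLocal L) (τ τ' : ℝ) {Q R : Variation n M ι}
    (hQ : IsLocalVariation Q) (hR : IsLocalVariation R) (t : ℝ) (z : Config n M ι) :
    BoundarySources.dvary τ Q (BoundarySources.dvary τ' R L) t z -
      BoundarySources.dvary τ' R (BoundarySources.dvary τ Q L) t z =
        BoundarySources.dvary 0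
          (BoundarySources.dvaryV τ Q R - BoundarySources.dvaryV τ' R Q) L t z := by
  unfold BoundarySources.dvary
  induction hL with
  | time => simp only [dirDeriv_time, dirDeriv_point, sub_self, map_zero]
  | point a => simp only [dirDeriv_point, sub_self]
  | field A =>
    simp only [dirDeriv_field]
    rfl
  | deriv X L hL ih =>
    simp only [hL.dirDeriv_vfield]
    have h1 := (hL.dvary τ hQ).dirDeriv_vfield X t z τ' (R t z)
    have h2 := (hL.dvary τ' hR).dirDeriv_vfield X t z τ (Q t z)
    unfold BoundarySources.dvary at h1 h2
    rw [h1, h2, ← X.apply_sub, ih]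
  | comp φ hφ L hL ih =>
    have hp := fun i => IsLocal.comp _ (contDiff_pderiv hφ i) L hL
    have hdQ := fun i => (hL i).dvary τ hQ
    have hdR := fun i => (hL i).dvary τ' hR
    unfold BoundarySources.dvary at hdQ hdR
    simp only [dirDeriv_compFn φ hφ hL, dirDeriv_sum_fn fun i => (hp i).mul (hdQ i),
      dirDeriv_sum_fn fun i => (hp i).mul (hdR i), dirDeriv_mul_fn (hp _) (hdQ _),
      dirDeriv_mul_fn (hp _) (hdR _), dirDeriv_compFn _ (contDiff_pderiv hφ _) hL,
      Finset.sum_add_distrib, ← ih, mul_sub, Finset.sum_sub_distrib, Finset.sum_mul]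
    rw [add_sub_add_comm, add_eq_right, sub_eq_zero, Finset.sum_comm]
    refine Finset.sum_congr rfl fun i _ => Finset.sum_congr rfl fun j _ => ?_
    rw [show (compFn (pderiv (pderiv φ j) i) (contDiff_pderiv (contDiff_pderiv hφ j) i)
      fun j => L j t z) = compFn (pderiv (pderiv φ i) j)
        (contDiff_pderiv (contDiff_pderiv hφ i) j) fun j => L j t z by
      ext x; change pderiv (pderiv φ j) i _ = pderiv (pderiv φ i) j _; rw [pderiv_comm hφ]]
    ring

end LocalCalculus

/-! ### Integrals depending smoothly on parameters -/

section Parametric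

variable {E E' : Type} [NormedAddCommGroup E] [NormedSpace ℝ E] [FiniteDimensional ℝ E]
  [NormedAddCommGroup E'] [NormedSpace ℝ E'] [FiniteDimensional ℝ E']
  [MeasurableSpace E'] [BorelSpace E'] {ν : Measure E'} [IsFiniteMeasure ν] {K : Set E'}

/-- Differentiation under the integral sign, for a finite measure concentrated on a compact set. -/
theorem hasFDerivAt_integral_of_contDiff (hK : IsCompact K) (hν : ν Kᶜ = 0) {F : Type}
    [NormedAddCommGroup F] [NormedSpace ℝ F] {Φ : E × E' → F} (hΦ : ContDiff ℝ 1 Φ) (p : E) :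
    HasFDerivAt (fun p => ∫ y, Φ (p, y) ∂ν)
      (∫ y, (fderiv ℝ Φ (p, y)).comp (ContinuousLinearMap.inl ℝ E E') ∂ν) p := by
  have hfin := FiniteDimensional.proper ℝ E
  have hc : Continuous fun q : E × E' =>
      (fderiv ℝ Φ q).comp (ContinuousLinearMap.inl ℝ E E') :=
    (hΦ.continuous_fderiv (by simp)).clm_comp continuous_const
  have hKae : ∀ᵐ y ∂ν, y ∈ K := hν
  have hsm : ∀ {G : Type} [NormedAddCommGroup G] {f : E' → G}, Continuous f →
      AEStronglyMeasurable f ν := fun hf => by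
    have := FiniteDimensional.proper ℝ E'
    exact hf.aestronglyMeasurable
  obtain ⟨C, hC⟩ := ((isCompact_closedBall p 1).prod hK).exists_bound_of_continuousOn
    hc.continuousOn
  obtain ⟨C', hC'⟩ := (isCompact_singleton (x := p).prod hK).exists_bound_of_continuousOn
    hΦ.continuous.continuousOn
  refine hasFDerivAt_integral_of_dominated_of_fderiv_le (bound := fun _ => C)
    (F' := fun p y => (fderiv ℝ Φ (p, y)).comp (ContinuousLinearMap.inl ℝ E E'))
    (Metric.ball_mem_nhds p one_pos) (Filter.Eventually.of_forall fun q => ?_) ?_ ?_ ?_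
    (integrable_const C) ?_
  · exact hsm (hΦ.continuous.comp (by fun_prop))
  · refine Integrable.of_bound (hsm (hΦ.continuous.comp (by fun_prop))) C' ?_
    filter_upwards [hKae] with y hy using hC' (p, y) ⟨rfl, hy⟩
  · exact hsm (hc.comp (by fun_prop))
  · filter_upwards [hKae] with y hy q hq
    exact hC (q, y) ⟨Metric.ball_subset_closedBall hq, hy⟩
  · refine Filter.Eventually.of_forall fun y q _ => ?_
    have h1 := ((hΦ.differentiable (by simp)) (q, y)).hasFDerivAt
    exact h1.comp q (hasFDerivAt_prodMk_left q y)

theorem contDiff_integral_of_contDiff (hK : IsCompact K) (hν : ν Kᶜ = 0) {F : Type}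
    [NormedAddCommGroup F] [NormedSpace ℝ F] {Φ : E × E' → F} (hΦ : ContDiff ℝ ∞ Φ) :
    ContDiff ℝ ∞ fun p => ∫ y, Φ (p, y) ∂ν := by
  have key : ∀ (k : ℕ) {F : Type} [NormedAddCommGroup F] [NormedSpace ℝ F] {Φ : E × E' → F},
      ContDiff ℝ ∞ Φ → ContDiff ℝ k fun p => ∫ y, Φ (p, y) ∂ν := by
    intro k
    induction k with
    | zero =>
      intro F _ _ Φ hΦ
      refine contDiff_zero.2 (continuous_iff_continuousAt.2 fun p => ?_)
      exact (hasFDerivAt_integral_of_contDiff hK hν (hΦ.of_le (by norm_cast)) p).continuousAt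
    | succ k ih =>
      intro F _ _ Φ hΦ
      have hd := hasFDerivAt_integral_of_contDiff hK hν (hΦ.of_le (by norm_cast))
      refine (contDiff_succ_iff_hasFDerivAt (n := k)).2 ⟨_, ?_, hd⟩
      exact ih (Φ := fun q => (fderiv ℝ Φ q).comp (ContinuousLinearMap.inl ℝ E E'))
        ((hΦ.fderiv_right (m := ∞) (by simp)).clm_comp contDiff_const)
  exact contDiff_infty.2 fun k => key k hΦ

end Parametric

section Families

variable {n : ℕ} [NeZero n] {M : Type*} [TopologicalSpace M]
  [ChartedSpace (EuclideanHalfSpace n) M] [IsManifold (𝓡∂ n) ∞ M] {ι : Type*}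

/-- Smooth one-parameter families of local functions. -/
def IsLocalFamily (P : ℝ → Density n M ι) : Prop :=
  ∃ (J : Type) (_ : Fintype J) (φ : (J → ℝ) × ℝ → ℝ) (_ : ContDiff ℝ ∞ φ) (a : J → Density n M ι),
    (∀ j, IsLocal (a j)) ∧ ∀ s t z x, P s t z x = φ (fun j => a j t z x, s)

theorem IsLocalFamily.mul {P P' : ℝ → Density n M ι} (hP : IsLocalFamily P)
    (hP' : IsLocalFamily P') : IsLocalFamily fun s t z => P s t z * P' s t z := by
  obtain ⟨J, _, φ, hφ, a, ha, h⟩ := hP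
  obtain ⟨J', _, φ', hφ', a', ha', h'⟩ := hP'
  refine ⟨J ⊕ J', inferInstance,
    fun q => φ (fun j => q.1 (Sum.inl j), q.2) * φ' (fun j => q.1 (Sum.inr j), q.2), ?_,
    Sum.elim a a', ?_, ?_⟩
  · exact (hφ.comp ((contDiff_pi.2 fun j => (contDiff_apply ℝ ℝ _).comp contDiff_fst).prodMk
      contDiff_snd)).mul (hφ'.comp ((contDiff_pi.2 fun j =>
        (contDiff_apply ℝ ℝ _).comp contDiff_fst).prodMk contDiff_snd))
  · rintro (j | j)
    exacts [ha j, ha' j]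
  · intro s t z x
    simp [h, h']

theorem IsLocalFamily.continuous {P : ℝ → Density n M ι} (hP : IsLocalFamily P) (t : ℝ)
    (z : Config n M ι) (x : M) : Continuous fun s => P s t z x := by
  obtain ⟨J, _, φ, hφ, a, ha, h⟩ := hP
  simp only [h]
  exact hφ.continuous.comp (by fun_prop)

theorem IsLocalFamily.vfield {P : ℝ → Density n M ι} (hP : IsLocalFamily P) (X : VField n M) :
    IsLocalFamily fun s t z => X.apply (P s t z) := by
  obtain ⟨J, _, φ, hφ, a, ha, h⟩ := hP
  refine ⟨J ⊕ J, inferInstance, fun q => fderiv ℝ φ (fun j => q.1 (Sum.inl j), q.2)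
    (fun j => q.1 (Sum.inr j), 0), ?_, Sum.elim a fun j t z => X.apply (a j t z), ?_, ?_⟩
  · exact (((hφ.fderiv_right (m := ∞) (by simp)).comp
      ((contDiff_pi.2 fun j => (contDiff_apply ℝ ℝ _).comp contDiff_fst).prodMk
        contDiff_snd)).clm_apply
      ((contDiff_pi.2 fun j => (contDiff_apply ℝ ℝ _).comp contDiff_fst).prodMk contDiff_const))
  · rintro (j | j)
    exacts [ha j, .deriv X _ (ha j)]
  · intro s t z x
    have hs : ContDiff ℝ ∞ fun y => φ (y, s) := hφ.comp (contDiff_prodMk_left s)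
    have hPs : P s t z = smoothComp _ hs fun j => a j t z := by
      ext x; simp [h]
    have hd : HasFDerivAt (fun y => φ (y, s)) _ fun j => a j t z x :=
      ((hφ.differentiable (by simp)) (fun j => a j t z x, s)).hasFDerivAt.comp
        (f := fun y => (y, s)) (fun j => a j t z x) (hasFDerivAt_prodMk_left _ s)
    simp only [hPs, X.apply_smoothComp, smoothFn_sum_apply, smoothFn_mul_apply, smoothComp_apply]
    rw [← fderiv_eq_sum_pderiv (fun y => φ (y, s)) _ fun i => X.apply (a i t z) x, hd.fderiv]
    rfl

/-- Jet coordinates are homogeneous of degree zero or one in the fields. -/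
theorem IsJetCoord.homogeneous {L : Density n M ι} (hL : IsJetCoord L) :
    ∃ ε : ℝ, (∀ (t : ℝ) (z : Config n M ι) (s : ℝ), L t (s • z) = (1 - ε + ε * s) • L t z) ∧
      ∀ t (z z' : Config n M ι), dirDeriv L t z' 0 z = ε • L t z := by
  cases hL with
  | time => exact ⟨0, fun t z s => by simp, fun t z z' => by simp [dirDeriv_time]⟩
  | point a => exact ⟨0, fun t z s => by simp, fun t z z' => by simp [dirDeriv_point]⟩
  | jet _ hL =>
    refine ⟨1, fun t z s => ?_, fun t z z' => by rw [hL.dirDeriv, one_smul]⟩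
    have h0 := hL.line t t 0 0 1
    have h1 := hL.line t t 0 z s
    simp only [zero_add, one_smul, left_eq_add] at h0 h1
    rw [h1, h0]
    simp

/-- The pull-back of a local function by the homotopy `z ↦ s z` of the fields. -/
theorem IsLocal.isLocalFamily_scale {L : Density n M ι} (hL : IsLocal L) :
    IsLocalFamily fun s t z => L t (s • z) := by
  obtain ⟨J, _, φ, hφ, a, ha, rfl⟩ := hL.exists_jetCoord
  choose ε hε _ using fun j => (ha j).homogeneous
  refine ⟨J, inferInstance, fun q => φ fun j => (1 - ε j + ε j * q.2) * q.1 j, ?_, a,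
    fun j => (ha j).isLocal, fun s t z x => ?_⟩
  · refine hφ.comp (contDiff_pi.2 fun j => ?_)
    exact (contDiff_const.add (contDiff_const.mul contDiff_snd)).mul
      ((contDiff_apply ℝ ℝ j).comp contDiff_fst)
  · simp [hε]

/-- The derivative of a local function along the homotopy `z ↦ s z` of the fields. -/
theorem IsLocal.isLocalFamily_dirDeriv_scale {L : Density n M ι} (hL : IsLocal L) :
    IsLocalFamily fun s t z => dirDeriv L t (s • z) 0 z := by
  obtain ⟨J, _, φ, hφ, a, ha, rfl⟩ := hL.exists_jetCoord
  choose ε hε hε' using fun j => (ha j).homogeneous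
  refine ⟨J, inferInstance, fun q => ∑ i,
    pderiv φ i (fun j => (1 - ε j + ε j * q.2) * q.1 j) * (ε i * q.1 i), ?_, a,
    fun j => (ha j).isLocal, fun s t z x => ?_⟩
  · refine ContDiff.sum fun i _ => ((contDiff_pderiv hφ i).comp (contDiff_pi.2 fun j => ?_)).mul
      (contDiff_const.mul ((contDiff_apply ℝ ℝ i).comp contDiff_fst))
    exact (contDiff_const.add (contDiff_const.mul contDiff_snd)).mul
      ((contDiff_apply ℝ ℝ j).comp contDiff_fst)
  · have := dirDeriv_smoothComp φ hφ (fun j => (ha j).isLocal) t (s • z) 0 z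
    dsimp only
    rw [this]
    simp [hε, hε', mul_left_comm]

/-- The integral over the parameter of a family of local functions is local, and the integration
commutes with the derivatives along vector fields. -/
theorem IsLocalFamily.exists_integral {P : ℝ → Density n M ι} (hP : IsLocalFamily P) :
    ∃ L : Density n M ι, IsLocal L ∧ (∀ t z x, L t z x = ∫ s in (0 : ℝ)..1, P s t z x) ∧
      ∀ (X : VField n M) t z x,
        X.apply (L t z) x = ∫ s in (0 : ℝ)..1, X.apply (P s t z) x := by
  obtain ⟨J, _, φ, hφ, a, ha, h⟩ := hP
  have hν : (volume.restrict (Set.uIoc (0 : ℝ) 1)) (Set.Icc 0 1)ᶜ = 0 := by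
    rw [Measure.restrict_apply measurableSet_Icc.compl, Set.uIoc_of_le zero_le_one]
    convert measure_empty (μ := volume)
    ext x
    simp only [Set.mem_inter_iff, Set.mem_compl_iff, Set.mem_Icc, Set.mem_Ioc,
      Set.mem_empty_iff_false, iff_false]
    rintro ⟨h1, h2, h3⟩
    exact h1 ⟨h2.le, h3⟩
  have hfin : IsFiniteMeasure (volume.restrict (Set.uIoc (0 : ℝ) 1)) :=
    ⟨by simp⟩
  have hψ := contDiff_integral_of_contDiff isCompact_Icc hν hφ
  have hψ' := hasFDerivAt_integral_of_contDiff isCompact_Icc hν (hφ.of_le (by norm_cast))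
  refine ⟨_, IsLocal.smoothComp _ hψ ha, fun t z x => ?_, fun X t z x => ?_⟩
  · rw [intervalIntegral.integral_of_le zero_le_one, ← Set.uIoc_of_le zero_le_one]
    simp only [h, smoothComp_apply]
  · have hs : ∀ s, ContDiff ℝ ∞ fun y => φ (y, s) := fun s => hφ.comp (contDiff_prodMk_left s)
    have hPs : ∀ s, P s t z = smoothComp _ (hs s) fun j => a j t z := fun s => by
      ext x; simp [h]
    rw [intervalIntegral.integral_of_le zero_le_one, ← Set.uIoc_of_le zero_le_one]
    simp only [hPs, X.apply_smoothComp, smoothFn_sum_apply, smoothFn_mul_apply, smoothComp_apply]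
    have hc : Continuous fun s : ℝ => (fderiv ℝ φ (fun j => a j t z x, s)).comp
        (ContinuousLinearMap.inl ℝ (J → ℝ) ℝ) :=
      ((hφ.continuous_fderiv (by simp)).comp (by fun_prop)).clm_comp continuous_const
    have hint : Integrable (fun s : ℝ => (fderiv ℝ φ (fun j => a j t z x, s)).comp
        (ContinuousLinearMap.inl ℝ (J → ℝ) ℝ)) (volume.restrict (Set.uIoc (0 : ℝ) 1)) := by
      have := hc.intervalIntegrable (μ := volume) 0 1
      rw [intervalIntegrable_iff] at this
      exact this
    rw [← fderiv_eq_sum_pderiv _ _ fun i => X.apply (a i t z) x, (hψ' _).fderiv,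
      ContinuousLinearMap.integral_apply hint]
    congr 1
    ext s
    have hd : HasFDerivAt (fun y => φ (y, s)) _ fun j => a j t z x :=
      ((hφ.differentiable (by simp)) (fun j => a j t z x, s)).hasFDerivAt.comp
        (f := fun y => (y, s)) (fun j => a j t z x) (hasFDerivAt_prodMk_left _ s)
    rw [← fderiv_eq_sum_pderiv (fun y => φ (y, s)) _ fun i => X.apply (a i t z) x, hd.fderiv]

/-- At fixed fields, the time enters a local function smoothly. -/
theorem IsLocal.exists_time_family {L : Density n M ι} (hL : IsLocal L) (z : Config n M ι) :
    ∃ (J : Type) (_ : Fintype J) (φ : ℝ × (J → ℝ) → ℝ) (_ : ContDiff ℝ ∞ φ)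
      (b : J → SmoothFn n M), ∀ t x, L t z x = φ (t, fun j => b j x) := by
  obtain ⟨J, _, φ, hφ, a, ha, rfl⟩ := hL.exists_jetCoord
  have key : ∀ j, ∃ ε : ℝ, ∀ t x, a j t z x = ε * t + a j 0 z x := by
    intro j
    generalize a j = L, ha j = hj
    cases hj with
    | time => exact ⟨1, fun t x => by simp⟩
    | point a => exact ⟨0, fun t x => by simp⟩
    | jet _ hL =>
      refine ⟨0, fun t x => ?_⟩
      have := hL.line t 0 z 0 0
      simp only [smul_zero, add_zero, zero_smul] at this
      rw [this]; simp
  choose ε hε using key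
  refine ⟨J, inferInstance, fun q => φ fun j => ε j * q.1 + q.2 j, ?_, fun j => a j 0 z,
    fun t x => ?_⟩
  · exact hφ.comp (contDiff_pi.2 fun j => (contDiff_const.mul contDiff_fst).add
      ((contDiff_apply ℝ ℝ j).comp contDiff_snd))
  · rw [smoothComp_apply]
    congr 1
    ext j
    exact hε j t x

end Families

/-! ### Measures with a smooth density -/

section SmoothDensity

open Set Topology

variable {n : ℕ} [NeZero n] {M : Type*} [TopologicalSpace M]
  [ChartedSpace (EuclideanHalfSpace n) M] [IsManifold (𝓡∂ n) ∞ M]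

theorem isOpen_manifoldInterior : IsOpen ((𝓡∂ n).interior M) :=
  (𝓡∂ n).isOpen_interior (n := ∞) (by simp)

theorem extChartAt_symm_mem_interior {p : M} {y : EuclideanSpace ℝ (Fin n)}
    (hy : y ∈ (extChartAt (𝓡∂ n) p).target) (hy' : y ∈ interior (range (𝓡∂ n))) :
    (extChartAt (𝓡∂ n) p).symm y ∈ (𝓡∂ n).interior M := by
  have hs := (extChartAt (𝓡∂ n) p).map_target hy
  rw [extChartAt_source] at hs
  refine ((𝓡∂ n).isInteriorPoint_iff_of_mem_atlas (n := ∞) (by simp)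
    (chart_mem_atlas (EuclideanHalfSpace n) p) hs).2 ?_
  change extChartAt (𝓡∂ n) p ((extChartAt (𝓡∂ n) p).symm y) ∈ _
  rw [(extChartAt (𝓡∂ n) p).right_inv hy]
  have := hy
  rw [extChartAt_target] at this
  have h2 := (chartAt (EuclideanHalfSpace n) p).mem_interior_extend_target (I := 𝓡∂ n) this.1
    (by rwa [(𝓡∂ n).right_inv this.2])
  rwa [(𝓡∂ n).right_inv this.2] at h2

theorem extChartAt_mem_interior_target {p x : M} (hx : x ∈ (extChartAt (𝓡∂ n) p).source)
    (hx' : x ∈ (𝓡∂ n).interior M) :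
    extChartAt (𝓡∂ n) p x ∈ interior (extChartAt (𝓡∂ n) p).target := by
  rw [extChartAt_source] at hx
  exact ((𝓡∂ n).isInteriorPoint_iff_of_mem_atlas (n := ∞) (by simp)
    (chart_mem_atlas (EuclideanHalfSpace n) p) hx).1 hx'

theorem exists_mem_interior_nhdsWithin {y : EuclideanSpace ℝ (Fin n)}
    {W : Set (EuclideanSpace ℝ (Fin n))} (hW : W ∈ 𝓝[range (𝓡∂ n)] y) (hy : y ∈ range (𝓡∂ n)) :
    ∃ N, IsOpen N ∧ N.Nonempty ∧ N ⊆ W ∩ interior (range (𝓡∂ n)) := by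
  obtain ⟨N, hN, hyN, hNW⟩ := mem_nhdsWithin.1 hW
  refine ⟨N ∩ interior (range (𝓡∂ n)), hN.inter isOpen_interior, ?_, fun u hu =>
    ⟨hNW ⟨hu.1, interior_subset hu.2⟩, hu.2⟩⟩
  exact mem_closure_iff.1 ((𝓡∂ n).range_subset_closure_interior hy) N hN hyN

theorem preimage_symm_mem_nhdsWithin {p : M} {U : Set M} (hU : IsOpen U) (hp : p ∈ U) :
    (extChartAt (𝓡∂ n) p).target ∩ (extChartAt (𝓡∂ n) p).symm ⁻¹' U ∈
      𝓝[range (𝓡∂ n)] (extChartAt (𝓡∂ n) p p) := by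
  refine Filter.inter_mem (extChartAt_target_mem_nhdsWithin p) ?_
  have h := (continuousAt_extChartAt_symm (I := 𝓡∂ n) p).continuousWithinAt (s := range (𝓡∂ n))
  exact h (by rw [extChartAt_to_inv]; exact hU.mem_nhds hp)

theorem dense_manifoldInterior : Dense ((𝓡∂ n).interior M) := by
  refine dense_iff_inter_open.2 fun U hU ⟨p, hp⟩ => ?_
  obtain ⟨N, _, ⟨y, hy⟩, hN⟩ := exists_mem_interior_nhdsWithin
    (preimage_symm_mem_nhdsWithin (n := n) hU hp) (mem_range_self _)
  exact ⟨_, (hN hy).1.2, extChartAt_symm_mem_interior (hN hy).1.1 (hN hy).2⟩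

theorem measurableSet_extChartAt_target (p : M) :
    MeasurableSet (extChartAt (𝓡∂ n) p).target := by
  rw [extChartAt_target]
  exact (((chartAt (EuclideanHalfSpace n) p).open_target.preimage
    (𝓡∂ n).continuous_symm).measurableSet).inter (𝓡∂ n).isClosed_range.measurableSet

variable [MeasurableSpace M] [BorelSpace M] {μ : Measure M}

theorem aemeasurable_extChartAt (p : M) :
    AEMeasurable (extChartAt (𝓡∂ n) p) (μ.restrict (extChartAt (𝓡∂ n) p).source) :=
  (continuousOn_extChartAt p).aemeasurable (isOpen_extChartAt_source p).measurableSet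

/-- The measure of a set in a chart, in terms of the density. -/
theorem measure_chart_preimage {p : M} {ρ : EuclideanSpace ℝ (Fin n) → ℝ}
    (hρ : (μ.restrict (extChartAt (𝓡∂ n) p).source).map (extChartAt (𝓡∂ n) p) =
      (volume.restrict (extChartAt (𝓡∂ n) p).target).withDensity fun x => ENNReal.ofReal (ρ x))
    {N : Set (EuclideanSpace ℝ (Fin n))} (hN : MeasurableSet N) :
    μ (extChartAt (𝓡∂ n) p ⁻¹' N ∩ (extChartAt (𝓡∂ n) p).source) =
      ∫⁻ y in N ∩ (extChartAt (𝓡∂ n) p).target, ENNReal.ofReal (ρ y) := by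
  have h1 : (μ.restrict (extChartAt (𝓡∂ n) p).source).map (extChartAt (𝓡∂ n) p) N =
      μ (extChartAt (𝓡∂ n) p ⁻¹' N ∩ (extChartAt (𝓡∂ n) p).source) := by
    rw [Measure.map_apply_of_aemeasurable (aemeasurable_extChartAt p) hN,
      Measure.restrict_apply₀' (isOpen_extChartAt_source p).measurableSet.nullMeasurableSet]
  rw [← h1, hρ, withDensity_apply _ hN, Measure.restrict_restrict hN]

theorem IsSmoothDensity.isLocallyFiniteMeasure (hμ : IsSmoothDensity (n := n) μ) :
    IsLocallyFiniteMeasure μ := by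
  refine ⟨fun p => ?_⟩
  obtain ⟨ρ, hρ, hpos, hmap⟩ := hμ p
  have hc : ContinuousWithinAt ρ (extChartAt (𝓡∂ n) p).target (extChartAt (𝓡∂ n) p p) :=
    hρ.continuousOn _ (mem_extChartAt_target p)
  have hb := hc.eventually_lt (continuousWithinAt_const (b := ρ (extChartAt (𝓡∂ n) p p) + 1))
    (by linarith)
  obtain ⟨r, hr, hball⟩ := Metric.mem_nhdsWithin_iff.1 hb
  refine ⟨_, Filter.inter_mem ((continuousAt_extChartAt p).preimage_mem_nhds
    (Metric.ball_mem_nhds (extChartAt (𝓡∂ n) p p) hr))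
    (extChartAt_source_mem_nhds (I := 𝓡∂ n) p), ?_⟩
  rw [measure_chart_preimage hmap Metric.isOpen_ball.measurableSet]
  have hm : MeasurableSet (Metric.ball (extChartAt (𝓡∂ n) p p) r ∩ (extChartAt (𝓡∂ n) p).target) :=
    Metric.isOpen_ball.measurableSet.inter (measurableSet_extChartAt_target p)
  refine (setLIntegral_mono' (g := fun _ => ENNReal.ofReal (ρ (extChartAt (𝓡∂ n) p p) + 1)) hm
    fun y hy => ENNReal.ofReal_le_ofReal (le_of_lt (hball hy))).trans_lt ?_
  rw [setLIntegral_const]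
  exact ENNReal.mul_lt_top ENNReal.ofReal_lt_top
    ((measure_mono inter_subset_left).trans_lt measure_ball_lt_top)

theorem IsSmoothDensity.isOpenPosMeasure (hμ : IsSmoothDensity (n := n) μ) :
    μ.IsOpenPosMeasure := by
  refine ⟨fun U hU ⟨p, hp⟩ h0 => ?_⟩
  obtain ⟨ρ, hρ, hpos, hmap⟩ := hμ p
  obtain ⟨N, hNo, hNn, hN⟩ := exists_mem_interior_nhdsWithin
    (preimage_symm_mem_nhdsWithin (n := n) hU hp) (mem_range_self _)
  have h1 : μ (extChartAt (𝓡∂ n) p ⁻¹' N ∩ (extChartAt (𝓡∂ n) p).source) = 0 := by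
    refine measure_mono_null (fun x hx => ?_) h0
    have := (hN hx.1).1.2
    rwa [mem_preimage, (extChartAt (𝓡∂ n) p).left_inv hx.2] at this
  have hNt : N ⊆ (extChartAt (𝓡∂ n) p).target := fun y hy => (hN hy).1.1
  rw [measure_chart_preimage hmap hNo.measurableSet, inter_eq_left.2 hNt,
    setLIntegral_eq_zero_iff' hNo.measurableSet] at h1
  · have h2 : volume N = 0 := by
      have : ∀ᵐ y, y ∉ N := by
        filter_upwards [h1] with y hy hyN
        have := hy hyN
        simp only [ENNReal.ofReal_eq_zero] at this
        exact absurd this (not_le.2 (hpos y (hNt hyN)))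
      simpa [ae_iff] using this
    exact (hNo.measure_pos volume hNn).ne' h2
  · exact (((hρ.continuousOn.mono hNt).aemeasurable hNo.measurableSet).ennreal_ofReal)

/-- The integral of a function supported in the domain of a chart, in terms of the density. -/
theorem integral_eq_integral_chart {p : M} {ρ : EuclideanSpace ℝ (Fin n) → ℝ}
    (hρ : ContinuousOn ρ (extChartAt (𝓡∂ n) p).target)
    (hpos : ∀ x ∈ (extChartAt (𝓡∂ n) p).target, 0 < ρ x)
    (hmap : (μ.restrict (extChartAt (𝓡∂ n) p).source).map (extChartAt (𝓡∂ n) p) =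
      (volume.restrict (extChartAt (𝓡∂ n) p).target).withDensity fun x => ENNReal.ofReal (ρ x))
    {f : M → ℝ} (hf : Continuous f) (hf0 : ∀ x ∉ (extChartAt (𝓡∂ n) p).source, f x = 0) :
    ∫ x, f x ∂μ = ∫ y in (extChartAt (𝓡∂ n) p).target, ρ y * f ((extChartAt (𝓡∂ n) p).symm y) := by
  have hms := (isOpen_extChartAt_source (I := 𝓡∂ n) p).measurableSet
  have hmt := measurableSet_extChartAt_target (n := n) p
  have hfs : ContinuousOn (fun y => f ((extChartAt (𝓡∂ n) p).symm y))
      (extChartAt (𝓡∂ n) p).target := hf.comp_continuousOn (continuousOn_extChartAt_symm p)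
  rw [← setIntegral_eq_integral_of_forall_compl_eq_zero hf0]
  have h1 : ∫ x in (extChartAt (𝓡∂ n) p).source, f x ∂μ =
      ∫ x in (extChartAt (𝓡∂ n) p).source,
        f ((extChartAt (𝓡∂ n) p).symm (extChartAt (𝓡∂ n) p x)) ∂μ :=
    setIntegral_congr_fun hms fun x hx => by
      rw [(extChartAt (𝓡∂ n) p).left_inv hx]
  rw [h1, ← integral_map (aemeasurable_extChartAt p)
    (f := fun y => f ((extChartAt (𝓡∂ n) p).symm y)), hmap,
    integral_withDensity_eq_integral_toReal_smul₀
      (hρ.aemeasurable hmt).ennreal_ofReal (by simp)]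
  · refine setIntegral_congr_fun hmt fun y hy => ?_
    simp only [smul_eq_mul, ENNReal.toReal_ofReal (hpos y hy).le]
  · rw [hmap]
    exact (hfs.aestronglyMeasurable hmt).mono_ac (withDensity_absolutelyContinuous _ _)

variable [T2Space M] [CompactSpace M]

theorem IsSmoothDensity.isFiniteMeasure (hμ : IsSmoothDensity (n := n) μ) : IsFiniteMeasure μ := by
  have := hμ.isLocallyFiniteMeasure
  infer_instance

theorem IsSmoothDensity.integrable (hμ : IsSmoothDensity (n := n) μ) {f : M → ℝ}
    (hf : Continuous f) : Integrable f μ := by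
  have := hμ.isLocallyFiniteMeasure
  exact hf.integrable_of_hasCompactSupport (HasCompactSupport.of_compactSpace f)

/-- The fundamental lemma of the calculus of variations. -/
theorem IsSmoothDensity.eq_zero_of_integral_mul_eq_zero (hμ : IsSmoothDensity (n := n) μ)
    (f : SmoothFn n M)
    (hf : ∀ h : SmoothFn n M, tsupport h ⊆ (𝓡∂ n).interior M → ∫ x, f x * h x ∂μ = 0) :
    f = 0 := by
  have := hμ.isOpenPosMeasure
  have h0 : EqOn (f : M → ℝ) 0 ((𝓡∂ n).interior M) := by
    intro x hx
    obtain ⟨b, -, hb⟩ := (SmoothBumpFunction.nhds_basis_tsupport (I := 𝓡∂ n) x).mem_iff.1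
      ((isOpen_manifoldInterior (n := n) (M := M)).mem_nhds hx)
    let B : SmoothFn n M := ⟨b, b.contMDiff⟩
    have h1 := hf (B * f) ((closure_mono fun y (hy : (B * f) y ≠ 0) (hb : b y = 0) => hy (by
      change b y * f y = 0
      rw [hb, zero_mul])).trans hb)
    have hnn : 0 ≤ fun y => f y * (B * f) y := fun y => by
      have : f y * (B * f) y = b y * (f y * f y) := by
        change f y * (b y * f y) = _
        ring
      change 0 ≤ f y * (B * f) y
      rw [this]
      exact mul_nonneg b.nonneg (mul_self_nonneg _)
    have h2 := (integral_eq_zero_iff_of_nonneg hnn (hμ.integrable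
      (f.contMDiff.continuous.mul (B * f).contMDiff.continuous))).1 h1
    have h3 := Measure.eq_of_ae_eq h2 (f.contMDiff.continuous.mul (B * f).contMDiff.continuous)
      continuous_zero
    have h4 := congrFun h3 x
    have hb1 : b x = 1 := b.eq_one
    have : f x * (b x * f x) = 0 := h4
    simpa [hb1] using this
  exact DFunLike.coe_injective
    (Continuous.ext_on dense_manifoldInterior f.contMDiff.continuous continuous_zero h0)

end SmoothDensity

/-! ### Divergences -/

section Divergence

open Set Topology

variable {n : ℕ} [NeZero n] {M : Type*} [TopologicalSpace M]
  [ChartedSpace (EuclideanHalfSpace n) M] [IsManifold (𝓡∂ n) ∞ M]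

/-- The coordinate vector field `∂_i` of the chart at `p`, extended by zero. -/
def chartFrame (p : M) (i : Fin n) (x : M) : TangentSpace (𝓡∂ n) x :=
  (trivializationAt (EuclideanSpace ℝ (Fin n)) (TangentSpace (𝓡∂ n)) p).localFrame
    (EuclideanSpace.basisFun (Fin n) ℝ).toBasis i x

/-- The vector field `c ∂_i` in the chart at `p`, for a function `c` supported in the domain of the
chart. -/
def chartField (p : M) (i : Fin n) (c : SmoothFn n M)
    (hc : tsupport c ⊆ (extChartAt (𝓡∂ n) p).source) : VField n M where
  toFun x := c x • chartFrame p i x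
  contMDiff_toFun := by
    have h := (trivializationAt (EuclideanSpace ℝ (Fin n))
      (TangentSpace (𝓡∂ n) : M → Type _) p).contMDiffOn_localFrame_baseSet (I := 𝓡∂ n) ∞
      (EuclideanSpace.basisFun (Fin n) ℝ).toBasis i
    rw [extChartAt_source] at hc
    exact ContMDiffOn.smul_section_of_tsupport c.contMDiff.contMDiffOn
      (chartAt (EuclideanHalfSpace n) p).open_source hc h

/-- The value of `chartFrame`, as a vector in the model space of the preferred chart. -/
def chartFrameVec (p : M) (i : Fin n) (x : M) : EuclideanSpace ℝ (Fin n) := chartFrame p i x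

/-- The derivative of `g` in the chart at `p` is the differential of `g` composed with the change of
frame from the chart at `p` to the preferred chart at `x`. -/
theorem hasFDerivWithinAt_comp_extChartAt_symm (g : SmoothFn n M) {p x : M}
    (hx : x ∈ (extChartAt (𝓡∂ n) p).source) :
    HasFDerivWithinAt (g ∘ (extChartAt (𝓡∂ n) p).symm)
      ((chartDeriv g x).comp ((trivializationAt (EuclideanSpace ℝ (Fin n))
        (TangentSpace (𝓡∂ n)) p).symmL ℝ x : EuclideanSpace ℝ (Fin n) →L[ℝ] _))
      (extChartAt (𝓡∂ n) p).target (extChartAt (𝓡∂ n) p x) := by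
  have hx' := hx
  rw [extChartAt_source] at hx'
  rw [TangentBundle.symmL_trivializationAt hx']
  have h1 := (mdifferentiableWithinAt_extChartAt_symm (I := 𝓡∂ n)
    ((extChartAt (𝓡∂ n) p).map_source hx)).hasMFDerivWithinAt
  have h2 : HasMFDerivAt (𝓡∂ n) 𝓘(ℝ, ℝ) g
      ((extChartAt (𝓡∂ n) p).symm (extChartAt (𝓡∂ n) p x)) _ :=
    (g.contMDiff.mdifferentiableAt (by simp)).hasMFDerivAt
  have h3 := h2.comp_hasMFDerivWithinAt (extChartAt (𝓡∂ n) p x) h1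
  have h4 := (hasMFDerivWithinAt_iff_hasFDerivWithinAt.1 h3).mono
    (extChartAt_target_subset_range p)
  rw [(extChartAt (𝓡∂ n) p).left_inv hx] at h4
  exact h4

theorem chartDeriv_chartFrame (g : SmoothFn n M) {p x : M}
    (hx : x ∈ (extChartAt (𝓡∂ n) p).source) (i : Fin n) :
    chartDeriv g x (chartFrameVec p i x) =
      fderivWithin ℝ (g ∘ (extChartAt (𝓡∂ n) p).symm) (extChartAt (𝓡∂ n) p).target
        (extChartAt (𝓡∂ n) p x) (EuclideanSpace.single i 1) := by
  rw [(hasFDerivWithinAt_comp_extChartAt_symm g hx).fderivWithin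
    (uniqueDiffOn_extChartAt_target p _ ((extChartAt (𝓡∂ n) p).map_source hx))]
  have hx' := hx
  rw [extChartAt_source] at hx'
  have key : chartFrame p i x = (trivializationAt (EuclideanSpace ℝ (Fin n))
      (TangentSpace (𝓡∂ n)) p).symmL ℝ x (EuclideanSpace.single i 1) := by
    unfold chartFrame
    rw [Bundle.Trivialization.localFrame_apply_of_mem_baseSet _ _ hx']
    simp only [Bundle.Trivialization.basisAt, Module.Basis.map_apply,
      OrthonormalBasis.coe_toBasis, EuclideanSpace.basisFun_apply]
    exact ((trivializationAt (EuclideanSpace ℝ (Fin n)) (TangentSpace (𝓡∂ n) : M → Type _)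
      p).symmₗ_apply (R := ℝ) hx' _).symm
  exact congrArg (chartDeriv g x) key

theorem chartField_apply (p : M) (i : Fin n) (c : SmoothFn n M)
    (hc : tsupport c ⊆ (extChartAt (𝓡∂ n) p).source) (g : SmoothFn n M) {x : M}
    (hx : x ∈ (extChartAt (𝓡∂ n) p).source) :
    (chartField p i c hc).apply g x = c x *
      fderivWithin ℝ (g ∘ (extChartAt (𝓡∂ n) p).symm) (extChartAt (𝓡∂ n) p).target
        (extChartAt (𝓡∂ n) p x) (EuclideanSpace.single i 1) := by
  have h : (chartField p i c hc).vec x = c x • chartFrameVec p i x := rfl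
  rw [VField.apply_apply, h, map_smul, chartDeriv_chartFrame g hx, smul_eq_mul]

theorem chartField_apply_of_notMem (p : M) (i : Fin n) (c : SmoothFn n M)
    (hc : tsupport c ⊆ (extChartAt (𝓡∂ n) p).source) (g : SmoothFn n M) {x : M}
    (hx : x ∉ tsupport c) : (chartField p i c hc).apply g x = 0 := by
  have h : (chartField p i c hc).vec x = 0 := by
    change c x • chartFrame p i x = 0
    rw [image_eq_zero_of_notMem_tsupport hx, zero_smul]
  rw [VField.apply_apply, h, map_zero]

/-- Integration by parts in a chart: the total derivative of a function with compact support in the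
interior of the chart has vanishing integral. -/
theorem integral_fderivWithin_target_eq_zero {p : M} {u : EuclideanSpace ℝ (Fin n) → ℝ}
    (hu : ContDiffOn ℝ ∞ u (extChartAt (𝓡∂ n) p).target) {K : Set (EuclideanSpace ℝ (Fin n))}
    (hK : IsCompact K) (hKi : K ⊆ interior (extChartAt (𝓡∂ n) p).target)
    (hu0 : ∀ y ∈ (extChartAt (𝓡∂ n) p).target, y ∉ K → u y = 0) (v : EuclideanSpace ℝ (Fin n)) :
    ∫ y in (extChartAt (𝓡∂ n) p).target,
      fderivWithin ℝ u (extChartAt (𝓡∂ n) p).target y v = 0 := by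
  set T := (extChartAt (𝓡∂ n) p).target
  classical
  let w : EuclideanSpace ℝ (Fin n) → ℝ := K.indicator u
  have hwu : ∀ y ∈ T, w y = u y := fun y hy => by
    by_cases h : y ∈ K
    · exact indicator_of_mem h u
    · rw [hu0 y hy h]; exact indicator_of_notMem h u
  have hw0 : ∀ y ∉ K, w =ᶠ[𝓝 y] 0 := fun y hy => by
    filter_upwards [hK.isClosed.isOpen_compl.mem_nhds hy] with y' hy'
    exact indicator_of_notMem hy' u
  have hw : ContDiff ℝ ∞ w := contDiff_iff_contDiffAt.2 fun y => by
    by_cases h : y ∈ K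
    · have hT : T ∈ 𝓝 y := mem_interior_iff_mem_nhds.1 (hKi h)
      refine (hu.contDiffAt hT).congr_of_eventuallyEq ?_
      filter_upwards [hT] using hwu
    · exact contDiffAt_const.congr_of_eventuallyEq (hw0 y h)
  have hsupp : HasCompactSupport w := HasCompactSupport.intro hK fun y hy =>
    indicator_of_notMem hy u
  have hcd : Continuous fun y => fderiv ℝ w y v :=
    (hw.continuous_fderiv (by simp)).clm_apply continuous_const
  have hsupp' : HasCompactSupport fun y => fderiv ℝ w y v :=
    HasCompactSupport.intro hK fun y hy => by
      rw [(hw0 y hy).fderiv_eq]; simp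
  have h1 := integral_mul_fderiv_eq_neg_fderiv_mul_of_integrable (μ := volume)
    (f := fun _ => (1 : ℝ)) (g := w) (v := v) (by simp)
    (by simpa using hcd.integrable_of_hasCompactSupport hsupp')
    (by simpa using hw.continuous.integrable_of_hasCompactSupport hsupp)
    (fun _ _ => differentiableAt_const _) (fun y _ => hw.differentiable (by simp) y)
  simp only [one_mul, fderiv_fun_const, Pi.zero_apply, zero_apply, zero_mul,
    integral_zero, neg_zero] at h1
  rw [← h1, ← setIntegral_eq_integral_of_forall_compl_eq_zero (s := T)
    (f := fun y => fderiv ℝ w y v)]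
  · refine setIntegral_congr_fun (measurableSet_extChartAt_target (n := n) p) fun y hy => ?_
    rw [← (fderivWithin_congr hwu (hwu y hy)),
      ((hw.differentiable (by simp) y).hasFDerivAt.hasFDerivWithinAt).fderivWithin
        (uniqueDiffOn_extChartAt_target p y hy)]
  · intro y hy
    have : y ∉ K := fun h => hy (interior_subset (hKi h))
    rw [(hw0 y this).fderiv_eq]; simp

/-- Extension by zero of a function which is smooth in a chart. -/
theorem exists_smoothFn_of_chart {p : M} {D : EuclideanSpace ℝ (Fin n) → ℝ}
    (hD : ContDiffOn ℝ ∞ D (extChartAt (𝓡∂ n) p).target) {K : Set M} (hK : IsClosed K)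
    (hKs : K ⊆ (extChartAt (𝓡∂ n) p).source)
    (h0 : ∀ x ∈ (extChartAt (𝓡∂ n) p).source, x ∉ K → D (extChartAt (𝓡∂ n) p x) = 0) :
    ∃ d : SmoothFn n M, tsupport d ⊆ K ∧
      ∀ x ∈ (extChartAt (𝓡∂ n) p).source, d x = D (extChartAt (𝓡∂ n) p x) := by
  classical
  let d : M → ℝ := K.indicator fun x => D (extChartAt (𝓡∂ n) p x)
  have hds : ∀ x ∈ (extChartAt (𝓡∂ n) p).source, d x = D (extChartAt (𝓡∂ n) p x) := fun x hx => by
    by_cases h : x ∈ K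
    · exact indicator_of_mem h _
    · rw [h0 x hx h]; exact indicator_of_notMem h _
  have hdK : tsupport d ⊆ K := closure_minimal (fun x hx => by
    by_contra h
    exact hx (indicator_of_notMem h _)) hK
  refine ⟨⟨d, contMDiff_of_tsupport fun x hx => ?_⟩, hdK, hds⟩
  have hxs := hKs (hdK hx)
  have h1 : ContMDiffOn (𝓡∂ n) 𝓘(ℝ, ℝ) ∞ (D ∘ extChartAt (𝓡∂ n) p)
      (extChartAt (𝓡∂ n) p).source := by
    refine hD.contMDiffOn.comp (t := (extChartAt (𝓡∂ n) p).target) ?_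
      (fun x hx => (extChartAt (𝓡∂ n) p).map_source hx)
    rw [extChartAt_source]
    exact contMDiffOn_extChartAt
  have hs := (isOpen_extChartAt_source (I := 𝓡∂ n) p).mem_nhds hxs
  refine (h1.contMDiffAt hs).congr_of_eventuallyEq ?_
  filter_upwards [hs] with y hy using hds y hy

theorem contDiffOn_comp_extChartAt_symm (g : SmoothFn n M) (p : M) :
    ContDiffOn ℝ ∞ (g ∘ (extChartAt (𝓡∂ n) p).symm) (extChartAt (𝓡∂ n) p).target :=
  (g.contMDiff.comp_contMDiffOn (contMDiffOn_extChartAt_symm p)).contDiffOn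

variable [MeasurableSpace M] [BorelSpace M] {μ : Measure M} [T2Space M] [CompactSpace M]

/-- The divergence of the vector field `c ∂_i` in a chart with density `ρ` is `ρ⁻¹ ∂_i (ρ c)`. -/
theorem exists_isDivergence_chartField {p : M} {ρ : EuclideanSpace ℝ (Fin n) → ℝ}
    (hμ : IsSmoothDensity (n := n) μ)
    (hρ : ContDiffOn ℝ ∞ ρ (extChartAt (𝓡∂ n) p).target)
    (hpos : ∀ x ∈ (extChartAt (𝓡∂ n) p).target, 0 < ρ x)
    (hmap : (μ.restrict (extChartAt (𝓡∂ n) p).source).map (extChartAt (𝓡∂ n) p) =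
      (volume.restrict (extChartAt (𝓡∂ n) p).target).withDensity fun x => ENNReal.ofReal (ρ x))
    (i : Fin n) (c : SmoothFn n M) (hc : tsupport c ⊆ (extChartAt (𝓡∂ n) p).source) :
    ∃ d : SmoothFn n M, IsDivergence μ (chartField p i c hc) d ∧ tsupport d ⊆ tsupport c ∧
      ∀ x ∈ (extChartAt (𝓡∂ n) p).source, d x = (ρ (extChartAt (𝓡∂ n) p x))⁻¹ *
        fderivWithin ℝ (fun y => ρ y * c ((extChartAt (𝓡∂ n) p).symm y))
          (extChartAt (𝓡∂ n) p).target (extChartAt (𝓡∂ n) p x) (EuclideanSpace.single i 1) := by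
  have hU : UniqueDiffOn ℝ (extChartAt (𝓡∂ n) p).target := uniqueDiffOn_extChartAt_target p
  have hρc : ContDiffOn ℝ ∞ (fun y => ρ y * c ((extChartAt (𝓡∂ n) p).symm y))
      (extChartAt (𝓡∂ n) p).target :=
    hρ.mul (contDiffOn_comp_extChartAt_symm c p)
  obtain ⟨d, hdc, hd⟩ := exists_smoothFn_of_chart (p := p) (K := tsupport c)
    (D := fun y => (ρ y)⁻¹ *
      fderivWithin ℝ (fun y => ρ y * c ((extChartAt (𝓡∂ n) p).symm y))
        (extChartAt (𝓡∂ n) p).target y (EuclideanSpace.single i 1))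
    ((hρ.inv fun y hy => (hpos y hy).ne').mul
      ((hρc.fderivWithin hU (m := ∞) (by simp)).clm_apply contDiffOn_const))
    (isClosed_tsupport c) hc (fun x hx hxc => by
      have h0 : (fun y => ρ y * c ((extChartAt (𝓡∂ n) p).symm y))
          =ᶠ[𝓝[(extChartAt (𝓡∂ n) p).target] (extChartAt (𝓡∂ n) p x)] fun _ => 0 := by
        have h1 : ContinuousWithinAt (extChartAt (𝓡∂ n) p).symm (extChartAt (𝓡∂ n) p).target
            (extChartAt (𝓡∂ n) p x) :=
          continuousOn_extChartAt_symm p _ ((extChartAt (𝓡∂ n) p).map_source hx)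
        have h2 := h1.preimage_mem_nhdsWithin (t := (tsupport c)ᶜ)
          ((isClosed_tsupport c).isOpen_compl.mem_nhds (by rwa [(extChartAt (𝓡∂ n) p).left_inv hx]))
        filter_upwards [h2] with y hy
        rw [image_eq_zero_of_notMem_tsupport hy, mul_zero]
      rw [h0.fderivWithin_eq (by rw [(extChartAt (𝓡∂ n) p).left_inv hx,
        image_eq_zero_of_notMem_tsupport hxc, mul_zero])]
      simp)
  refine ⟨d, fun g hg => ?_, hdc, hd⟩
  rw [eq_neg_iff_add_eq_zero, ← integral_add (f := (chartField p i c hc).apply g)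
    (g := fun x => d x * g x) (hμ.integrable (ContMDiffMap.contMDiff _).continuous)
    (hμ.integrable (d.contMDiff.continuous.mul g.contMDiff.continuous))]
  rw [integral_eq_integral_chart (f := fun x => (chartField p i c hc).apply g x + d x * g x)
    hρ.continuousOn hpos hmap
    ((ContMDiffMap.contMDiff _).continuous.add (d.contMDiff.continuous.mul g.contMDiff.continuous))]
  · have hK : IsCompact (extChartAt (𝓡∂ n) p '' (tsupport c ∩ tsupport g)) :=
      ((isClosed_tsupport c).isCompact.inter_right (isClosed_tsupport g)).image_of_continuousOn
        ((continuousOn_extChartAt p).mono (inter_subset_left.trans hc))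
    have hKi : extChartAt (𝓡∂ n) p '' (tsupport c ∩ tsupport g) ⊆
        interior (extChartAt (𝓡∂ n) p).target := by
      rintro _ ⟨x, ⟨hxc, hxg⟩, rfl⟩
      exact extChartAt_mem_interior_target (hc hxc) (hg hxg)
    have hgs := contDiffOn_comp_extChartAt_symm g p
    refine Eq.trans
      (setIntegral_congr_fun (measurableSet_extChartAt_target (n := n) p) fun y hy => ?_)
      (integral_fderivWithin_target_eq_zero (p := p) (hρc.mul hgs) hK hKi (fun y hy hyK => ?_)
        (EuclideanSpace.single i 1))
    · have hys := (extChartAt (𝓡∂ n) p).map_target hy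
      have hpy := (hpos y hy).ne'
      have h1 := ((hρc.differentiableOn (by simp)) y hy).hasFDerivWithinAt
      have h2 := ((hgs.differentiableOn (by simp)) y hy).hasFDerivWithinAt
      have h3 := (h1.mul h2).fderivWithin (hU y hy)
      rw [chartField_apply p i c hc g hys, hd _ hys, (extChartAt (𝓡∂ n) p).right_inv hy]
      refine Eq.trans ?_ (congrArg (fun L => L (EuclideanSpace.single i 1)) h3).symm
      simp only [add_apply, smul_apply, smul_eq_mul, Function.comp_apply]
      field_simp
    · have : (extChartAt (𝓡∂ n) p).symm y ∉ tsupport c ∩ tsupport g :=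
        fun h => hyK ⟨_, h, (extChartAt (𝓡∂ n) p).right_inv hy⟩
      rw [mem_inter_iff, not_and_or] at this
      rcases this with h | h
      · change _ * c ((extChartAt (𝓡∂ n) p).symm y) * _ = 0
        rw [image_eq_zero_of_notMem_tsupport h, mul_zero, zero_mul]
      · change _ * g ((extChartAt (𝓡∂ n) p).symm y) = 0
        rw [image_eq_zero_of_notMem_tsupport h, mul_zero]
  · intro x hx
    have hxc : x ∉ tsupport c := fun h => hx (hc h)
    rw [chartField_apply_of_notMem p i c hc g hxc,
      image_eq_zero_of_notMem_tsupport fun h => hxc (hdc h)]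
    simp

omit [MeasurableSpace M] [BorelSpace M] [T2Space M] [CompactSpace M] in
/-- A vector field cut off to the domain of a chart is a smooth combination of the coordinate
vector fields. -/
theorem exists_chartFrame_coeff (X : VField n M) {p : M} (f : SmoothFn n M)
    (hf : tsupport f ⊆ (extChartAt (𝓡∂ n) p).source) :
    ∃ c : Fin n → SmoothFn n M, (∀ i, tsupport (c i) ⊆ tsupport f) ∧
      ∀ x, f x • X.vec x = ∑ i, c i x • chartFrameVec p i x := by
  let e := trivializationAt (EuclideanSpace ℝ (Fin n)) (TangentSpace (𝓡∂ n) : M → Type _) p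
  let b := (EuclideanSpace.basisFun (Fin n) ℝ).toBasis
  have hbase : e.baseSet = (extChartAt (𝓡∂ n) p).source := by
    rw [extChartAt_source]; rfl
  let a : Fin n → M → ℝ := fun i x => e.localFrameCoeff (𝓡∂ n) b i x (X x)
  have ha : ∀ i, ContMDiffOn (𝓡∂ n) 𝓘(ℝ, ℝ) ∞ (a i) e.baseSet := fun i =>
    contMDiffOn_baseSet_localFrameCoeff (I := 𝓡∂ n) (b := b) (k := ∞)
      X.contMDiff.contMDiffOn i
  have hsub : ∀ i, tsupport (fun x => f x * a i x) ⊆ tsupport f := fun i =>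
    closure_mono fun x hx hfx => hx (by
      change f x * a i x = 0
      rw [hfx, zero_mul])
  refine ⟨fun i => ⟨fun x => f x * a i x, contMDiff_of_tsupport fun x hx => ?_⟩, hsub, fun x => ?_⟩
  · have hx' : x ∈ e.baseSet := hbase ▸ hf (hsub i hx)
    exact (f.contMDiff x).mul ((ha i).contMDiffAt (e.open_baseSet.mem_nhds hx'))
  · by_cases hx : x ∈ e.baseSet
    · have h : X.vec x = ∑ i, a i x • chartFrameVec p i x :=
        e.eq_sum_localFrameCoeff_smul (I := 𝓡∂ n) (b := b) (s := X) hx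
      rw [h, Finset.smul_sum]
      refine Finset.sum_congr rfl fun i _ => ?_
      rw [smul_smul]
      rfl
    · have h : f x = 0 := image_eq_zero_of_notMem_tsupport fun h => hx (hbase ▸ hf h)
      rw [h, zero_smul]
      refine (Finset.sum_eq_zero fun i _ => ?_).symm
      change (f x * a i x) • _ = 0
      rw [h, zero_mul, zero_smul]

/-- Every vector field has a divergence: by a partition of unity it is a sum of fields `c ∂_i`
supported in chart domains. -/
theorem IsSmoothDensity.exists_isDivergence (hμ : IsSmoothDensity (n := n) μ) (X : VField n M) :
    ∃ d : SmoothFn n M, IsDivergence μ X d := by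
  obtain ⟨t, ht⟩ := isCompact_univ.elim_nhds_subcover (fun p : M => (extChartAt (𝓡∂ n) p).source)
    (fun p _ => (isOpen_extChartAt_source (I := 𝓡∂ n) p).mem_nhds
      (mem_extChartAt_source (I := 𝓡∂ n) p))
  obtain ⟨f, hf⟩ := SmoothPartitionOfUnity.exists_isSubordinate (𝓡∂ n) (isClosed_univ (X := M))
    (fun p : t => (extChartAt (𝓡∂ n) (p : M)).source) (fun p => isOpen_extChartAt_source _)
    (fun x hx => by simpa using ht.2 hx)
  have hsum : ∀ x, ∑ p, f p x = 1 := fun x => by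
    rw [← finsum_eq_sum_of_fintype]; exact f.sum_eq_one (mem_univ x)
  choose c hcf hc using fun p : t => exists_chartFrame_coeff X (f p) (hf p)
  choose ρ hρ hpos hmap using hμ
  choose d hd _ _ using fun (p : t) (i : Fin n) =>
    exists_isDivergence_chartField (p := (p : M)) (fun p => ⟨ρ p, hρ p, hpos p, hmap p⟩) (hρ p)
      (hpos p) (hmap p) i (c p i) ((hcf p i).trans (hf p))
  refine ⟨∑ p, ∑ i, d p i, fun g hg => ?_⟩
  have hμ : IsSmoothDensity (n := n) μ := fun p => ⟨ρ p, hρ p, hpos p, hmap p⟩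
  have h1 : ∀ x, X.apply g x = ∑ p : t, ∑ i,
      (chartField (p : M) i (c p i) ((hcf p i).trans (hf p))).apply g x := fun x => by
    have h2 : X.vec x = ∑ p : t, ∑ i, c p i x • chartFrameVec (p : M) i x := by
      rw [← one_smul ℝ (X.vec x), ← hsum x, Finset.sum_smul]
      exact Finset.sum_congr rfl fun p _ => hc p x
    rw [VField.apply_apply, h2, map_sum]
    refine Finset.sum_congr rfl fun p _ => ?_
    rw [map_sum]
    rfl
  have hi : ∀ (p : t) (i : Fin n), Integrable
      (fun x => (chartField (p : M) i (c p i) ((hcf p i).trans (hf p))).apply g x) μ :=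
    fun p i => hμ.integrable (ContMDiffMap.contMDiff _).continuous
  have hi' : ∀ (p : t) (i : Fin n), Integrable (fun x => d p i x * g x) μ :=
    fun p i => hμ.integrable ((d p i).contMDiff.continuous.mul g.contMDiff.continuous)
  simp only [h1, smoothFn_sum_apply, Finset.sum_mul]
  rw [integral_finsetSum _ fun p _ => integrable_finsetSum _ fun i _ => hi p i,
    integral_finsetSum _ fun p _ => integrable_finsetSum _ fun i _ => hi' p i,
    ← Finset.sum_neg_distrib]
  refine Finset.sum_congr rfl fun p _ => ?_
  rw [integral_finsetSum _ fun i _ => hi p i, integral_finsetSum _ fun i _ => hi' p i,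
    ← Finset.sum_neg_distrib]
  exact Finset.sum_congr rfl fun i _ => hd p i g hg

theorem IsSmoothDensity.isDivergence_divergence (hμ : IsSmoothDensity (n := n) μ)
    (X : VField n M) : IsDivergence μ X (divergence μ X) := by
  unfold divergence
  rw [dif_pos (hμ.exists_isDivergence X)]
  exact (hμ.exists_isDivergence X).choose_spec

theorem IsSmoothDensity.divergence_eq (hμ : IsSmoothDensity (n := n) μ) {X : VField n M}
    {d : SmoothFn n M} (hd : IsDivergence μ X d) : divergence μ X = d := by
  rw [← sub_eq_zero]
  refine hμ.eq_zero_of_integral_mul_eq_zero _ fun h hh => ?_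
  have h1 := hμ.isDivergence_divergence X h hh
  rw [hd h hh, neg_inj] at h1
  simp only [smoothFn_sub_apply, sub_mul]
  rw [integral_sub (f := fun x => divergence μ X x * h x) (g := fun x => d x * h x)
    (hμ.integrable ((divergence μ X).contMDiff.continuous.mul h.contMDiff.continuous))
    (hμ.integrable (d.contMDiff.continuous.mul h.contMDiff.continuous)), h1, sub_self]

/-- The Leibniz rule for the divergence of a combination of vector fields. -/
theorem IsSmoothDensity.divergence_sum_smul (hμ : IsSmoothDensity (n := n) μ) {J : Type*}
    [Fintype J] {Y : VField n M} {c : J → SmoothFn n M} {X : J → VField n M}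
    (hY : ∀ x, Y x = ∑ j, c j x • X j x) :
    divergence μ Y = ∑ j, ((X j).apply (c j) + c j * divergence μ (X j)) := by
  refine hμ.divergence_eq fun g hg => ?_
  have h1 : ∀ x, Y.apply g x = ∑ j, c j x * (X j).apply g x := fun x => by
    have h2 : Y.vec x = ∑ j, c j x • (X j).vec x := hY x
    rw [VField.apply_apply, h2, map_sum]
    exact Finset.sum_congr rfl fun j _ => by rw [map_smul]; rfl
  have hi : ∀ j, Integrable (fun x => c j x * (X j).apply g x) μ := fun j =>
    hμ.integrable ((c j).contMDiff.continuous.mul (ContMDiffMap.contMDiff _).continuous)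
  have hi' : ∀ j, Integrable
      (fun x => ((X j).apply (c j) + c j * divergence μ (X j)) x * g x) μ := fun j =>
    hμ.integrable ((ContMDiffMap.contMDiff _).continuous.mul g.contMDiff.continuous)
  simp only [h1, smoothFn_sum_apply, Finset.sum_mul]
  rw [integral_finsetSum _ fun j _ => hi j, integral_finsetSum _ fun j _ => hi' j,
    ← Finset.sum_neg_distrib]
  refine Finset.sum_congr rfl fun j _ => ?_
  -- The divergence of `X j` is tested against `c j * g`, which has interior support with `g`.
  have h2 := hμ.isDivergence_divergence (X j) (c j * g)
    ((closure_mono fun x (hx : (c j * g) x ≠ 0) (hgx : g x = 0) => hx (by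
      change c j x * g x = 0
      rw [hgx, mul_zero])).trans hg)
  simp only [VField.apply_mul, smoothFn_add_apply, smoothFn_mul_apply, add_mul] at h2 ⊢
  have hi1 : Integrable (fun x => (X j).apply (c j) x * g x) μ :=
    hμ.integrable ((ContMDiffMap.contMDiff _).continuous.mul g.contMDiff.continuous)
  have hi2 : Integrable (fun x => c j x * divergence μ (X j) x * g x) μ :=
    hμ.integrable ((c j * divergence μ (X j)).contMDiff.continuous.mul g.contMDiff.continuous)
  rw [integral_add hi1 (hi j)] at h2
  rw [integral_add hi1 hi2]
  have h3 : ∫ x, c j x * divergence μ (X j) x * g x ∂μ =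
      ∫ x, divergence μ (X j) x * (c j x * g x) ∂μ :=
    integral_congr_ae (Filter.Eventually.of_forall fun x => by ring)
  rw [h3]
  linarith

end Divergence

/-! ### Boundary fluxes -/

section Flux

open Set Topology

variable {n : ℕ} [NeZero n] {M : Type*} [TopologicalSpace M]
  [ChartedSpace (EuclideanHalfSpace n) M] [IsManifold (𝓡∂ n) ∞ M]
  [MeasurableSpace M] [BorelSpace M] {μ : Measure M} [T2Space M] [CompactSpace M]

/-- If the boundary is non-empty, some vector field has non-zero flux through it. In a chart with
density `ρ` at a boundary point the field is `ρ⁻¹ b ∂_0` with a radial bump function `b` centred on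
the boundary. Since `∂_0 b ≤ 0` on the half-space, its divergence `ρ⁻¹ ∂_0 b` is non-positive,
and it does not vanish identically. -/
theorem IsSmoothDensity.exists_boundaryIntegral_ne_zero (hμ : IsSmoothDensity (n := n) μ)
    (hM : ((𝓡∂ n).boundary M).Nonempty) : ∃ Y : VField n M, boundaryIntegral μ Y ≠ 0 := by
  obtain ⟨p, hp⟩ := hM
  obtain ⟨ρ, hρ, hpos, hmap⟩ := hμ p
  set y₀ := extChartAt (𝓡∂ n) p p with hy₀
  set v : EuclideanSpace ℝ (Fin n) := EuclideanSpace.single 0 1 with hv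
  have hy₀0 : y₀ 0 = 0 := by
    have := (ModelWithCorners.isBoundaryPoint_iff).1 hp
    rw [frontier_range_modelWithCornersEuclideanHalfSpace] at this
    exact this.symm
  obtain ⟨r, hr, hball⟩ := Metric.mem_nhdsWithin_iff.1
    (extChartAt_target_mem_nhdsWithin (I := 𝓡∂ n) p)
  set q := r / 2 with hq
  have hq0 : 0 < q := half_pos hr
  have hrange : range (𝓡∂ n) = {y | 0 ≤ y 0} := range_modelWithCornersEuclideanHalfSpace n
  let φ : EuclideanSpace ℝ (Fin n) → ℝ := fun y => 1 - ‖y - y₀‖ ^ 2 / q ^ 2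
  let b : EuclideanSpace ℝ (Fin n) → ℝ := fun y => Real.smoothTransition (φ y)
  have hφ : ContDiff ℝ ∞ φ :=
    contDiff_const.sub (((contDiff_id.sub contDiff_const).norm_sq ℝ).div_const _)
  have hb : ContDiff ℝ ∞ b := Real.smoothTransition.contDiff.comp hφ
  have hb0 : ∀ y, q ≤ ‖y - y₀‖ → b y = 0 := fun y hy => by
    refine Real.smoothTransition.zero_of_nonpos ?_
    have : 1 ≤ ‖y - y₀‖ ^ 2 / q ^ 2 := by
      rw [one_le_div (by positivity)]
      gcongr
    simp only [φ]
    linarith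
  have hb1 : b y₀ = 1 := by simp [b, φ]
  have hdb : ∀ y, fderiv ℝ b y v = deriv Real.smoothTransition (φ y) * (-(2 * (y 0)) / q ^ 2) := by
    intro y
    have h1 : HasFDerivAt (fun y : EuclideanSpace ℝ (Fin n) => ‖y - y₀‖ ^ 2) _ y :=
      ((hasFDerivAt_id y).sub_const y₀).norm_sq
    have h2 : HasFDerivAt φ _ y := (h1.mul_const (q ^ 2)⁻¹).const_sub 1
    have h3 : HasFDerivAt b _ y := ((Real.smoothTransition.contDiff (n := ⊤)).differentiable
      (by simp) (φ y)).hasDerivAt.comp_hasFDerivAt y h2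
    rw [h3.fderiv]
    simp [hv, hy₀0, EuclideanSpace.inner_single_right]
    ring
  have hdb' : ∀ y ∈ range (𝓡∂ n), fderiv ℝ b y v ≤ 0 := fun y hy => by
    rw [hrange] at hy
    rw [hdb]
    refine mul_nonpos_of_nonneg_of_nonpos (Real.smoothTransition.monotone.deriv_nonneg) ?_
    refine div_nonpos_of_nonpos_of_nonneg ?_ (by positivity)
    have : 0 ≤ y 0 := hy
    linarith
  have hKT : Metric.closedBall y₀ q ∩ range (𝓡∂ n) ⊆ (extChartAt (𝓡∂ n) p).target := fun y hy =>
    hball ⟨lt_of_le_of_lt hy.1 (half_lt_self hr), hy.2⟩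
  have hK : IsCompact (Metric.closedBall y₀ q ∩ range (𝓡∂ n)) :=
    (isCompact_closedBall _ _).inter_right (𝓡∂ n).isClosed_range
  have hKs : (extChartAt (𝓡∂ n) p).symm '' (Metric.closedBall y₀ q ∩ range (𝓡∂ n)) ⊆
      (extChartAt (𝓡∂ n) p).source := by
    rintro _ ⟨y, hy, rfl⟩
    exact (extChartAt (𝓡∂ n) p).map_target (hKT hy)
  obtain ⟨c, hcK, hc⟩ := exists_smoothFn_of_chart (p := p) (D := fun y => (ρ y)⁻¹ * b y)
    ((hρ.inv fun y hy => (hpos y hy).ne').mul hb.contDiffOn)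
    (hK.image_of_continuousOn ((continuousOn_extChartAt_symm p).mono hKT)).isClosed hKs
    (fun x hx hxK => by
      rw [hb0, mul_zero]
      by_contra h
      refine hxK ⟨extChartAt (𝓡∂ n) p x, ⟨?_, extChartAt_target_subset_range p
        ((extChartAt (𝓡∂ n) p).map_source hx)⟩, (extChartAt (𝓡∂ n) p).left_inv hx⟩
      rw [mem_closedBall_iff_norm]
      exact (not_le.1 h).le)
  obtain ⟨d, hd, hdc, hdx⟩ :=
    exists_isDivergence_chartField hμ hρ hpos hmap 0 c (hcK.trans hKs)
  have hd' : ∀ x ∈ (extChartAt (𝓡∂ n) p).source, d x =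
      (ρ (extChartAt (𝓡∂ n) p x))⁻¹ * fderiv ℝ b (extChartAt (𝓡∂ n) p x) v := fun x hx => by
    have hcb : ∀ y ∈ (extChartAt (𝓡∂ n) p).target,
        ρ y * c ((extChartAt (𝓡∂ n) p).symm y) = b y := fun y hy => by
      rw [hc _ ((extChartAt (𝓡∂ n) p).map_target hy), (extChartAt (𝓡∂ n) p).right_inv hy,
        mul_inv_cancel_left₀ (hpos y hy).ne']
    have hxT := (extChartAt (𝓡∂ n) p).map_source hx
    rw [hdx x hx, fderivWithin_congr hcb (hcb _ hxT),
      (hb.differentiable (by simp) _).hasFDerivAt.hasFDerivWithinAt.fderivWithin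
        (uniqueDiffOn_extChartAt_target p _ hxT)]
  refine ⟨chartField p 0 c (hcK.trans hKs), fun h0 => ?_⟩
  rw [boundaryIntegral, hμ.divergence_eq hd] at h0
  have := hμ.isOpenPosMeasure
  have hnn : 0 ≤ fun x => -d x := fun x => by
    by_cases hx : x ∈ (extChartAt (𝓡∂ n) p).source
    · have hxT := (extChartAt (𝓡∂ n) p).map_source hx
      have h1 := hdb' _ (extChartAt_target_subset_range p hxT)
      have h2 := inv_pos.2 (hpos _ hxT)
      change 0 ≤ -d x
      rw [hd' x hx]
      nlinarith
    · change 0 ≤ -d x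
      rw [image_eq_zero_of_notMem_tsupport fun h => hx (hKs (hcK (hdc h))), neg_zero]
  have hz := (integral_eq_zero_iff_of_nonneg hnn (hμ.integrable d.contMDiff.continuous).neg).1
    (by rw [integral_neg, h0, neg_zero])
  have hz' := Measure.eq_of_ae_eq hz d.contMDiff.continuous.neg continuous_zero
  have hline : ∀ s : ℝ, HasDerivAt (fun s : ℝ => b (y₀ + s • v)) (fderiv ℝ b (y₀ + s • v) v) s :=
    fun s => by
      have h1 : HasDerivAt (fun s : ℝ => y₀ + s • v) v s := by
        simpa using ((hasDerivAt_id s).smul_const v).const_add y₀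
      exact (hb.differentiable (by simp) _).hasFDerivAt.comp_hasDerivAt s h1
  obtain ⟨s, hs, hslope⟩ := exists_hasDerivAt_eq_slope _ _ hq0
    (continuous_iff_continuousAt.2 fun s => (hline s).continuousAt).continuousOn
    (fun s _ => hline s)
  have hvn : ‖v‖ = 1 := by simp [hv]
  have hsT : y₀ + s • v ∈ (extChartAt (𝓡∂ n) p).target := by
    refine hKT ⟨?_, ?_⟩
    · rw [mem_closedBall_iff_norm, add_sub_cancel_left, norm_smul, hvn, mul_one, Real.norm_eq_abs,
        abs_of_pos hs.1]
      exact hs.2.le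
    · rw [hrange]
      simp [hy₀0, hv, hs.1.le]
  have hzero : fderiv ℝ b (y₀ + s • v) v = 0 := by
    have h1 := congrFun hz' ((extChartAt (𝓡∂ n) p).symm (y₀ + s • v))
    have h2 := hd' _ ((extChartAt (𝓡∂ n) p).map_target hsT)
    rw [(extChartAt (𝓡∂ n) p).right_inv hsT] at h2
    rw [Pi.zero_apply, neg_eq_zero, h2] at h1
    exact (mul_eq_zero.1 h1).resolve_left (inv_ne_zero (hpos _ hsT).ne')
  rw [hzero, zero_smul, add_zero, hb1, hb0 (y₀ + q • v) (by
    rw [add_sub_cancel_left, norm_smul, hvn, mul_one, Real.norm_eq_abs, abs_of_pos hq0]),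
    eq_comm, div_eq_zero_iff] at hslope
  rcases hslope with h | h <;> linarith

end Flux

/-! ### Local functionals -/

section Functionals

variable {n : ℕ} [NeZero n] {M : Type*} [TopologicalSpace M]
  [ChartedSpace (EuclideanHalfSpace n) M] [IsManifold (𝓡∂ n) ∞ M] {ι : Type*}
  [MeasurableSpace M] {μ : Measure M}

/-- The derivative of a functional at `(t, z)` in the direction of `(τ, v)`. -/
def dirDerivF (F : Functional n M ι) (t : ℝ) (z : Config n M ι) (τ : ℝ) (v : Config n M ι) : ℝ :=
  deriv (fun s : ℝ => F (t + s * τ) (z + s • v)) 0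

/-- The derivation `τ ∂_t + δ_Q` of the local functionals. -/
def dvaryF (τ : ℝ) (Q : Variation n M ι) (F : Functional n M ι) : Functional n M ι :=
  fun t z => dirDerivF F t z τ (Q t z)

theorem varyFunctional_eq_dvaryF (Q : Variation n M ι) (F : Functional n M ι) :
    varyFunctional Q F = dvaryF 0 Q F := by
  ext t z
  simp [varyFunctional, dvaryF, dirDerivF]

/-- The functional `z ↦ ∫ E_A Q^A dⁿx`. -/
def pairF (μ : Measure M) [Fintype ι] (E Q : Variation n M ι) : Functional n M ι :=
  fun t z => pairing μ (E t z) (Q t z)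

variable [BorelSpace M] [T2Space M] [CompactSpace M]

theorem IsSmoothDensity.hasDerivAt_integral (hμ : IsSmoothDensity (n := n) μ) {f : Density n M ι}
    (hf : IsLocal f) (t : ℝ) (z : Config n M ι) (τ : ℝ) (v : Config n M ι) :
    HasDerivAt (fun s : ℝ => ∫ x, f (t + s * τ) (z + s • v) x ∂μ)
      (∫ x, dirDeriv f t z τ v x ∂μ) 0 := by
  have := hμ.isFiniteMeasure
  have hg := (hf.dvary τ (isLocalVariation_const v)).contMDiff_line t z τ v
  obtain ⟨C, hC⟩ := ((isCompact_closedBall (0 : ℝ) 1).prod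
    (isCompact_univ (X := M))).exists_bound_of_continuousOn hg.continuous.continuousOn
  have h := hasDerivAt_integral_of_dominated_loc_of_deriv_le (μ := μ) (x₀ := (0 : ℝ))
    (F := fun s x => f (t + s * τ) (z + s • v) x)
    (F' := fun s x => dirDeriv f (t + s * τ) (z + s • v) τ v x) (bound := fun _ => C)
    (Metric.ball_mem_nhds (0 : ℝ) one_pos)
    (Filter.Eventually.of_forall fun s => (hμ.integrable (ContMDiffMap.contMDiff _).continuous).1)
    (hμ.integrable (ContMDiffMap.contMDiff _).continuous)
    (hμ.integrable (ContMDiffMap.contMDiff _).continuous).1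
    (Filter.Eventually.of_forall fun x s hs => hC (s, x)
      ⟨Metric.ball_subset_closedBall hs, Set.mem_univ x⟩)
    (integrable_const C)
    (Filter.Eventually.of_forall fun x s _ => hf.hasDerivAt_line t z τ v x s)
  simpa using h.2

theorem IsSmoothDensity.dirDerivF_eq (hμ : IsSmoothDensity (n := n) μ) {f : Density n M ι}
    (hf : IsLocal f) {F : Functional n M ι} (hF : ∀ t z, F t z = ∫ x, f t z x ∂μ) (t : ℝ)
    (z : Config n M ι) (τ : ℝ) (v : Config n M ι) :
    dirDerivF F t z τ v = ∫ x, dirDeriv f t z τ v x ∂μ := by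
  simp only [dirDerivF, hF]
  exact (hμ.hasDerivAt_integral hf t z τ v).deriv

theorem IsSmoothDensity.hasDerivAt (hμ : IsSmoothDensity (n := n) μ) {F : Functional n M ι}
    (hF : IsLocalFunctional μ F) (t : ℝ) (z : Config n M ι) (τ : ℝ) (v : Config n M ι) :
    HasDerivAt (fun s : ℝ => F (t + s * τ) (z + s • v)) (dirDerivF F t z τ v) 0 := by
  obtain ⟨f, hf, hF⟩ := hF
  rw [hμ.dirDerivF_eq hf hF]
  simp only [hF]
  exact hμ.hasDerivAt_integral hf t z τ v

theorem IsSmoothDensity.hasDerivAt_fixed_time (hμ : IsSmoothDensity (n := n) μ)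
    {F : Functional n M ι} (hF : IsLocalFunctional μ F) (t : ℝ) (z v : Config n M ι) :
    HasDerivAt (fun s : ℝ => F t (z + s • v)) (dirDerivF F t z 0 v) 0 := by
  simpa using hμ.hasDerivAt hF t z 0 v

theorem IsSmoothDensity.dirDerivF_add (hμ : IsSmoothDensity (n := n) μ) {F : Functional n M ι}
    (hF : IsLocalFunctional μ F) (t : ℝ) (z : Config n M ι) (τ τ' : ℝ) (v v' : Config n M ι) :
    dirDerivF F t z (τ + τ') (v + v') = dirDerivF F t z τ v + dirDerivF F t z τ' v' := by
  obtain ⟨f, hf, hF⟩ := hF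
  simp only [hμ.dirDerivF_eq hf hF, hf.dirDeriv_add, smoothFn_add_apply]
  exact integral_add (hμ.integrable (ContMDiffMap.contMDiff _).continuous)
    (hμ.integrable (ContMDiffMap.contMDiff _).continuous)

theorem IsSmoothDensity.dirDerivF_smul (hμ : IsSmoothDensity (n := n) μ) {F : Functional n M ι}
    (hF : IsLocalFunctional μ F) (t : ℝ) (z : Config n M ι) (r τ : ℝ) (v : Config n M ι) :
    dirDerivF F t z (r * τ) (r • v) = r * dirDerivF F t z τ v := by
  obtain ⟨f, hf, hF⟩ := hF
  simp only [hμ.dirDerivF_eq hf hF, hf.dirDeriv_smul, smoothFn_smul_apply]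
  exact integral_const_mul _ _

theorem IsSmoothDensity.isLocalFunctional_add (hμ : IsSmoothDensity (n := n) μ)
    {F G : Functional n M ι} (hF : IsLocalFunctional μ F) (hG : IsLocalFunctional μ G) :
    IsLocalFunctional μ (F + G) := by
  obtain ⟨f, hf, hF⟩ := hF
  obtain ⟨g, hg, hG⟩ := hG
  refine ⟨_, hf.add hg, fun t z => ?_⟩
  simp only [Pi.add_apply, hF, hG, smoothFn_add_apply]
  exact (integral_add (hμ.integrable (ContMDiffMap.contMDiff _).continuous)
    (hμ.integrable (ContMDiffMap.contMDiff _).continuous)).symm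

omit [BorelSpace M] [T2Space M] [CompactSpace M] in
theorem IsLocalFunctional.smul (r : ℝ) {F : Functional n M ι} (hF : IsLocalFunctional μ F) :
    IsLocalFunctional μ (r • F) := by
  obtain ⟨f, hf, hF⟩ := hF
  refine ⟨_, hf.smul r, fun t z => ?_⟩
  simp only [Pi.smul_apply, hF, smoothFn_smul_apply, smul_eq_mul]
  exact (integral_const_mul _ _).symm

theorem IsSmoothDensity.isLocalFunctional_sub (hμ : IsSmoothDensity (n := n) μ)
    {F G : Functional n M ι} (hF : IsLocalFunctional μ F) (hG : IsLocalFunctional μ G) :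
    IsLocalFunctional μ (F - G) := by
  have : F - G = F + (-1 : ℝ) • G := by rw [neg_one_smul, sub_eq_add_neg]
  rw [this]
  exact hμ.isLocalFunctional_add hF (hG.smul _)

theorem IsSmoothDensity.dirDerivF_add_fn (hμ : IsSmoothDensity (n := n) μ)
    {F G : Functional n M ι} (hF : IsLocalFunctional μ F) (hG : IsLocalFunctional μ G) (t : ℝ)
    (z : Config n M ι) (τ : ℝ) (v : Config n M ι) :
    dirDerivF (F + G) t z τ v = dirDerivF F t z τ v + dirDerivF G t z τ v :=
  ((hμ.hasDerivAt hF t z τ v).add (hμ.hasDerivAt hG t z τ v)).deriv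

theorem IsSmoothDensity.dirDerivF_sub_fn (hμ : IsSmoothDensity (n := n) μ)
    {F G : Functional n M ι} (hF : IsLocalFunctional μ F) (hG : IsLocalFunctional μ G) (t : ℝ)
    (z : Config n M ι) (τ : ℝ) (v : Config n M ι) :
    dirDerivF (F - G) t z τ v = dirDerivF F t z τ v - dirDerivF G t z τ v :=
  ((hμ.hasDerivAt hF t z τ v).sub (hμ.hasDerivAt hG t z τ v)).deriv

theorem IsSmoothDensity.dirDerivF_smul_fn (hμ : IsSmoothDensity (n := n) μ)
    {F : Functional n M ι} (r : ℝ) (hF : IsLocalFunctional μ F) (t : ℝ)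
    (z : Config n M ι) (τ : ℝ) (v : Config n M ι) :
    dirDerivF (r • F) t z τ v = r * dirDerivF F t z τ v :=
  ((hμ.hasDerivAt hF t z τ v).const_mul r).deriv

theorem IsSmoothDensity.isLocalFunctional_dvaryF (hμ : IsSmoothDensity (n := n) μ) (τ : ℝ)
    {Q : Variation n M ι} (hQ : IsLocalVariation Q) {F : Functional n M ι}
    (hF : IsLocalFunctional μ F) : IsLocalFunctional μ (dvaryF τ Q F) := by
  obtain ⟨f, hf, hF⟩ := hF
  exact ⟨_, hf.dvary τ hQ, fun t z => hμ.dirDerivF_eq hf hF t z τ _⟩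

/-- The commutator of two derivations `τ ∂_t + δ_Q` and `τ' ∂_t + δ_R` of the local functionals is a
variation. -/
theorem IsSmoothDensity.dvaryF_comm (hμ : IsSmoothDensity (n := n) μ) (τ τ' : ℝ)
    {Q R : Variation n M ι} (hQ : IsLocalVariation Q) (hR : IsLocalVariation R)
    {F : Functional n M ι} (hF : IsLocalFunctional μ F) (t : ℝ) (z : Config n M ι) :
    dvaryF τ Q (dvaryF τ' R F) t z - dvaryF τ' R (dvaryF τ Q F) t z =
      dvaryF 0 (dvaryV τ Q R - dvaryV τ' R Q) F t z := by
  obtain ⟨f, hf, hF⟩ := hF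
  have h1 := fun t z => hμ.dirDerivF_eq hf hF t z τ (Q t z)
  have h2 := fun t z => hμ.dirDerivF_eq hf hF t z τ' (R t z)
  change dirDerivF (dvaryF τ' R F) t z τ _ - dirDerivF (dvaryF τ Q F) t z τ' _ =
    dirDerivF F t z 0 _
  rw [hμ.dirDerivF_eq (F := dvaryF τ' R F) (hf.dvary τ' hR) h2,
    hμ.dirDerivF_eq (F := dvaryF τ Q F) (hf.dvary τ hQ) h1,
    hμ.dirDerivF_eq hf hF, ← integral_sub]
  · refine congrArg (fun g : SmoothFn n M => ∫ x, g x ∂μ) (hf.dvary_comm τ τ' hQ hR t z)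
  · exact hμ.integrable (ContMDiffMap.contMDiff _).continuous
  · exact hμ.integrable (ContMDiffMap.contMDiff _).continuous

section Pairing

variable [Fintype ι]

theorem IsSmoothDensity.pairing_eq_integral (hμ : IsSmoothDensity (n := n) μ)
    (E h : Config n M ι) : pairing μ E h = ∫ x, (∑ A, E A * h A) x ∂μ := by
  simp only [smoothFn_sum_apply]
  rw [integral_finsetSum _ fun A _ => hμ.integrable (ContMDiffMap.contMDiff _).continuous]
  rfl

theorem IsSmoothDensity.pairing_add_left (hμ : IsSmoothDensity (n := n) μ)
    (E E' h : Config n M ι) : pairing μ (E + E') h = pairing μ E h + pairing μ E' h := by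
  simp only [hμ.pairing_eq_integral]
  rw [← integral_add (hμ.integrable (ContMDiffMap.contMDiff _).continuous)
    (hμ.integrable (ContMDiffMap.contMDiff _).continuous)]
  refine integral_congr_ae (Filter.Eventually.of_forall fun x => ?_)
  simp [add_mul, Finset.sum_add_distrib]

omit [BorelSpace M] [T2Space M] [CompactSpace M] in
theorem pairing_smul_left (r : ℝ) (E h : Config n M ι) :
    pairing μ (r • E) h = r * pairing μ E h := by
  simp only [pairing, Pi.smul_apply, smoothFn_smul_apply, Finset.mul_sum, mul_assoc]
  exact Finset.sum_congr rfl fun A _ => integral_const_mul _ _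

omit [BorelSpace M] [T2Space M] [CompactSpace M] in
theorem pairing_comm (E h : Config n M ι) : pairing μ E h = pairing μ h E := by
  simp only [pairing, mul_comm]

theorem IsSmoothDensity.pairing_add_right (hμ : IsSmoothDensity (n := n) μ)
    (E h h' : Config n M ι) : pairing μ E (h + h') = pairing μ E h + pairing μ E h' := by
  rw [pairing_comm, hμ.pairing_add_left, pairing_comm h, pairing_comm h']

omit [BorelSpace M] [T2Space M] [CompactSpace M] in
theorem pairing_smul_right (r : ℝ) (E h : Config n M ι) :
    pairing μ E (r • h) = r * pairing μ E h := by
  rw [pairing_comm, pairing_smul_left, pairing_comm]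

theorem IsSmoothDensity.pairing_sub_left (hμ : IsSmoothDensity (n := n) μ)
    (E E' h : Config n M ι) : pairing μ (E - E') h = pairing μ E h - pairing μ E' h := by
  have : E - E' = E + (-1 : ℝ) • E' := by rw [neg_one_smul, sub_eq_add_neg]
  rw [this, hμ.pairing_add_left, pairing_smul_left]
  ring

theorem IsSmoothDensity.pairing_sub_right (hμ : IsSmoothDensity (n := n) μ)
    (E h h' : Config n M ι) : pairing μ E (h - h') = pairing μ E h - pairing μ E h' := by
  rw [pairing_comm, hμ.pairing_sub_left, pairing_comm h, pairing_comm h']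

theorem IsSmoothDensity.isLocalFunctional_pairF (hμ : IsSmoothDensity (n := n) μ)
    {E Q : Variation n M ι} (hE : IsLocalVariation E) (hQ : IsLocalVariation Q) :
    IsLocalFunctional μ (pairF μ E Q) :=
  ⟨_, IsLocal.sum_finset fun A => (hE A).mul (hQ A), fun _ _ => hμ.pairing_eq_integral _ _⟩

theorem IsSmoothDensity.dirDerivF_pairF (hμ : IsSmoothDensity (n := n) μ)
    {E Q : Variation n M ι} (hE : IsLocalVariation E) (hQ : IsLocalVariation Q) (t : ℝ)
    (z : Config n M ι) (τ : ℝ) (v : Config n M ι) :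
    dirDerivF (pairF μ E Q) t z τ v =
      pairing μ (fun A => dirDeriv (fun t z => E t z A) t z τ v) (Q t z) +
        pairing μ (E t z) (fun A => dirDeriv (fun t z => Q t z A) t z τ v) := by
  rw [hμ.dirDerivF_eq (F := pairF μ E Q) (IsLocal.sum_finset fun A => (hE A).mul (hQ A))
    fun _ _ => hμ.pairing_eq_integral _ _, dirDeriv_sum_fn fun A => (hE A).mul (hQ A),
    hμ.pairing_eq_integral, hμ.pairing_eq_integral,
    ← integral_add (hμ.integrable (ContMDiffMap.contMDiff _).continuous)
      (hμ.integrable (ContMDiffMap.contMDiff _).continuous)]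
  refine integral_congr_ae (Filter.Eventually.of_forall fun x => ?_)
  simp [dirDeriv_mul_fn (hE _) (hQ _), Finset.sum_add_distrib]

theorem IsSmoothDensity.dvaryF_pairF (hμ : IsSmoothDensity (n := n) μ) (τ : ℝ)
    {E Q : Variation n M ι} (R : Variation n M ι) (hE : IsLocalVariation E)
    (hQ : IsLocalVariation Q) (t : ℝ) (z : Config n M ι) :
    dvaryF τ R (pairF μ E Q) t z =
      pairing μ (dvaryV τ R E t z) (Q t z) + pairing μ (E t z) (dvaryV τ R Q t z) :=
  hμ.dirDerivF_pairF hE hQ t z τ (R t z)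

end Pairing

end Functionals


/-! ### Euler–Lagrange derivatives -/

section EulerLagrange

variable {n : ℕ} [NeZero n] {M : Type*} [TopologicalSpace M]
  [ChartedSpace (EuclideanHalfSpace n) M] [IsManifold (𝓡∂ n) ∞ M] {ι : Type*}
  [MeasurableSpace M] {μ : Measure M}

/-- The divergence `X w + w div X` of the vector field `w X`. -/
def divSmul (μ : Measure M) (X : VField n M) (w : SmoothFn n M) : SmoothFn n M :=
  X.apply w + w * divergence μ X

theorem isLocal_divSmul (X : VField n M) {L : Density n M ι} (hL : IsLocal L) :
    IsLocal fun t z => divSmul μ X (L t z) :=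
  (IsLocal.deriv X L hL).add (hL.mul (.point _))

theorem dirDeriv_divSmul (X : VField n M) {L : Density n M ι} (hL : IsLocal L) (t : ℝ)
    (z : Config n M ι) (τ : ℝ) (v : Config n M ι) :
    dirDeriv (fun t z => divSmul μ X (L t z)) t z τ v = divSmul μ X (dirDeriv L t z τ v) := by
  unfold divSmul
  rw [dirDeriv_add_fn (IsLocal.deriv X L hL) (hL.mul (.point _)), hL.dirDeriv_vfield,
    dirDeriv_mul_fn hL (.point _), dirDeriv_point, mul_zero, add_zero]

/-- Integration by parts: moving all derivatives off the variation `h` in `a δ_h L` leaves the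
divergence of a current whose coefficients are again derivatives of local functions along `h`. -/
theorem IsLocal.exists_eulerLagrange (μ : Measure M) [Fintype ι] {L : Density n M ι}
    (hL : IsLocal L) {a : Density n M ι} (ha : IsLocal a) :
    ∃ (E : Variation n M ι) (J : Type) (_ : Fintype J) (b c : J → Density n M ι)
      (X : J → VField n M), IsLocalVariation E ∧ (∀ j, IsLocal (b j)) ∧ (∀ j, IsLocal (c j)) ∧
      ∀ t z h, a t z * dirDeriv L t z 0 h = ∑ A, E t z A * h A +
        ∑ j, divSmul μ (X j) (b j t z * dirDeriv (c j) t z 0 h) := by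
  classical
  induction hL generalizing a with
  | time =>
    refine ⟨0, Empty, inferInstance, Empty.elim, Empty.elim, Empty.elim, fun A => .zero,
      fun j => j.elim, fun j => j.elim, fun t z h => ?_⟩
    simp [dirDeriv_time]
  | point g =>
    refine ⟨0, Empty, inferInstance, Empty.elim, Empty.elim, Empty.elim, fun A => .zero,
      fun j => j.elim, fun j => j.elim, fun t z h => ?_⟩
    simp [dirDeriv_point]
  | field A =>
    refine ⟨fun t z => Pi.single A (a t z), Empty, inferInstance, Empty.elim, Empty.elim,
      Empty.elim, fun B => ?_, fun j => j.elim, fun j => j.elim, fun t z h => ?_⟩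
    · by_cases hB : B = A
      · subst hB
        simpa using ha
      · simp only [Pi.single_eq_of_ne hB]
        exact .zero
    · rw [dirDeriv_field, Finset.sum_eq_single A]
      · simp
      · intro B _ hB
        simp [Pi.single_eq_of_ne hB]
      · simp
  | deriv X L hL ih =>
    obtain ⟨E, J, _, b, c, Y, hE, hb, hc, h⟩ := ih (a := fun t z => -divSmul μ X (a t z))
      (isLocal_divSmul X ha).neg
    refine ⟨E, Option J, inferInstance, fun j => j.elim a b, fun j => j.elim L c,
      fun j => j.elim X Y, hE, ?_, ?_, fun t z v => ?_⟩
    · rintro (_ | j)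
      exacts [ha, hb j]
    · rintro (_ | j)
      exacts [hL, hc j]
    · rw [hL.dirDeriv_vfield, Fintype.sum_option]
      simp only [Option.elim]
      rw [add_left_comm, ← h, divSmul, divSmul, X.apply_mul]
      ring
  | comp φ hφ L hL ih =>
    choose E J hJ b c X hE hb hc h using fun i => ih i
      (a := fun t z => a t z * compFn (pderiv φ i) (contDiff_pderiv hφ i) fun j => L j t z)
      (ha.mul (.comp _ _ _ hL))
    refine ⟨fun t z A => ∑ i, E i t z A, Sigma J, inferInstance, fun p => b p.1 p.2,
      fun p => c p.1 p.2, fun p => X p.1 p.2, fun A => .sum_finset fun i => hE i A,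
      fun p => hb _ _, fun p => hc _ _, fun t z v => ?_⟩
    rw [dirDeriv_compFn φ hφ hL, Finset.mul_sum, Fintype.sum_sigma]
    simp only [Finset.sum_mul]
    rw [Finset.sum_comm, ← Finset.sum_add_distrib]
    exact Finset.sum_congr rfl fun i _ => by rw [← h, mul_assoc]

variable [BorelSpace M] [T2Space M] [CompactSpace M]

theorem IsSmoothDensity.integrable_mul (hμ : IsSmoothDensity (n := n) μ) (f g : SmoothFn n M) :
    Integrable (fun x => f x * g x) μ :=
  hμ.integrable (f * g).contMDiff.continuous

theorem IsSmoothDensity.integral_divSmul_eq_zero (hμ : IsSmoothDensity (n := n) μ)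
    (X : VField n M) {w : SmoothFn n M} (hw : tsupport w ⊆ (𝓡∂ n).interior M) :
    ∫ x, divSmul μ X w x ∂μ = 0 := by
  have h := hμ.isDivergence_divergence X w hw
  have : ∀ x, divSmul μ X w x = X.apply w x + divergence μ X x * w x := fun x => by
    simp [divSmul, mul_comm]
  simp only [this]
  rw [integral_add (hμ.integrable (ContMDiffMap.contMDiff _).continuous)
    (hμ.integrable_mul _ _), h]
  exact neg_add_cancel _

omit [MeasurableSpace M] [BorelSpace M] [T2Space M] [CompactSpace M] in
theorem IsLocal.tsupport_mul_dirDeriv_subset [Finite ι] {L : Density n M ι} (hL : IsLocal L)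
    (b : SmoothFn n M) (t : ℝ) (z h : Config n M ι) {s : Set M}
    (hs : ∀ A, tsupport (h A) ⊆ s) : tsupport (b * dirDeriv L t z 0 h) ⊆ s := by
  have hc : IsClosed (⋃ A, tsupport (h A)) := isClosed_iUnion_of_finite fun A => isClosed_tsupport _
  refine (closure_minimal (fun x hx => ?_) hc).trans (Set.iUnion_subset hs)
  by_contra hx'
  refine hx ?_
  have := hL.dirDeriv_eq_zero_of_eqOn t z h hc.isOpen_compl (fun A y hy => ?_) x hx'
  · change b x * dirDeriv L t z 0 h x = 0
    rw [this, mul_zero]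
  · by_contra hne
    exact hy (Set.mem_iUnion.2 ⟨A, subset_tsupport _ hne⟩)

variable [Fintype ι]

/-- The first variation of a local functional. -/
theorem IsSmoothDensity.exists_eulerLagrange (hμ : IsSmoothDensity (n := n) μ)
    {f : Density n M ι} (hf : IsLocal f) {F : Functional n M ι}
    (hF : ∀ t z, F t z = ∫ x, f t z x ∂μ) :
    ∃ (E : Variation n M ι) (J : Type) (_ : Fintype J) (b c : J → Density n M ι)
      (X : J → VField n M), HasFunctionalDeriv μ F E ∧ (∀ j, IsLocal (b j)) ∧
      (∀ j, IsLocal (c j)) ∧ ∀ t z h, dirDeriv f t z 0 h = ∑ A, E t z A * h A +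
        ∑ j, divSmul μ (X j) (b j t z * dirDeriv (c j) t z 0 h) := by
  obtain ⟨E, J, _, b, c, X, hE, hb, hc, h⟩ := hf.exists_eulerLagrange μ (IsLocal.point 1)
  simp only [one_mul] at h
  refine ⟨E, J, inferInstance, b, c, X, ⟨hE, fun t z v hv => ?_⟩, hb, hc, h⟩
  convert hμ.hasDerivAt_fixed_time ⟨f, hf, hF⟩ t z v using 1
  rw [hμ.dirDerivF_eq hf hF, hμ.pairing_eq_integral, h]
  simp only [smoothFn_add_apply]
  rw [integral_add (hμ.integrable (ContMDiffMap.contMDiff _).continuous)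
    (hμ.integrable (ContMDiffMap.contMDiff _).continuous)]
  simp only [smoothFn_sum_apply _ fun j => divSmul _ _ _]
  rw [integral_finsetSum _ fun j _ => hμ.integrable (ContMDiffMap.contMDiff _).continuous]
  rw [Finset.sum_eq_zero fun j _ => hμ.integral_divSmul_eq_zero _
    ((hc j).tsupport_mul_dirDeriv_subset _ t z v hv), add_zero]

theorem IsSmoothDensity.hasFunctionalDeriv_unique (hμ : IsSmoothDensity (n := n) μ)
    {F : Functional n M ι} {E E' : Variation n M ι} (hE : HasFunctionalDeriv μ F E)
    (hE' : HasFunctionalDeriv μ F E') : E = E' := by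
  classical
  ext1 t
  ext1 z
  ext1 A
  rw [← sub_eq_zero]
  refine hμ.eq_zero_of_integral_mul_eq_zero _ fun g hg => ?_
  have hs : ∀ B, tsupport ((Pi.single A g : Config n M ι) B) ⊆ (𝓡∂ n).interior M := fun B => by
    by_cases hB : B = A
    · subst hB
      simpa using hg
    · rw [Pi.single_eq_of_ne hB]
      have : ((0 : SmoothFn n M) : M → ℝ) = 0 := rfl
      simp [this]
  have hp : ∀ E : Config n M ι, pairing μ E (Pi.single A g) = ∫ x, E A x * g x ∂μ := fun E => by
    rw [pairing, Finset.sum_eq_single A]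
    · simp
    · intro B _ hB
      simp [Pi.single_eq_of_ne hB]
    · simp
  have h := (hE.2 t z _ hs).unique (hE'.2 t z _ hs)
  rw [hp, hp] at h
  simp only [smoothFn_sub_apply, sub_mul]
  rw [integral_sub (hμ.integrable_mul _ _) (hμ.integrable_mul _ _), h, sub_self]

theorem IsSmoothDensity.funcDeriv_eq (hμ : IsSmoothDensity (n := n) μ) {F : Functional n M ι}
    {E : Variation n M ι} (hE : HasFunctionalDeriv μ F E) : funcDeriv μ F = E := by
  have h : ∃ E, HasFunctionalDeriv μ F E := ⟨E, hE⟩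
  unfold funcDeriv
  rw [dif_pos h]
  exact hμ.hasFunctionalDeriv_unique h.choose_spec hE

theorem IsSmoothDensity.hasFunctionalDeriv (hμ : IsSmoothDensity (n := n) μ)
    {F : Functional n M ι} (hF : IsLocalFunctional μ F) :
    HasFunctionalDeriv μ F (funcDeriv μ F) := by
  obtain ⟨f, hf, hF⟩ := hF
  obtain ⟨E, _, _, _, _, _, hE, _⟩ := hμ.exists_eulerLagrange hf hF
  rwa [hμ.funcDeriv_eq hE]

theorem IsSmoothDensity.isLocalVariation_funcDeriv (hμ : IsSmoothDensity (n := n) μ)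
    {F : Functional n M ι} (hF : IsLocalFunctional μ F) : IsLocalVariation (funcDeriv μ F) :=
  (hμ.hasFunctionalDeriv hF).1

theorem IsSmoothDensity.dirDerivF_eq_pairing (hμ : IsSmoothDensity (n := n) μ)
    {F : Functional n M ι} (hF : IsLocalFunctional μ F) (t : ℝ) (z : Config n M ι)
    {h : Config n M ι} (hh : ∀ A, tsupport (h A) ⊆ (𝓡∂ n).interior M) :
    dirDerivF F t z 0 h = pairing μ (funcDeriv μ F t z) h :=
  (hμ.hasDerivAt_fixed_time hF t z h).unique ((hμ.hasFunctionalDeriv hF).2 t z h hh)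

theorem IsSmoothDensity.funcDeriv_eq_of_dirDerivF (hμ : IsSmoothDensity (n := n) μ)
    {F : Functional n M ι} (hF : IsLocalFunctional μ F) {E : Variation n M ι}
    (hE : IsLocalVariation E)
    (h : ∀ t (z h : Config n M ι), (∀ A, tsupport (h A) ⊆ (𝓡∂ n).interior M) →
      dirDerivF F t z 0 h = pairing μ (E t z) h) : funcDeriv μ F = E :=
  hμ.funcDeriv_eq ⟨hE, fun t z v hv => by
    rw [← h t z v hv]
    exact hμ.hasDerivAt_fixed_time hF t z v⟩

theorem IsSmoothDensity.funcDeriv_add (hμ : IsSmoothDensity (n := n) μ) {F G : Functional n M ι}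
    (hF : IsLocalFunctional μ F) (hG : IsLocalFunctional μ G) :
    funcDeriv μ (F + G) = funcDeriv μ F + funcDeriv μ G :=
  hμ.funcDeriv_eq_of_dirDerivF (hμ.isLocalFunctional_add hF hG)
    ((hμ.isLocalVariation_funcDeriv hF).add (hμ.isLocalVariation_funcDeriv hG)) fun t z h hh => by
      rw [hμ.dirDerivF_add_fn hF hG, hμ.dirDerivF_eq_pairing hF t z hh,
        hμ.dirDerivF_eq_pairing hG t z hh]
      exact (hμ.pairing_add_left _ _ _).symm

theorem IsSmoothDensity.funcDeriv_sub (hμ : IsSmoothDensity (n := n) μ) {F G : Functional n M ι}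
    (hF : IsLocalFunctional μ F) (hG : IsLocalFunctional μ G) :
    funcDeriv μ (F - G) = funcDeriv μ F - funcDeriv μ G :=
  hμ.funcDeriv_eq_of_dirDerivF (hμ.isLocalFunctional_sub hF hG)
    ((hμ.isLocalVariation_funcDeriv hF).sub (hμ.isLocalVariation_funcDeriv hG)) fun t z h hh => by
      rw [hμ.dirDerivF_sub_fn hF hG, hμ.dirDerivF_eq_pairing hF t z hh,
        hμ.dirDerivF_eq_pairing hG t z hh]
      exact (hμ.pairing_sub_left _ _ _).symm

theorem IsSmoothDensity.funcDeriv_smul (hμ : IsSmoothDensity (n := n) μ) (r : ℝ)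
    {F : Functional n M ι} (hF : IsLocalFunctional μ F) :
    funcDeriv μ (r • F) = r • funcDeriv μ F :=
  hμ.funcDeriv_eq_of_dirDerivF (hF.smul r) ((hμ.isLocalVariation_funcDeriv hF).smul r)
    fun t z h hh => by
      rw [hμ.dirDerivF_smul_fn r hF, hμ.dirDerivF_eq_pairing hF t z hh]
      exact (pairing_smul_left _ _ _).symm

end EulerLagrange

/-! ### Boundary terms of local currents -/

section Currents

variable {n : ℕ} [NeZero n] {M : Type*} [TopologicalSpace M]
  [ChartedSpace (EuclideanHalfSpace n) M] [IsManifold (𝓡∂ n) ∞ M] {ι : Type*}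

/-- The vector field `∑ c_j X_j`. -/
def sumSmul {J : Type*} [Fintype J] (c : J → SmoothFn n M) (X : J → VField n M) : VField n M where
  toFun x := ∑ j, c j x • X j x
  contMDiff_toFun := ContMDiff.sum_section fun j _ =>
    ContMDiff.smul_section (c j).contMDiff (X j).contMDiff

theorem isLocalCurrent_sumSmul {J : Type*} [Fintype J] {c : J → Density n M ι}
    (hc : ∀ j, IsLocal (c j)) (X : J → VField n M) :
    IsLocalCurrent fun t z => sumSmul (fun j => c j t z) X := by
  let e := Fintype.equivFin J
  refine ⟨_, fun i => c (e.symm i), fun i => X (e.symm i), fun i => hc _, fun t z x => ?_⟩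
  exact (Equiv.sum_comp e.symm fun j => c j t z x • X j x).symm

theorem IsLocalCurrent.exists_sumSmul {K : Current n M ι} (hK : IsLocalCurrent K) :
    ∃ (m : ℕ) (c : Fin m → Density n M ι) (X : Fin m → VField n M), (∀ j, IsLocal (c j)) ∧
      K = fun t z => sumSmul (fun j => c j t z) X := by
  obtain ⟨m, c, X, hc, h⟩ := hK
  refine ⟨m, c, X, hc, ?_⟩
  ext1 t
  ext1 z
  ext1 x
  exact h t z x

theorem IsLocalCurrent.add {K K' : Current n M ι} (hK : IsLocalCurrent K)
    (hK' : IsLocalCurrent K') : IsLocalCurrent (K + K') := by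
  obtain ⟨m, c, X, hc, rfl⟩ := hK.exists_sumSmul
  obtain ⟨m', c', X', hc', rfl⟩ := hK'.exists_sumSmul
  have h := isLocalCurrent_sumSmul (c := Sum.elim c c') (by rintro (j | j); exacts [hc j, hc' j])
    (Sum.elim X X')
  convert h using 1
  ext1 t
  ext1 z
  ext1 x
  change (∑ j, c j t z x • X j x) + (∑ j, c' j t z x • X' j x) =
    ∑ j, Sum.elim c c' j t z x • Sum.elim X X' j x
  rw [Fintype.sum_sum_type]
  rfl

theorem IsLocalCurrent.smul (r : ℝ) {K : Current n M ι} (hK : IsLocalCurrent K) :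
    IsLocalCurrent (r • K) := by
  obtain ⟨m, c, X, hc, rfl⟩ := hK.exists_sumSmul
  convert isLocalCurrent_sumSmul (fun j => (hc j).smul r) X using 1
  ext1 t
  ext1 z
  ext1 x
  change r • (∑ j, c j t z x • X j x) = ∑ j, (r * c j t z x) • X j x
  simp only [Finset.smul_sum, mul_smul]

variable [MeasurableSpace M] {μ : Measure M} [BorelSpace M] [T2Space M] [CompactSpace M]

theorem IsSmoothDensity.divergence_sumSmul (hμ : IsSmoothDensity (n := n) μ) {J : Type*}
    [Fintype J] (c : J → SmoothFn n M) (X : J → VField n M) :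
    divergence μ (sumSmul c X) = ∑ j, divSmul μ (X j) (c j) :=
  hμ.divergence_sum_smul fun _ => rfl

theorem IsSmoothDensity.boundaryTerm_add (hμ : IsSmoothDensity (n := n) μ) (K K' : Current n M ι) :
    boundaryTerm μ (K + K') = boundaryTerm μ K + boundaryTerm μ K' := by
  ext t z
  have h : divergence μ (K t z + K' t z) = divergence μ (K t z) + divergence μ (K' t z) := by
    rw [hμ.divergence_sum_smul (J := Bool) (c := fun _ => 1)
      (X := fun b => cond b (K t z) (K' t z))]
    · have : ∀ X : VField n M, X.apply 1 = 0 := fun X => by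
        simpa using X.apply_algebraMap 1
      simp [this]
    · intro x
      rw [Fintype.sum_bool]
      simp
  change ∫ x, divergence μ (K t z + K' t z) x ∂μ = _
  rw [h]
  exact integral_add (hμ.integrable (ContMDiffMap.contMDiff _).continuous)
    (hμ.integrable (ContMDiffMap.contMDiff _).continuous)

theorem IsSmoothDensity.boundaryTerm_smul (hμ : IsSmoothDensity (n := n) μ) (r : ℝ)
    (K : Current n M ι) : boundaryTerm μ (r • K) = r • boundaryTerm μ K := by
  ext t z
  have h : divergence μ (r • K t z) = r • divergence μ (K t z) := by
    rw [hμ.divergence_sum_smul (J := Unit) (c := fun _ => algebraMap ℝ _ r) (X := fun _ => K t z)]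
    · ext x
      simp [VField.apply_algebraMap]
    · intro x
      simp
  change ∫ x, divergence μ (r • K t z) x ∂μ = _
  rw [h]
  exact integral_const_mul _ _

theorem IsSmoothDensity.isLocalFunctional_boundaryTerm (hμ : IsSmoothDensity (n := n) μ)
    {K : Current n M ι} (hK : IsLocalCurrent K) : IsLocalFunctional μ (boundaryTerm μ K) := by
  obtain ⟨m, c, X, hc, rfl⟩ := hK.exists_sumSmul
  refine ⟨_, IsLocal.sum_finset fun j => isLocal_divSmul (μ := μ) (X j) (hc j), fun t z => ?_⟩
  rw [← hμ.divergence_sumSmul]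
  rfl

theorem IsSmoothDensity.exists_dvaryF_boundaryTerm (hμ : IsSmoothDensity (n := n) μ)
    {K : Current n M ι} (hK : IsLocalCurrent K) {Q : Variation n M ι} (hQ : IsLocalVariation Q) :
    ∃ K' : Current n M ι, IsLocalCurrent K' ∧
      dvaryF 0 Q (boundaryTerm μ K) = boundaryTerm μ K' := by
  obtain ⟨m, c, X, hc, rfl⟩ := hK.exists_sumSmul
  refine ⟨_, isLocalCurrent_sumSmul (fun j => (hc j).dvary 0 hQ) X, ?_⟩
  ext t z
  have hd := fun j => isLocal_divSmul (μ := μ) (X j) (hc j)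
  change dirDerivF _ t z 0 _ = ∫ x, divergence μ (sumSmul _ X) x ∂μ
  rw [hμ.dirDerivF_eq (IsLocal.sum_finset hd) fun t z => by
    rw [← hμ.divergence_sumSmul]; rfl, dirDeriv_sum_fn hd, hμ.divergence_sumSmul]
  simp only [dirDeriv_divSmul _ (hc _)]
  rfl

variable [Fintype ι]

/-- A local functional without bulk functional derivative is a boundary term. This is the
homotopy formula `F(z) - F(0) = ∫₀¹ δ_z F(s z) ds`, applied to the divergence which remains of the
first variation; the number `F(t, 0)` is the boundary term of a multiple of a fixed vector field
with non-zero flux. -/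
theorem IsSmoothDensity.exists_boundaryTerm_of_funcDeriv_eq_zero
    (hμ : IsSmoothDensity (n := n) μ) (hM : ((𝓡∂ n).boundary M).Nonempty) {F : Functional n M ι}
    (hF : IsLocalFunctional μ F) (h0 : funcDeriv μ F = 0) :
    ∃ K : Current n M ι, IsLocalCurrent K ∧ F = boundaryTerm μ K := by
  obtain ⟨f, hf, hF⟩ := hF
  obtain ⟨E, J, _, b, c, X, hE, hb, hc, h⟩ := hμ.exists_eulerLagrange hf hF
  have hE0 : E = 0 := by rw [← hμ.funcDeriv_eq hE, h0]
  subst hE0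
  have hP : ∀ j, IsLocalFamily fun s t z => b j t (s • z) * dirDeriv (c j) t (s • z) 0 z :=
    fun j => (hb j).isLocalFamily_scale.mul (hc j).isLocalFamily_dirDeriv_scale
  choose C hC hCP hCX using fun j => (hP j).exists_integral
  obtain ⟨Y, hY⟩ := hμ.exists_boundaryIntegral_ne_zero hM
  -- the value at the zero field is a smooth function of time
  obtain ⟨N, hN, hNF⟩ : ∃ N : Density n M ι, IsLocal N ∧
      ∀ t z x, N t z x = (boundaryIntegral μ Y)⁻¹ * F t 0 := by
    obtain ⟨J', _, φ, hφ, g, hg⟩ := hf.exists_time_family 0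
    have := hμ.isFiniteMeasure
    have hgc : Continuous fun x j => g j x :=
      continuous_pi fun j => (ContMDiffMap.contMDiff _).continuous
    have hK : IsCompact (Set.range fun x j => g j x) := isCompact_range hgc
    have hν : μ.map (fun x j => g j x) (Set.range fun x j => g j x)ᶜ = 0 := by
      rw [Measure.map_apply hgc.measurable hK.isClosed.measurableSet.compl]
      convert measure_empty (μ := μ)
      ext x
      simp
    have hs := contDiff_integral_of_contDiff hK hν hφ
    have hs' : ContDiff ℝ ∞ fun t => F t 0 := by
      convert hs using 2 with t
      have hφt : Continuous fun y => φ (t, y) := hφ.continuous.comp (by fun_prop)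
      rw [hF, integral_map hgc.measurable.aemeasurable hφt.aestronglyMeasurable]
      simp only [hg]
    refine ⟨_, IsLocal.smoothComp (J := Unit) (fun y => (boundaryIntegral μ Y)⁻¹ * F (y ()) 0)
      (contDiff_const.mul (hs'.comp (contDiff_apply ℝ ℝ ()))) (fun _ => IsLocal.time),
      fun t z x => by simp⟩
  refine ⟨_, isLocalCurrent_sumSmul (c := fun j : Option J => j.elim N C)
    (by rintro (_ | j); exacts [hN, hC j]) fun j => j.elim Y X, ?_⟩
  ext t z
  have hfz : ∀ x, f t z x = f t 0 x + (∑ j, divSmul μ (X j) (C j t z)) x := fun x => by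
    have h1 : ∀ s : ℝ, HasDerivAt (fun s : ℝ => f t (s • z) x) (dirDeriv f t (s • z) 0 z x) s :=
      fun s => by simpa using hf.hasDerivAt_line t 0 0 z x s
    have h2 : Continuous fun s : ℝ => dirDeriv f t (s • z) 0 z x :=
      hf.isLocalFamily_dirDeriv_scale.continuous t z x
    have h3 := intervalIntegral.integral_eq_sub_of_hasDerivAt (fun s _ => h1 s)
      (h2.intervalIntegrable 0 1)
    simp only [one_smul, zero_smul] at h3
    rw [← sub_eq_iff_eq_add', ← h3]
    simp only [h, smoothFn_sum_apply, Pi.zero_apply, zero_mul, Finset.sum_const_zero, zero_add]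
    rw [intervalIntegral.integral_finsetSum]
    · refine Finset.sum_congr rfl fun j _ => ?_
      simp only [divSmul, smoothFn_add_apply, smoothFn_mul_apply (C j t z), hCP, hCX]
      rw [← intervalIntegral.integral_mul_const, ← intervalIntegral.integral_add]
      · rfl
      · exact (((hP j).vfield (X j)).continuous t z x).intervalIntegrable _ _
      · exact (((hP j).continuous t z x).mul continuous_const).intervalIntegrable _ _
    · intro j _
      refine Continuous.intervalIntegrable ?_ _ _
      exact (((hP j).vfield (X j)).continuous t z x).add
        (((hP j).continuous t z x).mul continuous_const)
  change F t z = ∫ x, divergence μ (sumSmul _ _) x ∂μ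
  rw [hμ.divergence_sumSmul, Fintype.sum_option, hF]
  simp only [Option.elim, hfz, smoothFn_add_apply _ (∑ j, divSmul μ (X j) (C j t z))]
  rw [integral_add (hμ.integrable (ContMDiffMap.contMDiff _).continuous)
    (hμ.integrable (ContMDiffMap.contMDiff _).continuous), integral_add
    (hμ.integrable (ContMDiffMap.contMDiff _).continuous)
    (hμ.integrable (ContMDiffMap.contMDiff _).continuous), ← hF]
  congr 1
  have hNt : N t z = algebraMap ℝ _ ((boundaryIntegral μ Y)⁻¹ * F t 0) := by
    ext x
    exact hNF t z x
  simp only [divSmul, hNt, Y.apply_algebraMap, zero_add, smoothFn_mul_apply,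
    smoothFn_algebraMap_apply]
  rw [integral_const_mul]
  change F t 0 = _ * boundaryIntegral μ Y
  field_simp

end Currents


/-! ### Boundary conditions -/

section BoundaryConditions

variable {n : ℕ} [NeZero n] {M : Type*} [TopologicalSpace M]
  [ChartedSpace (EuclideanHalfSpace n) M] [IsManifold (𝓡∂ n) ∞ M] {ι κ : Type*}

/-- The local function `L` vanishes on the boundary, for all fields at all times. -/
def VanishesOnBoundary (L : Density n M ι) : Prop :=
  ∀ t z, ∀ y ∈ (𝓡∂ n).boundary M, L t z y = 0

theorem VanishesOnBoundary.dirDeriv {L : Density n M ι} (h : VanishesOnBoundary L)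
    (hL : IsLocal L) (t : ℝ) (z : Config n M ι) (τ : ℝ) (v : Config n M ι) {y : M}
    (hy : y ∈ (𝓡∂ n).boundary M) : dirDeriv L t z τ v y = 0 := by
  rw [dirDeriv_apply hL]
  simp only [h _ _ y hy, deriv_const]

/-- Local functions which agree on the boundary have the same derivatives there. -/
theorem IsLocal.dirDeriv_congr_boundary {L L' : Density n M ι} (hL : IsLocal L) (hL' : IsLocal L')
    (h : ∀ t z, ∀ y ∈ (𝓡∂ n).boundary M, L t z y = L' t z y) (t : ℝ) (z : Config n M ι) (τ : ℝ)
    (v : Config n M ι) {y : M} (hy : y ∈ (𝓡∂ n).boundary M) :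
    dirDeriv L t z τ v y = dirDeriv L' t z τ v y := by
  rw [dirDeriv_apply hL, dirDeriv_apply hL']
  simp only [h _ _ y hy]

theorem IsLocal.dvary_comm_apply {L : Density n M ι} (hL : IsLocal L) (τ τ' : ℝ)
    {Q R : Variation n M ι} (hQ : IsLocalVariation Q) (hR : IsLocalVariation R) (t : ℝ)
    (z : Config n M ι) (y : M) :
    BoundarySources.dvary τ Q (BoundarySources.dvary τ' R L) t z y =
      BoundarySources.dvary τ' R (BoundarySources.dvary τ Q L) t z y +
        BoundarySources.dvary 0 (BoundarySources.dvaryV τ Q R - BoundarySources.dvaryV τ' R Q) L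
          t z y := by
  rw [← hL.dvary_comm τ τ' hQ hR, smoothFn_sub_apply, add_sub_cancel]

theorem IsLocalVariation.commutator {Q R : Variation n M ι} (hQ : IsLocalVariation Q)
    (hR : IsLocalVariation R) : IsLocalVariation (commutator Q R) :=
  (hQ.dvaryV 0 hR).sub (hR.dvaryV 0 hQ)

variable [MeasurableSpace M] {μ : Measure M} [BorelSpace M] [T2Space M] [CompactSpace M]
  [Fintype ι]

theorem IsSmoothDensity.isLocalVariation_hamVariation (hμ : IsSmoothDensity (n := n) μ)
    (σ : Matrix ι ι ℝ) {F : Functional n M ι} (hF : IsLocalFunctional μ F) :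
    IsLocalVariation (hamVariation μ σ F) := fun A =>
  .sum_finset fun B => (hμ.isLocalVariation_funcDeriv hF B).smul (σ A B)

variable {S : System n M ι κ}

/-- The evolution `δ_H z^A` of the fields. -/
def System.evolution (S : System n M ι κ) (μ : Measure M) : Variation n M ι :=
  hamVariation μ S.σ S.H

/-- The infinitesimal variation `h` of the fields `z` at time `t` fixes the sources and all their
time derivatives. -/
def System.FixesSources (S : System n M ι κ) (μ : Measure M) (t : ℝ) (z h : Config n M ι) : Prop :=
  ∀ (k : ℕ) (α : κ), ∀ y ∈ (𝓡∂ n).boundary M, dirDeriv (S.chi μ k α) t z 0 h y = 0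

variable [DecidableEq ι]

theorem System.IsRegular.isLocalVariation_evolution (hS : S.IsRegular μ)
    (hμ : IsSmoothDensity (n := n) μ) : IsLocalVariation (S.evolution μ) :=
  hμ.isLocalVariation_hamVariation _ hS.local_H

theorem System.IsRegular.isLocal_chi (hS : S.IsRegular μ) (hμ : IsSmoothDensity (n := n) μ)
    (k : ℕ) (α : κ) : IsLocal (S.chi μ k α) := by
  induction k with
  | zero => exact hS.local_χ α
  | succ k ih => exact ih.dvary 1 (hS.isLocalVariation_evolution hμ)

omit [BorelSpace M] [T2Space M] [CompactSpace M] [DecidableEq ι] in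
theorem System.chi_succ (k : ℕ) (α : κ) :
    S.chi μ (k + 1) α = dvary 1 (S.evolution μ) (S.chi μ k α) := rfl

theorem System.IsRegular.fixesSources_of_tsupport (hS : S.IsRegular μ)
    (hμ : IsSmoothDensity (n := n) μ) (t : ℝ) (z : Config n M ι) {h : Config n M ι}
    (hh : ∀ A, tsupport (h A) ⊆ (𝓡∂ n).interior M) : S.FixesSources μ t z h := by
  intro k α y hy
  by_contra hne
  have hs := (hS.isLocal_chi hμ k α).tsupport_mul_dirDeriv_subset 1 t z h hh
  rw [one_mul] at hs
  exact Set.disjoint_left.1 (𝓡∂ n).disjoint_interior_boundary (hs (subset_tsupport _ hne)) hy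

/-- The velocity `v` is compatible with the external boundary conditions if and only if it differs
from the Hamiltonian evolution by a variation at fixed sources. -/
theorem System.IsRegular.externalBC_iff (hS : S.IsRegular μ) (hμ : IsSmoothDensity (n := n) μ)
    (t : ℝ) (z v : Config n M ι) :
    S.ExternalBC μ t z v ↔ S.FixesSources μ t z (v - S.evolution μ t z) := by
  refine forall₂_congr fun k α => forall₂_congr fun y hy => ?_
  have h := (hS.isLocal_chi hμ k α).dirDeriv_sub t z 1 1 v (S.evolution μ t z)
  rw [sub_self] at h
  rw [h, smoothFn_sub_apply, sub_eq_zero]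
  rfl

theorem System.IsRegular.externalBC_add (hS : S.IsRegular μ) (hμ : IsSmoothDensity (n := n) μ)
    {t : ℝ} {z h : Config n M ι} (hh : S.FixesSources μ t z h) :
    S.ExternalBC μ t z (S.evolution μ t z + h) := by
  rwa [hS.externalBC_iff hμ, add_sub_cancel_left]

theorem System.IsRegular.fixesSources_zero (hS : S.IsRegular μ) (hμ : IsSmoothDensity (n := n) μ)
    (t : ℝ) (z : Config n M ι) : S.FixesSources μ t z 0 := fun k α y _ => by
  rw [(hS.isLocal_chi hμ k α).dirDeriv_zero, smoothFn_zero_apply]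

theorem System.IsRegular.externalBC_evolution (hS : S.IsRegular μ)
    (hμ : IsSmoothDensity (n := n) μ) (t : ℝ) (z : Config n M ι) :
    S.ExternalBC μ t z (S.evolution μ t z) := by
  simpa using hS.externalBC_add hμ (hS.fixesSources_zero hμ t z)

/-- A variation preserves the external boundary conditions if and only if, on the boundary, it
commutes with the time evolution of the sources, and transforms the sources among themselves. -/
theorem System.IsRegular.preservesExternal_iff (hS : S.IsRegular μ)
    (hμ : IsSmoothDensity (n := n) μ) {Q : Variation n M ι} (hQ : IsLocalVariation Q) :
    S.PreservesExternal μ Q ↔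
      (∀ k α t z, ∀ y ∈ (𝓡∂ n).boundary M, dvary 0 Q (S.chi μ (k + 1) α) t z y =
        dvary 1 (S.evolution μ) (dvary 0 Q (S.chi μ k α)) t z y) ∧
      ∀ t z h, S.FixesSources μ t z h → ∀ k α, ∀ y ∈ (𝓡∂ n).boundary M,
        dirDeriv (dvary 0 Q (S.chi μ k α)) t z 0 h y = 0 := by
  have hl := fun k α => (hS.isLocal_chi hμ k α).dvary 0 hQ
  constructor
  · intro h
    have h1 : ∀ k α t z, ∀ y ∈ (𝓡∂ n).boundary M, dvary 0 Q (S.chi μ (k + 1) α) t z y =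
        dvary 1 (S.evolution μ) (dvary 0 Q (S.chi μ k α)) t z y := fun k α t z y hy =>
      (h t z _ (hS.externalBC_evolution hμ t z) k α y hy).symm
    refine ⟨h1, fun t z v hv k α y hy => ?_⟩
    have h2 : dirDeriv (dvary 0 Q (S.chi μ k α)) t z 1 (S.evolution μ t z + v) y = _ :=
      h t z _ (hS.externalBC_add hμ hv) k α y hy
    have h3 := (hl k α).dirDeriv_add t z 1 0 (S.evolution μ t z) v
    rw [add_zero] at h3
    rw [h3, smoothFn_add_apply, vary_eq_dvary, h1 k α t z y hy] at h2
    exact left_eq_add.1 h2.symm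
  · rintro ⟨h1, h2⟩ t z v hv k α y hy
    have h3 := (hl k α).dirDeriv_add t z 1 0 (S.evolution μ t z) (v - S.evolution μ t z)
    rw [add_zero, add_sub_cancel] at h3
    change dirDeriv (dvary 0 Q (S.chi μ k α)) t z 1 v y = dvary 0 Q (S.chi μ (k + 1) α) t z y
    rw [h3, smoothFn_add_apply, h2 t z _ ((hS.externalBC_iff hμ t z v).1 hv) k α y hy, add_zero,
      h1 k α t z y hy]
    rfl

/-- A local variation preserves the internal boundary conditions if and only if at each
configuration it fixes the sources together with all their time derivatives. -/
theorem System.IsRegular.preservesInternal_iff (hS : S.IsRegular μ)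
    (hμ : IsSmoothDensity (n := n) μ) {δ : Variation n M ι} :
    S.PreservesInternal μ δ ↔ IsLocalVariation δ ∧ ∀ t z, S.FixesSources μ t z (δ t z) := by
  constructor
  · rintro ⟨hδ, h0, h⟩
    obtain ⟨h1, -⟩ := (hS.preservesExternal_iff hμ hδ).1 h
    have key : ∀ k α, VanishesOnBoundary (dvary 0 δ (S.chi μ k α)) := by
      intro k
      induction k with
      | zero => exact h0
      | succ k ih =>
        intro α t z y hy
        rw [h1 k α t z y hy]
        exact (ih α).dirDeriv ((hS.isLocal_chi hμ k α).dvary 0 hδ) _ _ _ _ hy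
    exact ⟨hδ, fun t z k α => key k α t z⟩
  · rintro ⟨hδ, h⟩
    have key : ∀ k α, VanishesOnBoundary (dvary 0 δ (S.chi μ k α)) :=
      fun k α t z y hy => h t z k α y hy
    refine ⟨hδ, fun α => key 0 α, (hS.preservesExternal_iff hμ hδ).2
      ⟨fun k α t z y hy => ?_, fun t z v _ k α y hy => ?_⟩⟩
    · rw [key (k + 1) α t z y hy]
      exact ((key k α).dirDeriv ((hS.isLocal_chi hμ k α).dvary 0 hδ) _ _ _ _ hy).symm
    · exact (key k α).dirDeriv ((hS.isLocal_chi hμ k α).dvary 0 hδ) _ _ _ _ hy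

/-- Variations preserving the external boundary conditions normalize those preserving the internal
ones. -/
theorem System.IsRegular.preservesInternal_commutator (hS : S.IsRegular μ)
    (hμ : IsSmoothDensity (n := n) μ) {δ Q : Variation n M ι} (hδ : S.PreservesInternal μ δ)
    (hQ : IsLocalVariation Q) (hQS : S.PreservesExternal μ Q) :
    S.PreservesInternal μ (dvaryV 0 δ Q - dvaryV 0 Q δ) := by
  obtain ⟨hδl, hδS⟩ := (hS.preservesInternal_iff hμ).1 hδ
  refine (hS.preservesInternal_iff hμ).2 ⟨(hδl.dvaryV 0 hQ).sub (hQ.dvaryV 0 hδl), ?_⟩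
  intro t z k α y hy
  have hχ := hS.isLocal_chi hμ k α
  have h := hχ.dvary_comm_apply 0 0 hδl hQ t z y
  have h1 : dvary 0 δ (dvary 0 Q (S.chi μ k α)) t z y = 0 :=
    ((hS.preservesExternal_iff hμ hQ).1 hQS).2 t z _ (hδS t z) k α y hy
  have h2 : VanishesOnBoundary (dvary 0 δ (S.chi μ k α)) := fun t z y hy => hδS t z k α y hy
  have h3 : dvary 0 Q (dvary 0 δ (S.chi μ k α)) t z y = 0 :=
    h2.dirDeriv (hχ.dvary 0 hδl) _ _ _ _ hy
  rw [h1, h3, zero_add] at h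
  exact h.symm

/-- The commutator of a variation acting on the sources with the time evolution fixes the
sources. -/
theorem System.IsRegular.preservesInternal_commutator_evolution (hS : S.IsRegular μ)
    (hμ : IsSmoothDensity (n := n) μ) {Q : Variation n M ι}
    (hQ : IsLocalVariation Q) (hQS : S.PreservesExternal μ Q) :
    S.PreservesInternal μ (dvaryV 0 Q (S.evolution μ) - dvaryV 1 (S.evolution μ) Q) := by
  have hW := hS.isLocalVariation_evolution hμ
  refine (hS.preservesInternal_iff hμ).2 ⟨(hQ.dvaryV 0 hW).sub (hW.dvaryV 1 hQ), ?_⟩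
  intro t z k α y hy
  have h := (hS.isLocal_chi hμ k α).dvary_comm_apply 0 1 hQ hW t z y
  have h1 := ((hS.preservesExternal_iff hμ hQ).1 hQS).1 k α t z y hy
  rw [S.chi_succ] at h1
  rw [h1] at h
  exact (left_eq_add.1 h)

/-- For local variations, preserving the external boundary conditions implies acting on the
sources. -/
theorem System.IsRegular.actsOnSources_iff (hS : S.IsRegular μ) (hμ : IsSmoothDensity (n := n) μ)
    {Q : Variation n M ι} (hQ : IsLocalVariation Q) :
    S.ActsOnSources μ Q ↔ S.PreservesExternal μ Q := by
  refine ⟨fun h => h.1, fun h => ⟨h, fun δ hδ α t z y hy => ?_⟩⟩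
  have h1 := ((hS.preservesInternal_iff hμ).1
    (hS.preservesInternal_commutator hμ hδ hQ h)).2 t z 0 α y hy
  rw [← smoothFn_sub_apply]
  have h2 := (hS.isLocal_chi hμ 0 α).dvary_comm 0 0 hδ.1 hQ t z
  exact (congrArg (fun g : SmoothFn n M => g y) h2).trans h1

theorem System.IsRegular.preservesExternal_add (hS : S.IsRegular μ)
    (hμ : IsSmoothDensity (n := n) μ) {Q R : Variation n M ι} (hQ : IsLocalVariation Q)
    (hR : IsLocalVariation R) (hQS : S.PreservesExternal μ Q) (hRS : S.PreservesExternal μ R) :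
    S.PreservesExternal μ (Q + R) := by
  have key : ∀ k α, dvary 0 (Q + R) (S.chi μ k α) =
      fun t z => dvary 0 Q (S.chi μ k α) t z + dvary 0 R (S.chi μ k α) t z := by
    intro k α
    ext1 t
    ext1 z
    have h := (hS.isLocal_chi hμ k α).dirDeriv_add t z 0 0 (Q t z) (R t z)
    rw [add_zero] at h
    exact h
  rw [hS.preservesExternal_iff hμ hQ] at hQS
  rw [hS.preservesExternal_iff hμ hR] at hRS
  have hlQ := fun k α => (hS.isLocal_chi hμ k α).dvary 0 hQ
  have hlR := fun k α => (hS.isLocal_chi hμ k α).dvary 0 hR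
  refine (hS.preservesExternal_iff hμ (hQ.add hR)).2
    ⟨fun k α t z y hy => ?_, fun t z h hh k α y hy => ?_⟩
  · have h1 := hQS.1 k α t z y hy
    have h2 := hRS.1 k α t z y hy
    rw [key, key, dvary, dirDeriv_add_fn (hlQ k α) (hlR k α), smoothFn_add_apply,
      smoothFn_add_apply, h1, h2]
    rfl
  · rw [key, dirDeriv_add_fn (hlQ k α) (hlR k α), smoothFn_add_apply, hQS.2 t z h hh k α y hy,
      hRS.2 t z h hh k α y hy, add_zero]

theorem System.IsRegular.preservesExternal_smul (hS : S.IsRegular μ)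
    (hμ : IsSmoothDensity (n := n) μ) (r : ℝ) {Q : Variation n M ι} (hQ : IsLocalVariation Q)
    (hQS : S.PreservesExternal μ Q) : S.PreservesExternal μ (r • Q) := by
  have key : ∀ k α, dvary 0 (r • Q) (S.chi μ k α) =
      fun t z => r • dvary 0 Q (S.chi μ k α) t z := by
    intro k α
    ext1 t
    ext1 z
    have h := (hS.isLocal_chi hμ k α).dirDeriv_smul t z r 0 (Q t z)
    rw [mul_zero] at h
    exact h
  rw [hS.preservesExternal_iff hμ hQ] at hQS
  have hlQ := fun k α => (hS.isLocal_chi hμ k α).dvary 0 hQ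
  refine (hS.preservesExternal_iff hμ (hQ.smul r)).2
    ⟨fun k α t z y hy => ?_, fun t z h hh k α y hy => ?_⟩
  · have h1 := hQS.1 k α t z y hy
    rw [key, key, dvary, dirDeriv_smul_fn r (hlQ k α), smoothFn_smul_apply, smoothFn_smul_apply, h1]
    rfl
  · rw [key, dirDeriv_smul_fn r (hlQ k α), smoothFn_smul_apply, hQS.2 t z h hh k α y hy, mul_zero]

theorem System.IsRegular.preservesExternal_commutator (hS : S.IsRegular μ)
    (hμ : IsSmoothDensity (n := n) μ) {Q R : Variation n M ι} (hQ : IsLocalVariation Q)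
    (hR : IsLocalVariation R) (hQS : S.PreservesExternal μ Q) (hRS : S.PreservesExternal μ R) :
    S.PreservesExternal μ (commutator Q R) := by
  have hW := hS.isLocalVariation_evolution hμ
  -- one half of the two conditions; the other one follows by exchanging `Q` and `R`
  have key1 : ∀ Q R : Variation n M ι, IsLocalVariation Q → IsLocalVariation R →
      S.PreservesExternal μ Q → S.PreservesExternal μ R → ∀ k α t z, ∀ y ∈ (𝓡∂ n).boundary M,
      dvary 0 Q (dvary 0 R (S.chi μ (k + 1) α)) t z y =
        dvary 1 (S.evolution μ) (dvary 0 Q (dvary 0 R (S.chi μ k α))) t z y := by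
    intro Q R hQ hR hQS hRS k α t z y hy
    have hlR := fun k => (hS.isLocal_chi hμ k α).dvary 0 hR
    have hcomm := hS.preservesInternal_commutator_evolution hμ hQ hQS
    rw [hS.preservesExternal_iff hμ hR] at hRS
    have h1 : dvary 0 Q (dvary 0 R (S.chi μ (k + 1) α)) t z y =
        dvary 0 Q (dvary 1 (S.evolution μ) (dvary 0 R (S.chi μ k α))) t z y :=
      (hlR (k + 1)).dirDeriv_congr_boundary ((hlR k).dvary 1 hW)
        (fun t z y hy => hRS.1 k α t z y hy) _ _ _ _ hy
    have h2 : dvary 0 (dvaryV 0 Q (S.evolution μ) - dvaryV 1 (S.evolution μ) Q)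
        (dvary 0 R (S.chi μ k α)) t z y = 0 :=
      hRS.2 t z _ (((hS.preservesInternal_iff hμ).1 hcomm).2 t z) k α y hy
    rw [h1, (hlR k).dvary_comm_apply 0 1 hQ hW, h2, add_zero]
  have key2 : ∀ Q R : Variation n M ι, IsLocalVariation Q → IsLocalVariation R →
      S.PreservesExternal μ Q → S.PreservesExternal μ R → ∀ t z h, S.FixesSources μ t z h →
      ∀ k α, ∀ y ∈ (𝓡∂ n).boundary M,
      dirDeriv (dvary 0 Q (dvary 0 R (S.chi μ k α))) t z 0 h y = 0 := by
    intro Q R hQ hR hQS hRS t z h hh k α y hy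
    obtain ⟨δ, hδ, rfl⟩ := hS.fixed_sources t z h hh
    have hlR := (hS.isLocal_chi hμ k α).dvary 0 hR
    have hcomm := hS.preservesInternal_commutator hμ hδ hQ hQS
    rw [hS.preservesExternal_iff hμ hR] at hRS
    have h1 : VanishesOnBoundary (dvary 0 δ (dvary 0 R (S.chi μ k α))) := fun t z y hy =>
      hRS.2 t z _ (((hS.preservesInternal_iff hμ).1 hδ).2 t z) k α y hy
    have h2 : dvary 0 Q (dvary 0 δ (dvary 0 R (S.chi μ k α))) t z y = 0 :=
      h1.dirDeriv (hlR.dvary 0 hδ.1) _ _ _ _ hy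
    have h3 : dvary 0 (dvaryV 0 δ Q - dvaryV 0 Q δ) (dvary 0 R (S.chi μ k α)) t z y = 0 :=
      hRS.2 t z _ (((hS.preservesInternal_iff hμ).1 hcomm).2 t z) k α y hy
    have h4 := hlR.dvary_comm_apply 0 0 hδ.1 hQ t z y
    rw [h2, h3, add_zero] at h4
    exact h4
  have key : ∀ k α, dvary 0 (commutator Q R) (S.chi μ k α) = fun t z =>
      dvary 0 Q (dvary 0 R (S.chi μ k α)) t z - dvary 0 R (dvary 0 Q (S.chi μ k α)) t z := by
    intro k α
    ext1 t
    ext1 z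
    exact ((hS.isLocal_chi hμ k α).dvary_comm 0 0 hQ hR t z).symm
  have hlQR := fun k α => ((hS.isLocal_chi hμ k α).dvary 0 hR).dvary 0 hQ
  have hlRQ := fun k α => ((hS.isLocal_chi hμ k α).dvary 0 hQ).dvary 0 hR
  refine (hS.preservesExternal_iff hμ (hQ.commutator hR)).2
    ⟨fun k α t z y hy => ?_, fun t z h hh k α y hy => ?_⟩
  · have h1 := key1 Q R hQ hR hQS hRS k α t z y hy
    have h2 := key1 R Q hR hQ hRS hQS k α t z y hy
    rw [key, key, dvary, dirDeriv_sub_fn (hlQR k α) (hlRQ k α), smoothFn_sub_apply,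
      smoothFn_sub_apply, h1, h2]
    rfl
  · rw [key, dirDeriv_sub_fn (hlQR k α) (hlRQ k α), smoothFn_sub_apply,
      key2 Q R hQ hR hQS hRS t z h hh k α y hy, key2 R Q hR hQ hRS hQS t z h hh k α y hy, sub_zero]

end BoundaryConditions


/-! ### The modified bracket -/

section Brackets

variable {n : ℕ} [NeZero n] {M : Type*} [TopologicalSpace M]
  [ChartedSpace (EuclideanHalfSpace n) M] [IsManifold (𝓡∂ n) ∞ M] {ι κ : Type*} [Fintype ι]

/-- The action `(σ E)^A = σ^{AB} E_B` of a constant matrix on the fields. -/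
def sharp (σ : Matrix ι ι ℝ) : Config n M ι →ₗ[ℝ] Config n M ι where
  toFun E A := ∑ B, σ A B • E B
  map_add' E E' := by
    ext1 A
    simp only [Pi.add_apply, smul_add, Finset.sum_add_distrib]
  map_smul' r E := by
    ext1 A
    simp only [Pi.smul_apply, Finset.smul_sum, RingHom.id_apply]
    exact Finset.sum_congr rfl fun B _ => smul_comm _ _ _

theorem sharp_apply (σ : Matrix ι ι ℝ) (E : Config n M ι) (A : ι) :
    sharp σ E A = ∑ B, σ A B • E B := rfl

theorem sharp_neg (σ : Matrix ι ι ℝ) (E : Config n M ι) : sharp (-σ) E = -sharp σ E := by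
  ext1 A
  simp [sharp_apply]

theorem sharp_sharp (σ σ' : Matrix ι ι ℝ) (E : Config n M ι) :
    sharp σ (sharp σ' E) = sharp (σ * σ') E := by
  ext1 A
  simp only [sharp_apply, Matrix.mul_apply, Finset.smul_sum, Finset.sum_smul, smul_smul]
  exact Finset.sum_comm

theorem sharp_one [DecidableEq ι] (E : Config n M ι) : sharp (1 : Matrix ι ι ℝ) E = E := by
  ext1 A
  simp [sharp_apply, Matrix.one_apply]

theorem isLocalVariation_sharp (σ : Matrix ι ι ℝ) {E : Variation n M ι} (hE : IsLocalVariation E) :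
    IsLocalVariation fun t z => sharp σ (E t z) := fun A =>
  .sum_finset fun B => (hE B).smul (σ A B)

theorem dirDeriv_sharp (σ : Matrix ι ι ℝ) {E : Variation n M ι} (hE : IsLocalVariation E) (t : ℝ)
    (z : Config n M ι) (τ : ℝ) (v : Config n M ι) :
    (fun A => dirDeriv (fun t z => sharp σ (E t z) A) t z τ v) =
      sharp σ fun A => dirDeriv (fun t z => E t z A) t z τ v := by
  ext1 A
  refine (dirDeriv_sum_fn (fun B => (hE B).smul (σ A B)) t z τ v).trans ?_
  exact Finset.sum_congr rfl fun B _ => dirDeriv_smul_fn _ (hE B) t z τ v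

variable [MeasurableSpace M] {μ : Measure M}

theorem hamVariation_eq_sharp (σ : Matrix ι ι ℝ) (F : Functional n M ι) :
    hamVariation μ σ F = fun t z => sharp σ (funcDeriv μ F t z) := rfl

variable [BorelSpace M] [T2Space M] [CompactSpace M]

theorem IsSmoothDensity.pairing_sharp (hμ : IsSmoothDensity (n := n) μ) (σ : Matrix ι ι ℝ)
    (E E' : Config n M ι) : pairing μ E (sharp σ E') = pairing μ E' (sharp σ.transpose E) := by
  rw [hμ.pairing_eq_integral, hμ.pairing_eq_integral]
  congr 1
  ext1 x
  refine congrArg (fun g : SmoothFn n M => g x) ?_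
  simp only [sharp_apply, Finset.mul_sum, Matrix.transpose_apply]
  rw [Finset.sum_comm]
  refine Finset.sum_congr rfl fun B _ => Finset.sum_congr rfl fun A _ => ?_
  rw [mul_smul_comm, mul_smul_comm, mul_comm]

theorem IsSmoothDensity.pairing_sharp_of_skew (hμ : IsSmoothDensity (n := n) μ) {σ : Matrix ι ι ℝ}
    (hσ : σ.transpose = -σ) (E E' : Config n M ι) :
    pairing μ E (sharp σ E') = -pairing μ E' (sharp σ E) := by
  rw [hμ.pairing_sharp, hσ, sharp_neg, ← neg_one_smul ℝ (sharp σ E), pairing_smul_right]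
  ring

/-- The derivation `τ ∂_t + δ_Q` applied to `σ^{AB} δF/δz^B`. -/
theorem IsSmoothDensity.dvaryV_hamVariation (hμ : IsSmoothDensity (n := n) μ) (σ : Matrix ι ι ℝ)
    {F : Functional n M ι} (hF : IsLocalFunctional μ F) (τ : ℝ) (Q : Variation n M ι) (t : ℝ)
    (z : Config n M ι) :
    dvaryV τ Q (hamVariation μ σ F) t z = sharp σ (dvaryV τ Q (funcDeriv μ F) t z) :=
  dirDeriv_sharp σ (hμ.isLocalVariation_funcDeriv hF) t z τ _

omit [BorelSpace M] [T2Space M] [CompactSpace M] in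
/-- The modified bracket is `δ_G F - δ_F G + ∫ (δG/δz^A) δ_F z^A dⁿx`, in which the boundary
variations no longer occur. -/
theorem modifiedBracket_eq (σ : Matrix ι ι ℝ) (F G : Functional n M ι) :
    modifiedBracket μ σ F G = dvaryF 0 (hamVariation μ σ G) F - dvaryF 0 (hamVariation μ σ F) G +
      pairF μ (funcDeriv μ G) (hamVariation μ σ F) := by
  ext t z
  simp only [modifiedBracket, poissonBracket, boundaryVariation, Pi.add_apply, Pi.sub_apply, dvaryF,
    dirDerivF, pairF, mul_zero, add_zero]
  ring

theorem IsSmoothDensity.isLocalFunctional_modifiedBracket (hμ : IsSmoothDensity (n := n) μ)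
    (σ : Matrix ι ι ℝ) {F G : Functional n M ι} (hF : IsLocalFunctional μ F)
    (hG : IsLocalFunctional μ G) : IsLocalFunctional μ (modifiedBracket μ σ F G) := by
  have hXF := hμ.isLocalVariation_hamVariation σ hF
  have hXG := hμ.isLocalVariation_hamVariation σ hG
  rw [modifiedBracket_eq]
  exact hμ.isLocalFunctional_add (hμ.isLocalFunctional_sub (hμ.isLocalFunctional_dvaryF 0 hXG hF)
    (hμ.isLocalFunctional_dvaryF 0 hXF hG))
    (hμ.isLocalFunctional_pairF (hμ.isLocalVariation_funcDeriv hG) hXF)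

/-- The modified bracket of local functionals along a variation `δ` for which `F` and `G` have no
boundary variation. Boundary conditions enter only through the assumption that the same
holds for the commutators of `δ` with the variations generated by `F` and `G`. -/
theorem IsSmoothDensity.dvaryF_modifiedBracket (hμ : IsSmoothDensity (n := n) μ)
    {σ : Matrix ι ι ℝ} (hσ : σ.transpose = -σ) {F G : Functional n M ι}
    (hF : IsLocalFunctional μ F) (hG : IsLocalFunctional μ G) {δ : Variation n M ι}
    (hδ : IsLocalVariation δ) (hδF : dvaryF 0 δ F = pairF μ (funcDeriv μ F) δ)
    (hδG : dvaryF 0 δ G = pairF μ (funcDeriv μ G) δ) {t : ℝ} {z : Config n M ι}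
    (hF' : dvaryF 0 (dvaryV 0 δ (hamVariation μ σ G) - dvaryV 0 (hamVariation μ σ G) δ) F t z =
      pairing μ (funcDeriv μ F t z)
        ((dvaryV 0 δ (hamVariation μ σ G) - dvaryV 0 (hamVariation μ σ G) δ) t z))
    (hG' : dvaryF 0 (dvaryV 0 δ (hamVariation μ σ F) - dvaryV 0 (hamVariation μ σ F) δ) G t z =
      pairing μ (funcDeriv μ G t z)
        ((dvaryV 0 δ (hamVariation μ σ F) - dvaryV 0 (hamVariation μ σ F) δ) t z)) :
    dvaryF 0 δ (modifiedBracket μ σ F G) t z =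
      pairing μ ((dvaryV 0 (hamVariation μ σ G) (funcDeriv μ F) -
        dvaryV 0 (hamVariation μ σ F) (funcDeriv μ G)) t z) (δ t z) := by
  have hXF := hμ.isLocalVariation_hamVariation σ hF
  have hXG := hμ.isLocalVariation_hamVariation σ hG
  have hEF := hμ.isLocalVariation_funcDeriv hF
  have hEG := hμ.isLocalVariation_funcDeriv hG
  have hGF := hμ.isLocalFunctional_dvaryF 0 hXG hF
  have hFG := hμ.isLocalFunctional_dvaryF 0 hXF hG
  have hp := hμ.isLocalFunctional_pairF hEG hXF
  have h1 := hμ.dvaryF_comm 0 0 hδ hXG hF t z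
  rw [hδF, hF', hμ.dvaryF_pairF 0 _ hEF hδ] at h1
  have h2 := hμ.dvaryF_comm 0 0 hδ hXF hG t z
  rw [hδG, hG', hμ.dvaryF_pairF 0 _ hEG hδ] at h2
  have h3 := hμ.dvaryF_pairF 0 δ hEG hXF t z
  have h4 : dvaryF 0 δ (modifiedBracket μ σ F G) t z =
      dvaryF 0 δ (dvaryF 0 (hamVariation μ σ G) F) t z -
        dvaryF 0 δ (dvaryF 0 (hamVariation μ σ F) G) t z +
        dvaryF 0 δ (pairF μ (funcDeriv μ G) (hamVariation μ σ F)) t z := by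
    rw [modifiedBracket_eq, dvaryF, hμ.dirDerivF_add_fn (hμ.isLocalFunctional_sub hGF hFG) hp,
      hμ.dirDerivF_sub_fn hGF hFG]
    rfl
  simp only [Pi.sub_apply, hμ.pairing_sub_right, hμ.pairing_sub_left] at h1 h2 ⊢
  have h5 : pairing μ (funcDeriv μ F t z) (dvaryV 0 δ (hamVariation μ σ G) t z) =
      -pairing μ (dvaryV 0 δ (funcDeriv μ G) t z) (hamVariation μ σ F t z) := by
    rw [hμ.dvaryV_hamVariation σ hG, hμ.pairing_sharp_of_skew hσ]
    rfl
  linarith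

theorem tsupport_dirDeriv_subset {Q : Variation n M ι} (hQ : IsLocalVariation Q) (t : ℝ)
    (z : Config n M ι) {h : Config n M ι} (hh : ∀ A, tsupport (h A) ⊆ (𝓡∂ n).interior M) (A : ι) :
    tsupport (dirDeriv (fun t z => Q t z A) t z 0 h) ⊆ (𝓡∂ n).interior M := by
  have := (hQ A).tsupport_mul_dirDeriv_subset 1 t z h hh
  rwa [one_mul] at this

/-- The functional derivative of the bracket. The boundary variations of `F` and `G` play no role,
since they are invisible to variations supported away from the boundary. -/
theorem IsSmoothDensity.funcDeriv_modifiedBracket (hμ : IsSmoothDensity (n := n) μ)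
    {σ : Matrix ι ι ℝ} (hσ : σ.transpose = -σ) {F G : Functional n M ι}
    (hF : IsLocalFunctional μ F) (hG : IsLocalFunctional μ G) :
    funcDeriv μ (modifiedBracket μ σ F G) = dvaryV 0 (hamVariation μ σ G) (funcDeriv μ F) -
        dvaryV 0 (hamVariation μ σ F) (funcDeriv μ G) := by
  have hXF := hμ.isLocalVariation_hamVariation σ hF
  have hXG := hμ.isLocalVariation_hamVariation σ hG
  refine hμ.funcDeriv_eq_of_dirDerivF (hμ.isLocalFunctional_modifiedBracket σ hF hG)
    ((hXG.dvaryV 0 (hμ.isLocalVariation_funcDeriv hF)).sub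
      (hXF.dvaryV 0 (hμ.isLocalVariation_funcDeriv hG))) fun t z h hh => ?_
  have hc : ∀ Q : Variation n M ι, dvaryV 0 Q (fun _ _ => h) = 0 := fun Q => by
    ext1 t
    ext1 z
    ext1 A
    exact dirDeriv_point _ _ _ _ _
  refine hμ.dvaryF_modifiedBracket hσ hF hG (isLocalVariation_const h) ?_ ?_ ?_ ?_
  · ext t z
    exact hμ.dirDerivF_eq_pairing hF t z hh
  · ext t z
    exact hμ.dirDerivF_eq_pairing hG t z hh
  · rw [hc, sub_zero]
    exact hμ.dirDerivF_eq_pairing hF t z (tsupport_dirDeriv_subset hXG t z hh)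
  · rw [hc, sub_zero]
    exact hμ.dirDerivF_eq_pairing hG t z (tsupport_dirDeriv_subset hXF t z hh)

/-- The modified bracket generates the commutator. -/
theorem IsSmoothDensity.hamVariation_modifiedBracket (hμ : IsSmoothDensity (n := n) μ)
    {σ : Matrix ι ι ℝ} (hσ : σ.transpose = -σ) {F G : Functional n M ι}
    (hF : IsLocalFunctional μ F) (hG : IsLocalFunctional μ G) :
    hamVariation μ σ (modifiedBracket μ σ F G) =
      commutator (hamVariation μ σ G) (hamVariation μ σ F) := by
  ext1 t
  ext1 z
  rw [hamVariation_eq_sharp, hμ.funcDeriv_modifiedBracket hσ hF hG, commutator_eq]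
  simp only [Pi.sub_apply, map_sub]
  rw [hμ.dvaryV_hamVariation σ hF, hμ.dvaryV_hamVariation σ hG]

theorem IsSmoothDensity.hamVariation_add (hμ : IsSmoothDensity (n := n) μ) (σ : Matrix ι ι ℝ)
    {F G : Functional n M ι} (hF : IsLocalFunctional μ F) (hG : IsLocalFunctional μ G) :
    hamVariation μ σ (F + G) = hamVariation μ σ F + hamVariation μ σ G := by
  ext1 t
  ext1 z
  simp only [hamVariation_eq_sharp, hμ.funcDeriv_add hF hG, Pi.add_apply, map_add]

theorem IsSmoothDensity.hamVariation_smul (hμ : IsSmoothDensity (n := n) μ) (σ : Matrix ι ι ℝ)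
    (r : ℝ) {F : Functional n M ι} (hF : IsLocalFunctional μ F) :
    hamVariation μ σ (r • F) = r • hamVariation μ σ F := by
  ext1 t
  ext1 z
  simp only [hamVariation_eq_sharp, hμ.funcDeriv_smul r hF, Pi.smul_apply, map_smul]

end Brackets


/-! ### Generators -/

section Generators

variable {n : ℕ} [NeZero n] {M : Type*} [TopologicalSpace M]
  [ChartedSpace (EuclideanHalfSpace n) M] [IsManifold (𝓡∂ n) ∞ M] {ι κ : Type*} [Fintype ι]
  [DecidableEq ι] [MeasurableSpace M] {μ : Measure M} [BorelSpace M] [T2Space M] [CompactSpace M]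
  {S : System n M ι κ}

/-- The derivation `δ_t = ∂_t + δ_H`, corrected by the boundary variation of `H`. On local
functionals it is `∂_t F + {F, H}_ζ`. -/
def System.rate (S : System n M ι κ) (μ : Measure M) (F : Functional n M ι) : Functional n M ι :=
  dvaryF 1 (S.evolution μ) F - dvaryF 0 (hamVariation μ S.σ F) S.H +
    pairF μ (funcDeriv μ S.H) (hamVariation μ S.σ F)

omit [DecidableEq ι] in
theorem IsSmoothDensity.deriv_add_modifiedBracket (hμ : IsSmoothDensity (n := n) μ)
    {F : Functional n M ι} (hF : IsLocalFunctional μ F) (t : ℝ) (z : Config n M ι) :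
    deriv (fun s : ℝ => F s z) t + modifiedBracket μ S.σ F S.H t z = S.rate μ F t z := by
  have h1 : deriv (fun s : ℝ => F s z) t = dirDerivF F t z 1 0 := by
    have h := deriv_comp_const_add (fun s : ℝ => F s z) t 0
    simp only [add_zero] at h
    simp [dirDerivF, h]
  have h2 := hμ.dirDerivF_add hF t z 1 0 0 (S.evolution μ t z)
  rw [add_zero, zero_add] at h2
  rw [h1, modifiedBracket_eq]
  simp only [System.rate, Pi.add_apply, Pi.sub_apply, dvaryF, h2]
  simp only [System.evolution]
  ring

theorem System.IsRegular.internallyInvariant_iff (hS : S.IsRegular μ)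
    (hμ : IsSmoothDensity (n := n) μ) {F : Functional n M ι} (hF : IsLocalFunctional μ F) :
    S.InternallyInvariant μ F ↔ ∀ t z h, S.FixesSources μ t z h → dirDerivF F t z 0 h = 0 := by
  constructor
  · intro h t z v hv
    obtain ⟨δ, hδ, rfl⟩ := hS.fixed_sources t z v hv
    exact (hμ.hasDerivAt_fixed_time hF t z _).unique (h δ hδ t z)
  · intro h δ hδ t z
    have h1 := hμ.hasDerivAt_fixed_time hF t z (δ t z)
    rwa [h t z _ (((hS.preservesInternal_iff hμ).1 hδ).2 t z)] at h1

theorem System.IsRegular.hasNoBoundaryVariation_iff (hS : S.IsRegular μ)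
    (hμ : IsSmoothDensity (n := n) μ) {F : Functional n M ι} (hF : IsLocalFunctional μ F) :
    S.HasNoBoundaryVariation μ F ↔ ∀ t z h, S.FixesSources μ t z h →
      dirDerivF F t z 0 h = pairing μ (funcDeriv μ F t z) h := by
  constructor
  · intro h t z v hv
    obtain ⟨δ, hδ, rfl⟩ := hS.fixed_sources t z v hv
    exact (hμ.hasDerivAt_fixed_time hF t z _).unique (h δ hδ t z)
  · intro h δ hδ t z
    rw [← h t z _ (((hS.preservesInternal_iff hμ).1 hδ).2 t z)]
    exact hμ.hasDerivAt_fixed_time hF t z _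

/-- Generators, described by directional derivatives and by the rate of change `System.rate`. That
`δ_Q` acts on the sources is automatic once it preserves the external boundary conditions. -/
theorem System.IsRegular.isGenerator_iff (hS : S.IsRegular μ) (hμ : IsSmoothDensity (n := n) μ)
    {Q : Variation n M ι} {G : Functional n M ι} :
    S.IsGenerator μ Q G ↔ IsLocalFunctional μ G ∧
      (∀ t z h, S.FixesSources μ t z h →
        dirDerivF G t z 0 h = pairing μ (funcDeriv μ G t z) h) ∧
      S.PreservesExternal μ Q ∧ Q = hamVariation μ S.σ G ∧
      ∃ V : Current n M ι, IsLocalCurrent V ∧ S.InternallyInvariant μ (boundaryTerm μ V) ∧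
        S.rate μ G = boundaryTerm μ V := by
  constructor
  · rintro ⟨⟨hG, hb, hs⟩, rfl, V, hV, hVi, h⟩
    refine ⟨hG, (hS.hasNoBoundaryVariation_iff hμ hG).1 hb, hs.1, rfl, V, hV, hVi, ?_⟩
    ext t z
    rw [← hμ.deriv_add_modifiedBracket hG, h]
  · rintro ⟨hG, hb, hs, rfl, V, hV, hVi, h⟩
    refine ⟨⟨hG, (hS.hasNoBoundaryVariation_iff hμ hG).2 hb, (hS.actsOnSources_iff hμ
      (hμ.isLocalVariation_hamVariation _ hG)).2 hs⟩, rfl, V, hV, hVi, fun t z => ?_⟩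
    rw [hμ.deriv_add_modifiedBracket hG, h]

theorem IsSmoothDensity.rate_add (hμ : IsSmoothDensity (n := n) μ) (hS : S.IsRegular μ)
    {F G : Functional n M ι} (hF : IsLocalFunctional μ F) (hG : IsLocalFunctional μ G) :
    S.rate μ (F + G) = S.rate μ F + S.rate μ G := by
  ext t z
  have h := hμ.dirDerivF_add hS.local_H t z 0 0 (hamVariation μ S.σ F t z)
    (hamVariation μ S.σ G t z)
  rw [add_zero] at h
  simp only [System.rate, Pi.add_apply, Pi.sub_apply, dvaryF, pairF, hμ.hamVariation_add S.σ hF hG,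
    hμ.dirDerivF_add_fn hF hG, hμ.pairing_add_right, h]
  ring

theorem IsSmoothDensity.rate_smul (hμ : IsSmoothDensity (n := n) μ) (hS : S.IsRegular μ) (r : ℝ)
    {F : Functional n M ι} (hF : IsLocalFunctional μ F) : S.rate μ (r • F) = r • S.rate μ F := by
  ext t z
  have h := hμ.dirDerivF_smul hS.local_H t z r 0 (hamVariation μ S.σ F t z)
  rw [mul_zero] at h
  simp only [System.rate, Pi.add_apply, Pi.sub_apply, Pi.smul_apply, dvaryF, pairF,
    hμ.hamVariation_smul S.σ r hF, hμ.dirDerivF_smul_fn r hF, pairing_smul_right, h, smul_eq_mul]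
  ring

theorem System.IsRegular.isGenerator_add (hS : S.IsRegular μ) (hμ : IsSmoothDensity (n := n) μ)
    {Q R : Variation n M ι} {F G : Functional n M ι} (hF : S.IsGenerator μ Q F)
    (hG : S.IsGenerator μ R G) : S.IsGenerator μ (Q + R) (F + G) := by
  rw [hS.isGenerator_iff hμ] at hF hG ⊢
  obtain ⟨hFl, hFb, hFe, rfl, V, hV, hVi, hFr⟩ := hF
  obtain ⟨hGl, hGb, hGe, rfl, V', hV', hVi', hGr⟩ := hG
  have hb := hμ.isLocalFunctional_boundaryTerm hV
  have hb' := hμ.isLocalFunctional_boundaryTerm hV'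
  refine ⟨hμ.isLocalFunctional_add hFl hGl, fun t z h hh => ?_,
    hS.preservesExternal_add hμ (hμ.isLocalVariation_hamVariation _ hFl)
      (hμ.isLocalVariation_hamVariation _ hGl) hFe hGe, (hμ.hamVariation_add _ hFl hGl).symm,
    V + V', hV.add hV', ?_, ?_⟩
  · rw [hμ.dirDerivF_add_fn hFl hGl, hFb t z h hh, hGb t z h hh, hμ.funcDeriv_add hFl hGl]
    exact (hμ.pairing_add_left _ _ _).symm
  · rw [hS.internallyInvariant_iff hμ hb] at hVi
    rw [hS.internallyInvariant_iff hμ hb'] at hVi'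
    rw [hμ.boundaryTerm_add, hS.internallyInvariant_iff hμ (hμ.isLocalFunctional_add hb hb')]
    intro t z h hh
    rw [hμ.dirDerivF_add_fn hb hb', hVi t z h hh, hVi' t z h hh, add_zero]
  · rw [hμ.rate_add hS hFl hGl, hμ.boundaryTerm_add, hFr, hGr]

theorem System.IsRegular.isGenerator_smul (hS : S.IsRegular μ) (hμ : IsSmoothDensity (n := n) μ)
    (r : ℝ) {Q : Variation n M ι} {F : Functional n M ι} (hF : S.IsGenerator μ Q F) :
    S.IsGenerator μ (r • Q) (r • F) := by
  rw [hS.isGenerator_iff hμ] at hF ⊢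
  obtain ⟨hFl, hFb, hFe, rfl, V, hV, hVi, hFr⟩ := hF
  have hb := hμ.isLocalFunctional_boundaryTerm hV
  refine ⟨hFl.smul r, fun t z h hh => ?_,
    hS.preservesExternal_smul hμ r (hμ.isLocalVariation_hamVariation _ hFl) hFe,
    (hμ.hamVariation_smul _ r hFl).symm, r • V, hV.smul r, ?_, ?_⟩
  · rw [hμ.dirDerivF_smul_fn r hFl, hFb t z h hh, hμ.funcDeriv_smul r hFl]
    exact (pairing_smul_left _ _ _).symm
  · rw [hS.internallyInvariant_iff hμ hb] at hVi
    rw [hμ.boundaryTerm_smul, hS.internallyInvariant_iff hμ (hb.smul r)]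
    intro t z h hh
    rw [hμ.dirDerivF_smul_fn r hb, hVi t z h hh, mul_zero]
  · rw [hμ.rate_smul hS r hFl, hμ.boundaryTerm_smul, hFr]

theorem IsSmoothDensity.funcDeriv_zero (hμ : IsSmoothDensity (n := n) μ) :
    funcDeriv μ (0 : Functional n M ι) = 0 := by
  have h : IsLocalFunctional μ (0 : Functional n M ι) := ⟨0, .zero, fun t z => by simp⟩
  have := hμ.funcDeriv_smul 0 h
  rwa [zero_smul, zero_smul] at this

theorem IsSmoothDensity.boundaryTerm_zero (hμ : IsSmoothDensity (n := n) μ) :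
    boundaryTerm μ (0 : Current n M ι) = 0 := by
  have := hμ.boundaryTerm_smul 0 (0 : Current n M ι)
  rwa [zero_smul, zero_smul] at this

theorem System.IsRegular.isGenerator_zero (hS : S.IsRegular μ) (hμ : IsSmoothDensity (n := n) μ) :
    S.IsGenerator μ 0 0 := by
  have h0 : IsLocalFunctional μ (0 : Functional n M ι) := ⟨0, .zero, fun t z => by simp⟩
  have hX : (0 : Variation n M ι) = hamVariation μ S.σ 0 := by
    have := hμ.hamVariation_smul S.σ 0 h0
    rw [zero_smul, zero_smul] at this
    exact this.symm
  have hd : ∀ t (z : Config n M ι) τ v, dirDerivF 0 t z τ v = 0 := fun t z τ v => by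
    simp [dirDerivF]
  have hi : S.PreservesInternal μ 0 := (hS.preservesInternal_iff hμ).2
    ⟨fun A => .zero, fun t z => hS.fixesSources_zero hμ t z⟩
  rw [hS.isGenerator_iff hμ]
  refine ⟨h0, fun t z h _ => ?_, hi.2.2, hX, 0,
    ⟨0, Fin.elim0, Fin.elim0, fun j => j.elim0, fun t z x => by simp⟩, ?_, ?_⟩
  · rw [hd, hμ.funcDeriv_zero]
    simp [pairing]
  · rw [hμ.boundaryTerm_zero, hS.internallyInvariant_iff hμ h0]
    exact fun t z h _ => hd _ _ _ _
  · have := hμ.rate_smul hS 0 h0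
    rw [zero_smul, zero_smul] at this
    rw [this, hμ.boundaryTerm_zero]

/-- The rate of change of the bracket of two local functionals without boundary variation. -/
theorem System.IsRegular.rate_modifiedBracket (hS : S.IsRegular μ)
    (hμ : IsSmoothDensity (n := n) μ) {F G : Functional n M ι} (hF : IsLocalFunctional μ F)
    (hG : IsLocalFunctional μ G)
    (hFb : ∀ t z h, S.FixesSources μ t z h → dirDerivF F t z 0 h = pairing μ (funcDeriv μ F t z) h)
    (hGb : ∀ t z h, S.FixesSources μ t z h → dirDerivF G t z 0 h = pairing μ (funcDeriv μ G t z) h)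
    (hFe : S.PreservesExternal μ (hamVariation μ S.σ F))
    (hGe : S.PreservesExternal μ (hamVariation μ S.σ G)) :
    S.rate μ (modifiedBracket μ S.σ F G) =
      dvaryF 0 (hamVariation μ S.σ G) (S.rate μ F) -
        dvaryF 0 (hamVariation μ S.σ F) (S.rate μ G) := by
  ext t z
  have hW := hS.isLocalVariation_evolution hμ
  have hσ := hS.skew
  have hH := hS.local_H
  -- the terms of `δ_G (rate F)`, for an arbitrary pair of functionals
  have key : ∀ {F G : Functional n M ι}, IsLocalFunctional μ F → IsLocalFunctional μ G →
      (∀ t z h, S.FixesSources μ t z h →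
        dirDerivF F t z 0 h = pairing μ (funcDeriv μ F t z) h) →
      S.PreservesExternal μ (hamVariation μ S.σ G) →
      dvaryF 0 (hamVariation μ S.σ G) (S.rate μ F) t z =
        dvaryF 1 (S.evolution μ) (dvaryF 0 (hamVariation μ S.σ G) F) t z
        - dvaryF 0 (hamVariation μ S.σ G) (dvaryF 0 (hamVariation μ S.σ F) S.H) t z
        + pairing μ (funcDeriv μ S.H t z)
            (dvaryV 0 (hamVariation μ S.σ G) (hamVariation μ S.σ F) t z)
        + pairing μ (dvaryV 1 (S.evolution μ) (funcDeriv μ G) t z)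
            (hamVariation μ S.σ F t z) := by
    intro F G hF hG hFb hGe
    have hXF := hμ.isLocalVariation_hamVariation S.σ hF
    have hXG := hμ.isLocalVariation_hamVariation S.σ hG
    have hEH := hμ.isLocalVariation_funcDeriv hH
    have h1 : dvaryF 0 (hamVariation μ S.σ G) (S.rate μ F) t z =
        dvaryF 0 (hamVariation μ S.σ G) (dvaryF 1 (S.evolution μ) F) t z -
          dvaryF 0 (hamVariation μ S.σ G) (dvaryF 0 (hamVariation μ S.σ F) S.H) t z +
          dvaryF 0 (hamVariation μ S.σ G)
            (pairF μ (funcDeriv μ S.H) (hamVariation μ S.σ F)) t z := by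
      rw [System.rate, dvaryF, hμ.dirDerivF_add_fn (hμ.isLocalFunctional_sub
        (hμ.isLocalFunctional_dvaryF 1 hW hF) (hμ.isLocalFunctional_dvaryF 0 hXF hH))
        (hμ.isLocalFunctional_pairF hEH hXF), hμ.dirDerivF_sub_fn
        (hμ.isLocalFunctional_dvaryF 1 hW hF) (hμ.isLocalFunctional_dvaryF 0 hXF hH)]
      rfl
    have h2 := hμ.dvaryF_pairF 0 (hamVariation μ S.σ G) hEH hXF t z
    have h3 := hμ.dvaryF_comm 0 1 hXG hW hF t z
    have h4 : dvaryF 0 (dvaryV 0 (hamVariation μ S.σ G) (S.evolution μ) -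
        dvaryV 1 (S.evolution μ) (hamVariation μ S.σ G)) F t z = _ := hFb t z _
      (((hS.preservesInternal_iff hμ).1
        (hS.preservesInternal_commutator_evolution hμ hXG hGe)).2 t z)
    simp only [Pi.sub_apply, hμ.pairing_sub_right] at h4
    have h5 : pairing μ (funcDeriv μ F t z)
        (dvaryV 0 (hamVariation μ S.σ G) (S.evolution μ) t z) =
        -pairing μ (dvaryV 0 (hamVariation μ S.σ G) (funcDeriv μ S.H) t z)
          (hamVariation μ S.σ F t z) := by
      rw [System.evolution, hμ.dvaryV_hamVariation S.σ hH, hμ.pairing_sharp_of_skew hσ]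
      rfl
    have h6 : pairing μ (funcDeriv μ F t z)
        (dvaryV 1 (S.evolution μ) (hamVariation μ S.σ G) t z) =
        -pairing μ (dvaryV 1 (S.evolution μ) (funcDeriv μ G) t z) (hamVariation μ S.σ F t z) := by
      rw [hμ.dvaryV_hamVariation S.σ hG, hμ.pairing_sharp_of_skew hσ]
      rfl
    linarith
  have hXF := hμ.isLocalVariation_hamVariation S.σ hF
  have hXG := hμ.isLocalVariation_hamVariation S.σ hG
  have hEG := hμ.isLocalVariation_funcDeriv hG
  have hGF := hμ.isLocalFunctional_dvaryF 0 hXG hF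
  have hFG := hμ.isLocalFunctional_dvaryF 0 hXF hG
  have h1 := key hF hG hFb hGe
  have h2 := key hG hF hGb hFe
  have h3 : dvaryF 1 (S.evolution μ) (modifiedBracket μ S.σ F G) t z =
      dvaryF 1 (S.evolution μ) (dvaryF 0 (hamVariation μ S.σ G) F) t z -
        dvaryF 1 (S.evolution μ) (dvaryF 0 (hamVariation μ S.σ F) G) t z +
        dvaryF 1 (S.evolution μ) (pairF μ (funcDeriv μ G) (hamVariation μ S.σ F)) t z := by
    rw [modifiedBracket_eq, dvaryF, hμ.dirDerivF_add_fn (hμ.isLocalFunctional_sub hGF hFG)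
      (hμ.isLocalFunctional_pairF hEG hXF), hμ.dirDerivF_sub_fn hGF hFG]
    rfl
  have h4 := hμ.dvaryF_pairF 1 (S.evolution μ) hEG hXF t z
  have h5 := hμ.dvaryF_comm 0 0 hXG hXF hH t z
  have h6 : pairing μ (funcDeriv μ G t z)
      (dvaryV 1 (S.evolution μ) (hamVariation μ S.σ F) t z) =
      -pairing μ (dvaryV 1 (S.evolution μ) (funcDeriv μ F) t z) (hamVariation μ S.σ G t z) := by
    rw [hμ.dvaryV_hamVariation S.σ hF, hμ.pairing_sharp_of_skew hσ]
    rfl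
  rw [System.rate, hμ.hamVariation_modifiedBracket hσ hF hG, commutator_eq]
  simp only [Pi.add_apply, Pi.sub_apply, pairF, hμ.pairing_sub_right]
  linarith

/-- Variations preserving the external boundary conditions map internally invariant functionals to
internally invariant functionals. -/
theorem System.IsRegular.internallyInvariant_dvaryF (hS : S.IsRegular μ)
    (hμ : IsSmoothDensity (n := n) μ) {F : Functional n M ι} (hF : IsLocalFunctional μ F)
    (hFi : S.InternallyInvariant μ F) {Q : Variation n M ι} (hQ : IsLocalVariation Q)
    (hQe : S.PreservesExternal μ Q) : S.InternallyInvariant μ (dvaryF 0 Q F) := by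
  rw [hS.internallyInvariant_iff hμ hF] at hFi
  rw [hS.internallyInvariant_iff hμ (hμ.isLocalFunctional_dvaryF 0 hQ hF)]
  intro t z h hh
  obtain ⟨δ, hδ, rfl⟩ := hS.fixed_sources t z h hh
  have h1 : dvaryF 0 δ F = 0 := by
    ext t z
    exact hFi t z _ (((hS.preservesInternal_iff hμ).1 hδ).2 t z)
  have h2 : dvaryF 0 (dvaryV 0 δ Q - dvaryV 0 Q δ) F t z = 0 := hFi t z _
    (((hS.preservesInternal_iff hμ).1 (hS.preservesInternal_commutator hμ hδ hQ hQe)).2 t z)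
  have h3 := hμ.dvaryF_comm 0 0 hδ.1 hQ hF t z
  have h4 : dvaryF 0 Q (0 : Functional n M ι) t z = 0 := by simp [dvaryF, dirDerivF]
  rw [h1, h2, h4, sub_zero] at h3
  exact h3

/-- The modified bracket of two generators generates the commutator. -/
theorem System.IsRegular.isGenerator_modifiedBracket (hS : S.IsRegular μ)
    (hμ : IsSmoothDensity (n := n) μ) {Q R : Variation n M ι} {F G : Functional n M ι}
    (hF : S.IsGenerator μ Q F) (hG : S.IsGenerator μ R G) :
    S.IsGenerator μ (commutator R Q) (modifiedBracket μ S.σ F G) := by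
  rw [hS.isGenerator_iff hμ] at hF hG ⊢
  obtain ⟨hFl, hFb, hFe, rfl, V, hV, hVi, hFr⟩ := hF
  obtain ⟨hGl, hGb, hGe, rfl, V', hV', hVi', hGr⟩ := hG
  have hXF := hμ.isLocalVariation_hamVariation S.σ hFl
  have hXG := hμ.isLocalVariation_hamVariation S.σ hGl
  have hb := hμ.isLocalFunctional_boundaryTerm hV
  have hb' := hμ.isLocalFunctional_boundaryTerm hV'
  have hBl := hμ.isLocalFunctional_modifiedBracket S.σ hFl hGl
  have hr := hS.rate_modifiedBracket hμ hFl hGl hFb hGb hFe hGe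
  rw [hFr, hGr] at hr
  obtain ⟨K, hK, hKV⟩ := hμ.exists_dvaryF_boundaryTerm hV hXG
  obtain ⟨K', hK', hKV'⟩ := hμ.exists_dvaryF_boundaryTerm hV' hXF
  have hKb := hμ.isLocalFunctional_boundaryTerm hK
  have hKb' := hμ.isLocalFunctional_boundaryTerm hK'
  have hKK : boundaryTerm μ (K + (-1 : ℝ) • K') = boundaryTerm μ K - boundaryTerm μ K' := by
    rw [hμ.boundaryTerm_add, hμ.boundaryTerm_smul, neg_one_smul, sub_eq_add_neg]
  refine ⟨hBl, fun t z h hh => ?_, hS.preservesExternal_commutator hμ hXG hXF hGe hFe,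
    (hμ.hamVariation_modifiedBracket hS.skew hFl hGl).symm, K + (-1 : ℝ) • K',
    hK.add (hK'.smul _), ?_, ?_⟩
  · obtain ⟨δ, hδ, rfl⟩ := hS.fixed_sources t z h hh
    have hδ' := ((hS.preservesInternal_iff hμ).1 hδ).2
    rw [hμ.funcDeriv_modifiedBracket hS.skew hFl hGl]
    refine hμ.dvaryF_modifiedBracket hS.skew hFl hGl hδ.1 ?_ ?_ ?_ ?_
    · ext t z
      exact hFb t z _ (hδ' t z)
    · ext t z
      exact hGb t z _ (hδ' t z)
    · exact hFb t z _ (((hS.preservesInternal_iff hμ).1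
        (hS.preservesInternal_commutator hμ hδ hXG hGe)).2 t z)
    · exact hGb t z _ (((hS.preservesInternal_iff hμ).1
        (hS.preservesInternal_commutator hμ hδ hXF hFe)).2 t z)
  · have h1 := hS.internallyInvariant_dvaryF hμ hb hVi hXG hGe
    have h2 := hS.internallyInvariant_dvaryF hμ hb' hVi' hXF hFe
    rw [hKV, hS.internallyInvariant_iff hμ hKb] at h1
    rw [hKV', hS.internallyInvariant_iff hμ hKb'] at h2
    rw [hKK, hS.internallyInvariant_iff hμ (hμ.isLocalFunctional_sub hKb hKb')]
    intro t z h hh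
    rw [hμ.dirDerivF_sub_fn hKb hKb', h1 t z h hh, h2 t z h hh, sub_zero]
  · rw [hr, hKK, hKV, hKV']

end Generators


/-! ### Symmetries of the action -/

section Symmetries

variable {n : ℕ} [NeZero n] {M : Type*} [TopologicalSpace M]
  [ChartedSpace (EuclideanHalfSpace n) M] [IsManifold (𝓡∂ n) ∞ M] {ι κ : Type*} [Fintype ι]
  [DecidableEq ι] [MeasurableSpace M] {μ : Measure M} [BorelSpace M] [T2Space M] [CompactSpace M]
  {S : System n M ι κ}

theorem System.IsRegular.transpose_inv (hS : S.IsRegular μ) : (S.σ⁻¹).transpose = -S.σ⁻¹ := by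
  rw [Matrix.transpose_nonsing_inv, hS.skew]
  refine Matrix.inv_eq_left_inv ?_
  rw [neg_mul_neg, Matrix.nonsing_inv_mul _ hS.invertible]

theorem System.IsRegular.sharp_inv_sharp (hS : S.IsRegular μ) (E : Config n M ι) :
    sharp S.σ⁻¹ (sharp S.σ E) = E := by
  rw [sharp_sharp, Matrix.nonsing_inv_mul _ hS.invertible, sharp_one]

theorem System.IsRegular.sharp_sharp_inv (hS : S.IsRegular μ) (E : Config n M ι) :
    sharp S.σ (sharp S.σ⁻¹ E) = E := by
  rw [sharp_sharp, Matrix.mul_nonsing_inv _ hS.invertible, sharp_one]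

theorem IsSmoothDensity.lagrangian_eq (hμ : IsSmoothDensity (n := n) μ) (S : System n M ι κ) (t : ℝ)
    (z v : Config n M ι) :
    S.lagrangian μ t z v = 1 / 2 * pairing μ z (sharp S.σ⁻¹ v) - S.H t z := by
  rw [System.lagrangian, pairing, Finset.mul_sum]
  congr 1
  refine Finset.sum_congr rfl fun A _ => ?_
  rw [← integral_const_mul, ← integral_finsetSum]
  · refine integral_congr_ae (Filter.Eventually.of_forall fun x => ?_)
    simp only [sharp_apply, smoothFn_sum_apply, smoothFn_smul_apply, Finset.mul_sum]
    exact Finset.sum_congr rfl fun B _ => by ring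
  · intro B _
    have := (hμ.integrable_mul (z A) (v B)).const_mul (1 / 2 * S.σ⁻¹ A B)
    refine this.congr (Filter.Eventually.of_forall fun x => ?_)
    simp only
    ring

/-- The functional `∫ z^A σ_{AB} Q^B dⁿx`. -/
def System.symplecticPotential (S : System n M ι κ) (μ : Measure M) (Q : Variation n M ι) :
    Functional n M ι :=
  pairF μ (fun _ z => z) fun t z => sharp S.σ⁻¹ (Q t z)

theorem IsSmoothDensity.isLocalFunctional_symplecticPotential (hμ : IsSmoothDensity (n := n) μ)
    {Q : Variation n M ι} (hQ : IsLocalVariation Q) :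
    IsLocalFunctional μ (S.symplecticPotential μ Q) :=
  hμ.isLocalFunctional_pairF (fun A => .field A) (isLocalVariation_sharp _ hQ)

/-- The variation of the integrand of the action. -/
theorem System.IsRegular.hasDerivAt_lagrangian (hS : S.IsRegular μ)
    (hμ : IsSmoothDensity (n := n) μ) {Q : Variation n M ι} (hQ : IsLocalVariation Q) (t : ℝ)
    (z v : Config n M ι) :
    HasDerivAt
      (fun s : ℝ => S.lagrangian μ t (z + s • Q t z)
        (v + s • fun A => totalDeriv (fun t z => Q t z A) t z v))
      (1 / 2 * dirDerivF (S.symplecticPotential μ Q) t z 1 v -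
        pairing μ v (sharp S.σ⁻¹ (Q t z)) - dirDerivF S.H t z 0 (Q t z)) 0 := by
  have h1 : dirDerivF (S.symplecticPotential μ Q) t z 1 v =
      pairing μ v (sharp S.σ⁻¹ (Q t z)) +
        pairing μ z (sharp S.σ⁻¹ fun A => totalDeriv (fun t z => Q t z A) t z v) := by
    rw [System.symplecticPotential, hμ.dirDerivF_pairF (fun A => .field A)
      (isLocalVariation_sharp _ hQ), dirDeriv_sharp _ hQ]
    simp only [dirDeriv_field]
    rfl
  generalize (fun A => totalDeriv (fun t z => Q t z A) t z v) = dQ at h1 ⊢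
  have h2 : pairing μ (Q t z) (sharp S.σ⁻¹ v) = -pairing μ v (sharp S.σ⁻¹ (Q t z)) :=
    hμ.pairing_sharp_of_skew hS.transpose_inv _ _
  have h3 : ∀ s : ℝ, S.lagrangian μ t (z + s • Q t z) (v + s • dQ) =
      1 / 2 * (pairing μ z (sharp S.σ⁻¹ v) + s * (pairing μ (Q t z) (sharp S.σ⁻¹ v) +
        pairing μ z (sharp S.σ⁻¹ dQ)) + s ^ 2 * pairing μ (Q t z) (sharp S.σ⁻¹ dQ)) -
        S.H t (z + s • Q t z) := fun s => by
    rw [hμ.lagrangian_eq, map_add, map_smul, hμ.pairing_add_left, hμ.pairing_add_right,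
      hμ.pairing_add_right, pairing_smul_right, pairing_smul_right, pairing_smul_left,
      pairing_smul_left]
    ring
  simp only [h3]
  have h4 := (((((hasDerivAt_id (0 : ℝ)).mul_const (pairing μ (Q t z) (sharp S.σ⁻¹ v) +
    pairing μ z (sharp S.σ⁻¹ dQ))).const_add (pairing μ z (sharp S.σ⁻¹ v))).add
    (((hasDerivAt_id (0 : ℝ)).pow 2).mul_const (pairing μ (Q t z) (sharp S.σ⁻¹ dQ)))).const_mul
    (1 / 2)).sub (hμ.hasDerivAt_fixed_time hS.local_H t z (Q t z))
  refine h4.congr_deriv ?_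
  rw [h1, h2]
  simp only [id_eq]
  ring

/-- The rate of change of `G`, in terms of the variation of `G` along the evolution. -/
theorem System.IsRegular.rate_eq (hS : S.IsRegular μ) (hμ : IsSmoothDensity (n := n) μ)
    {G : Functional n M ι} (t : ℝ) (z : Config n M ι) :
    S.rate μ G t z = dirDerivF G t z 1 (S.evolution μ t z) -
      pairing μ (S.evolution μ t z) (funcDeriv μ G t z) -
        dirDerivF S.H t z 0 (hamVariation μ S.σ G t z) := by
  have h : pairing μ (funcDeriv μ G t z) (S.evolution μ t z) =
      -pairing μ (funcDeriv μ S.H t z) (hamVariation μ S.σ G t z) :=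
    hμ.pairing_sharp_of_skew hS.skew _ _
  rw [pairing_comm, h]
  simp only [System.rate, Pi.add_apply, Pi.sub_apply, dvaryF, pairF]
  ring

/-- Noether's theorem: a variation is an external symmetry if and only if it has a generator. The
generator and the density `U` determine each other by `G = ½ ∫ z^A σ_{AB} Q^B dⁿx - ∫ U dⁿx`. The
compatible velocities are `δ_H z + h` with `h` at fixed sources: the part of the invariance condition
linear in `h` says that `G` has functional derivative `σ_{AB} Q^B` and no boundary variation, and the
condition at `h = 0` is the equation for its rate of change. -/
theorem System.IsRegular.isExternalSymmetry_iff (hS : S.IsRegular μ)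
    (hμ : IsSmoothDensity (n := n) μ) {Q : Variation n M ι} :
    S.IsExternalSymmetry μ Q ↔ ∃ G, S.IsGenerator μ Q G := by
  constructor
  · rintro ⟨hQ, hQa, U, V, hU, hV, hVi, h⟩
    have hPl := hμ.isLocalFunctional_symplecticPotential (S := S) hQ
    let UF : Functional n M ι := fun t z => ∫ x, U t z x ∂μ
    have hUl : IsLocalFunctional μ UF := ⟨U, hU, fun _ _ => rfl⟩
    have hPl' := hPl.smul (1 / 2)
    have hGl := hμ.isLocalFunctional_sub hPl' hUl
    -- the equality of the integrands, written in terms of the would-be generator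
    have h1 : ∀ t z v, S.ExternalBC μ t z v →
        dirDerivF ((1 / 2 : ℝ) • S.symplecticPotential μ Q - UF) t z 1 v -
          pairing μ v (sharp S.σ⁻¹ (Q t z)) - dirDerivF S.H t z 0 (Q t z) =
          boundaryTerm μ V t z := by
      intro t z v hv
      have h2 := (h t z v hv).unique (hS.hasDerivAt_lagrangian hμ hQ t z v)
      have h3 : deriv (fun s : ℝ => ∫ x, U (t + s) (z + s • v) x ∂μ) 0 = dirDerivF UF t z 1 v := by
        simp [dirDerivF, UF]
      rw [h3] at h2
      rw [hμ.dirDerivF_sub_fn hPl' hUl, hμ.dirDerivF_smul_fn _ hPl]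
      linarith
    generalize (1 / 2 : ℝ) • S.symplecticPotential μ Q - UF = G at h1 hGl
    have h2 : ∀ t z v, S.FixesSources μ t z v →
        dirDerivF G t z 0 v = pairing μ (sharp S.σ⁻¹ (Q t z)) v := by
      intro t z v hv
      have h3 := h1 t z _ (hS.externalBC_add hμ hv)
      have h4 := h1 t z _ (hS.externalBC_evolution hμ t z)
      have h5 := hμ.dirDerivF_add hGl t z 1 0 (S.evolution μ t z) v
      rw [add_zero] at h5
      rw [h5, hμ.pairing_add_left] at h3
      rw [pairing_comm]
      linarith
    have hE : funcDeriv μ G = fun t z => sharp S.σ⁻¹ (Q t z) :=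
      hμ.funcDeriv_eq_of_dirDerivF hGl (isLocalVariation_sharp _ hQ) fun t z v hv =>
        h2 t z v (hS.fixesSources_of_tsupport hμ t z hv)
    have hX : hamVariation μ S.σ G = Q := by
      ext1 t
      ext1 z
      rw [hamVariation_eq_sharp, hE]
      exact hS.sharp_sharp_inv _
    refine ⟨G, (hS.isGenerator_iff hμ).2 ⟨hGl, fun t z v hv => ?_, hQa.1, hX.symm, V, hV, hVi, ?_⟩⟩
    · rw [hE, h2 t z v hv]
    · ext t z
      rw [hS.rate_eq hμ, hX, hE, h1 t z _ (hS.externalBC_evolution hμ t z)]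
  · rintro ⟨G, hG⟩
    rw [hS.isGenerator_iff hμ] at hG
    obtain ⟨hGl, hGb, hQe, hX, V, hV, hVi, hr⟩ := hG
    have hQ : IsLocalVariation Q := hX ▸ hμ.isLocalVariation_hamVariation _ hGl
    have hPl := hμ.isLocalFunctional_symplecticPotential (S := S) hQ
    have hPl' := hPl.smul (1 / 2)
    obtain ⟨U, hU, hUF⟩ := hμ.isLocalFunctional_sub hPl' hGl
    refine ⟨hQ, (hS.actsOnSources_iff hμ hQ).2 hQe, U, V, hU, hV, hVi, fun t z v hv => ?_⟩
    have h1 := hS.hasDerivAt_lagrangian hμ hQ t z v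
    have h2 : deriv (fun s : ℝ => ∫ x, U (t + s) (z + s • v) x ∂μ) 0 =
        1 / 2 * dirDerivF (S.symplecticPotential μ Q) t z 1 v - dirDerivF G t z 1 v := by
      rw [← hμ.dirDerivF_smul_fn _ hPl, ← hμ.dirDerivF_sub_fn hPl' hGl]
      simp only [← hUF, dirDerivF, mul_one]
    have h3 := hS.rate_eq hμ (G := G) t z
    have h4 := hGb t z _ ((hS.externalBC_iff hμ t z v).1 hv)
    have h5 := hμ.dirDerivF_add hGl t z 1 0 (S.evolution μ t z) (v - S.evolution μ t z)
    have hE : sharp S.σ⁻¹ (Q t z) = funcDeriv μ G t z := by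
      rw [hX]
      exact hS.sharp_inv_sharp _
    rw [add_zero, add_sub_cancel, h4, pairing_comm, hμ.pairing_sub_left] at h5
    rw [← hX] at h3
    refine h1.congr_deriv ?_
    rw [h2, ← hr, h3, h5, hE]
    ring

theorem System.IsRegular.isExternalSymmetry_commutator (hS : S.IsRegular μ)
    (hμ : IsSmoothDensity (n := n) μ) {Q R : Variation n M ι} (hQ : S.IsExternalSymmetry μ Q)
    (hR : S.IsExternalSymmetry μ R) : S.IsExternalSymmetry μ (commutator Q R) := by
  rw [hS.isExternalSymmetry_iff hμ] at hQ hR ⊢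
  obtain ⟨F, hF⟩ := hQ
  obtain ⟨G, hG⟩ := hR
  exact ⟨_, hS.isGenerator_modifiedBracket hμ hG hF⟩

end Symmetries


/-! ### The Lie algebra of external symmetries and its extension -/

section LieAlgebra

variable {n : ℕ} [NeZero n] {M : Type*} [TopologicalSpace M]
  [ChartedSpace (EuclideanHalfSpace n) M] [IsManifold (𝓡∂ n) ∞ M] {ι κ : Type*}

theorem dvaryV_add_right (τ : ℝ) (Q : Variation n M ι) {R R' : Variation n M ι}
    (hR : IsLocalVariation R) (hR' : IsLocalVariation R') :
    dvaryV τ Q (R + R') = dvaryV τ Q R + dvaryV τ Q R' := by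
  ext1 t
  ext1 z
  ext1 A
  exact dirDeriv_add_fn (hR A) (hR' A) t z τ (Q t z)

theorem dvaryV_smul_right (τ r : ℝ) (Q : Variation n M ι) {R : Variation n M ι}
    (hR : IsLocalVariation R) : dvaryV τ Q (r • R) = r • dvaryV τ Q R := by
  ext1 t
  ext1 z
  ext1 A
  exact dirDeriv_smul_fn r (hR A) t z τ (Q t z)

theorem dvaryV_add_left (Q Q' : Variation n M ι) {R : Variation n M ι}
    (hR : IsLocalVariation R) :
    dvaryV 0 (Q + Q') R = dvaryV 0 Q R + dvaryV 0 Q' R := by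
  ext1 t
  ext1 z
  ext1 A
  have h := (hR A).dirDeriv_add t z 0 0 (Q t z) (Q' t z)
  rw [add_zero] at h
  exact h

theorem dvaryV_smul_left (r : ℝ) (Q : Variation n M ι) {R : Variation n M ι}
    (hR : IsLocalVariation R) : dvaryV 0 (r • Q) R = r • dvaryV 0 Q R := by
  ext1 t
  ext1 z
  ext1 A
  have h := (hR A).dirDeriv_smul t z r 0 (Q t z)
  rw [mul_zero] at h
  exact h

theorem commutator_add_right {Q R R' : Variation n M ι} (hQ : IsLocalVariation Q)
    (hR : IsLocalVariation R) (hR' : IsLocalVariation R') :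
    commutator Q (R + R') = commutator Q R + commutator Q R' := by
  rw [commutator_eq, commutator_eq, commutator_eq, dvaryV_add_right 0 Q hR hR',
    dvaryV_add_left _ _ hQ]
  abel

theorem commutator_smul_right (r : ℝ) {Q R : Variation n M ι} (hQ : IsLocalVariation Q)
    (hR : IsLocalVariation R) : commutator Q (r • R) = r • commutator Q R := by
  rw [commutator_eq, commutator_eq, dvaryV_smul_right 0 r Q hR, dvaryV_smul_left _ _ hQ, smul_sub]

theorem commutator_swap (Q R : Variation n M ι) : commutator Q R = -commutator R Q := by
  rw [commutator_eq, commutator_eq, neg_sub]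

theorem commutator_jacobi {Q₁ Q₂ Q₃ : Variation n M ι}
    (h₁ : IsLocalVariation Q₁) (h₂ : IsLocalVariation Q₂) (h₃ : IsLocalVariation Q₃) :
    commutator Q₁ (commutator Q₂ Q₃) +
      commutator Q₂ (commutator Q₃ Q₁) +
      commutator Q₃ (commutator Q₁ Q₂) = 0 := by
  have key : ∀ {Q R T : Variation n M ι}, IsLocalVariation Q → IsLocalVariation R →
      IsLocalVariation T → commutator Q (commutator R T) =
        dvaryV 0 Q (dvaryV 0 R T) -
        dvaryV 0 Q (dvaryV 0 T R) -
        (dvaryV 0 R (dvaryV 0 T Q) -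
          dvaryV 0 T (dvaryV 0 R Q)) := by
    intro Q R T hQ hR hT
    ext1 t
    ext1 z
    ext1 A
    have h1 := dirDeriv_sub_fn (hR.dvaryV 0 hT A) (hT.dvaryV 0 hR A) t z 0 (Q t z)
    have h2 := (hQ A).dvary_comm 0 0 hR hT t z
    exact congrArg₂ (· - ·) h1 h2.symm
  rw [key h₁ h₂ h₃, key h₂ h₃ h₁, key h₃ h₁ h₂]
  abel

variable [Fintype ι] [MeasurableSpace M] {μ : Measure M} [BorelSpace M] [T2Space M] [CompactSpace M]

theorem IsSmoothDensity.modifiedBracket_swap (hμ : IsSmoothDensity (n := n) μ)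
    {σ : Matrix ι ι ℝ} (hσ : σ.transpose = -σ) (F G : Functional n M ι) :
    modifiedBracket μ σ F G = -modifiedBracket μ σ G F := by
  ext t z
  have h : poissonBracket μ σ F G t z = -poissonBracket μ σ G F t z :=
    hμ.pairing_sharp_of_skew hσ _ _
  simp only [modifiedBracket, Pi.neg_apply, h]
  ring

/-- The cyclic identity of the modified bracket, which replaces the Jacobi identity. Each summand is
`δ_3 {F₂, F₁}_ζ + {K, F₁}_ζ - δ_1 K`, for a `K` generating `[δ_2, δ_3]`, but `K` itself does
not occur. No boundary conditions are involved. -/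
theorem IsSmoothDensity.modifiedBracket_cyclic (hμ : IsSmoothDensity (n := n) μ)
    {σ : Matrix ι ι ℝ} (hσ : σ.transpose = -σ) {F₁ F₂ F₃ : Functional n M ι}
    (h₁ : IsLocalFunctional μ F₁) (h₂ : IsLocalFunctional μ F₂) (h₃ : IsLocalFunctional μ F₃)
    {Q₁ Q₂ Q₃ : Variation n M ι} (hQ₁ : Q₁ = hamVariation μ σ F₁) (hQ₂ : Q₂ = hamVariation μ σ F₂)
    (hQ₃ : Q₃ = hamVariation μ σ F₃) (t : ℝ) (z : Config n M ι) :
    (dvaryF 0 Q₃ (modifiedBracket μ σ F₂ F₁) t z - dvaryF 0 (commutator Q₂ Q₃) F₁ t z +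
        pairing μ (funcDeriv μ F₁ t z) (commutator Q₂ Q₃ t z)) +
      (dvaryF 0 Q₁ (modifiedBracket μ σ F₃ F₂) t z - dvaryF 0 (commutator Q₃ Q₁) F₂ t z +
        pairing μ (funcDeriv μ F₂ t z) (commutator Q₃ Q₁ t z)) +
      (dvaryF 0 Q₂ (modifiedBracket μ σ F₁ F₃) t z - dvaryF 0 (commutator Q₁ Q₂) F₃ t z +
        pairing μ (funcDeriv μ F₃ t z) (commutator Q₁ Q₂ t z)) = 0 := by
  have key : ∀ {F₁ F₂ F₃ : Functional n M ι} {Q₁ Q₂ Q₃ : Variation n M ι},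
      IsLocalFunctional μ F₁ → IsLocalFunctional μ F₂ → IsLocalFunctional μ F₃ →
      Q₁ = hamVariation μ σ F₁ → Q₂ = hamVariation μ σ F₂ → Q₃ = hamVariation μ σ F₃ →
      dvaryF 0 Q₃ (modifiedBracket μ σ F₂ F₁) t z - dvaryF 0 (commutator Q₂ Q₃) F₁ t z +
        pairing μ (funcDeriv μ F₁ t z) (commutator Q₂ Q₃ t z) =
      dvaryF 0 Q₃ (dvaryF 0 Q₁ F₂) t z - dvaryF 0 Q₃ (dvaryF 0 Q₂ F₁) t z -
        (dvaryF 0 Q₂ (dvaryF 0 Q₃ F₁) t z - dvaryF 0 Q₃ (dvaryF 0 Q₂ F₁) t z) +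
        pairing μ (dvaryV 0 Q₃ (funcDeriv μ F₁) t z) (Q₂ t z) -
        pairing μ (dvaryV 0 Q₂ (funcDeriv μ F₃) t z) (Q₁ t z) := by
    intro F₁ F₂ F₃ Q₁ Q₂ Q₃ h₁ h₂ h₃ e₁ e₂ e₃
    have l₁ : IsLocalVariation Q₁ := e₁ ▸ hμ.isLocalVariation_hamVariation σ h₁
    have l₂ : IsLocalVariation Q₂ := e₂ ▸ hμ.isLocalVariation_hamVariation σ h₂
    have l₃ : IsLocalVariation Q₃ := e₃ ▸ hμ.isLocalVariation_hamVariation σ h₃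
    have hE := hμ.isLocalVariation_funcDeriv h₁
    have h12 := hμ.isLocalFunctional_dvaryF 0 l₁ h₂
    have h21 := hμ.isLocalFunctional_dvaryF 0 l₂ h₁
    have a1 : dvaryF 0 Q₃ (modifiedBracket μ σ F₂ F₁) t z =
        dvaryF 0 Q₃ (dvaryF 0 Q₁ F₂) t z - dvaryF 0 Q₃ (dvaryF 0 Q₂ F₁) t z +
          dvaryF 0 Q₃ (pairF μ (funcDeriv μ F₁) Q₂) t z := by
      rw [modifiedBracket_eq, ← e₁, ← e₂, dvaryF, hμ.dirDerivF_add_fn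
        (hμ.isLocalFunctional_sub h12 h21) (hμ.isLocalFunctional_pairF hE l₂),
        hμ.dirDerivF_sub_fn h12 h21]
      rfl
    have a2 := hμ.dvaryF_pairF 0 Q₃ hE l₂ t z
    have a3 := hμ.dvaryF_comm 0 0 l₂ l₃ h₁ t z
    have a4 : pairing μ (funcDeriv μ F₁ t z) (dvaryV 0 Q₂ Q₃ t z) =
        -pairing μ (dvaryV 0 Q₂ (funcDeriv μ F₃) t z) (Q₁ t z) := by
      rw [e₃, hμ.dvaryV_hamVariation σ h₃, hμ.pairing_sharp_of_skew hσ, e₁]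
      rfl
    rw [commutator_eq]
    simp only [Pi.sub_apply, hμ.pairing_sub_right]
    linarith
  rw [key h₁ h₂ h₃ hQ₁ hQ₂ hQ₃, key h₂ h₃ h₁ hQ₂ hQ₃ hQ₁, key h₃ h₁ h₂ hQ₃ hQ₁ hQ₂]
  ring

variable [DecidableEq ι] {S : System n M ι κ}

/-- The real vector space of external symmetries. -/
def System.externalSymmetries (hS : S.IsRegular μ) (hμ : IsSmoothDensity (n := n) μ) :
    Submodule ℝ (Variation n M ι) where
  carrier := {Q | S.IsExternalSymmetry μ Q}
  add_mem' {Q R} hQ hR := by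
    obtain ⟨F, hF⟩ := (hS.isExternalSymmetry_iff hμ).1 hQ
    obtain ⟨G, hG⟩ := (hS.isExternalSymmetry_iff hμ).1 hR
    exact (hS.isExternalSymmetry_iff hμ).2 ⟨_, hS.isGenerator_add hμ hF hG⟩
  zero_mem' := (hS.isExternalSymmetry_iff hμ).2 ⟨_, hS.isGenerator_zero hμ⟩
  smul_mem' r Q hQ := by
    obtain ⟨F, hF⟩ := (hS.isExternalSymmetry_iff hμ).1 hQ
    exact (hS.isExternalSymmetry_iff hμ).2 ⟨_, hS.isGenerator_smul hμ r hF⟩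

/-- The commutator of external symmetries. -/
def System.bracket (hS : S.IsRegular μ) (hμ : IsSmoothDensity (n := n) μ) :
    S.externalSymmetries hS hμ →ₗ[ℝ] S.externalSymmetries hS hμ →ₗ[ℝ]
      S.externalSymmetries hS hμ :=
  LinearMap.mk₂ ℝ
    (fun Q R => ⟨commutator Q.1 R.1, hS.isExternalSymmetry_commutator hμ Q.2 R.2⟩)
    (fun Q Q' R => Subtype.ext <| by
      change commutator (Q.1 + Q'.1) R.1 = commutator Q.1 R.1 + commutator Q'.1 R.1
      rw [commutator_swap, commutator_add_right R.2.1 Q.2.1 Q'.2.1, commutator_swap R.1 Q.1,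
        commutator_swap R.1 Q'.1, neg_add, neg_neg, neg_neg])
    (fun r Q R => Subtype.ext <| by
      change commutator (r • Q.1) R.1 = r • commutator Q.1 R.1
      rw [commutator_swap, commutator_smul_right r R.2.1 Q.2.1, commutator_swap R.1 Q.1, smul_neg,
        neg_neg])
    (fun Q R R' => Subtype.ext (commutator_add_right Q.2.1 R.2.1 R'.2.1))
    (fun r Q R => Subtype.ext (commutator_smul_right r Q.2.1 R.2.1))

/-- Generators may be prescribed freely on a basis, since they form a linear relation. -/
theorem System.IsRegular.exists_linear_generator (hS : S.IsRegular μ)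
    (hμ : IsSmoothDensity (n := n) μ) :
    ∃ G : S.externalSymmetries hS hμ →ₗ[ℝ] Functional n M ι,
      ∀ Q : S.externalSymmetries hS hμ, S.IsGenerator μ Q (G Q) := by
  let b := Module.Basis.ofVectorSpace ℝ (S.externalSymmetries hS hμ)
  choose g hg using fun i => (hS.isExternalSymmetry_iff hμ).1 (b i).2
  refine ⟨b.constr ℝ g, fun Q => ?_⟩
  refine Submodule.span_induction
    (p := fun (Q : S.externalSymmetries hS hμ) _ => S.IsGenerator μ Q (b.constr ℝ g Q))
    ?_ ?_ ?_ ?_ (b.mem_span Q)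
  · rintro _ ⟨i, rfl⟩
    rw [b.constr_basis]
    exact hg i
  · rw [map_zero]
    exact hS.isGenerator_zero hμ
  · intro Q R _ _ hQ hR
    rw [map_add]
    exact hS.isGenerator_add hμ hQ hR
  · intro r Q _ hQ
    rw [map_smul]
    exact hS.isGenerator_smul hμ r hQ

/-- Generators of the same symmetry have the same functional derivative. -/
theorem System.IsRegular.funcDeriv_eq_of_hamVariation_eq (hS : S.IsRegular μ)
    {F G : Functional n M ι} (h : hamVariation μ S.σ F = hamVariation μ S.σ G) :
    funcDeriv μ F = funcDeriv μ G := by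
  ext1 t
  ext1 z
  rw [← hS.sharp_inv_sharp (funcDeriv μ F t z), ← hS.sharp_inv_sharp (funcDeriv μ G t z)]
  exact congrArg _ (congrFun (congrFun h t) z)

/-- Two generators of the same symmetry differ by the flux of a local current, which is
invariant under the variations preserving the internal boundary conditions. -/
theorem System.IsRegular.exists_boundaryTerm_of_isGenerator (hS : S.IsRegular μ)
    (hμ : IsSmoothDensity (n := n) μ) (hM : ((𝓡∂ n).boundary M).Nonempty) {Q : Variation n M ι}
    {F G : Functional n M ι} (hF : S.IsGenerator μ Q F) (hG : S.IsGenerator μ Q G) :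
    ∃ K : Current n M ι, IsLocalCurrent K ∧ F - G = boundaryTerm μ K ∧
      S.InternallyInvariant μ (F - G) := by
  rw [hS.isGenerator_iff hμ] at hF hG
  obtain ⟨hFl, hFb, -, hFX, -⟩ := hF
  obtain ⟨hGl, hGb, -, hGX, -⟩ := hG
  have hE := hS.funcDeriv_eq_of_hamVariation_eq (hFX.symm.trans hGX)
  have hl := hμ.isLocalFunctional_sub hFl hGl
  obtain ⟨K, hK, h⟩ := hμ.exists_boundaryTerm_of_funcDeriv_eq_zero hM hl
    (by rw [hμ.funcDeriv_sub hFl hGl, hE, sub_self])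
  refine ⟨K, hK, h, (hS.internallyInvariant_iff hμ hl).2 fun t z v hv => ?_⟩
  rw [hμ.dirDerivF_sub_fn hFl hGl, hFb t z v hv, hGb t z v hv, hE, sub_self]

/-- The boundary terms `{G₂, G₁}_ζ - G_[1,2]` form a cocycle: the brackets of the generators
satisfy `modifiedBracket_cyclic`, the terms `δ_1 G_[2,3]` cancel in the cyclic sum, and the terms
`G_[1,[2,3]]` cancel by the Jacobi identity. -/
theorem System.IsRegular.cocycle (hS : S.IsRegular μ) (hμ : IsSmoothDensity (n := n) μ)
    {G : S.externalSymmetries hS hμ →ₗ[ℝ] Functional n M ι}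
    (hG : ∀ Q : S.externalSymmetries hS hμ, S.IsGenerator μ Q (G Q))
    {N : S.externalSymmetries hS hμ → S.externalSymmetries hS hμ → Functional n M ι}
    (hN : ∀ Q R, N Q R = modifiedBracket μ S.σ (G R) (G Q) - G (S.bracket hS hμ Q R))
    (Q₁ Q₂ Q₃ : S.externalSymmetries hS hμ) :
    (N Q₁ (S.bracket hS hμ Q₂ Q₃) + varyFunctional Q₃ (N Q₁ Q₂)) +
      (N Q₂ (S.bracket hS hμ Q₃ Q₁) + varyFunctional Q₁ (N Q₂ Q₃)) +
      (N Q₃ (S.bracket hS hμ Q₁ Q₂) + varyFunctional Q₂ (N Q₃ Q₁)) = 0 := by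
  have hGl := fun Q => (hG Q).1.1
  have hX := fun Q => (hG Q).2.1
  have hj : S.bracket hS hμ Q₁ (S.bracket hS hμ Q₂ Q₃) +
      S.bracket hS hμ Q₂ (S.bracket hS hμ Q₃ Q₁) +
      S.bracket hS hμ Q₃ (S.bracket hS hμ Q₁ Q₂) = 0 :=
    Subtype.ext (commutator_jacobi Q₁.2.1 Q₂.2.1 Q₃.2.1)
  have hGj := congrArg G hj
  rw [map_add, map_add, map_zero] at hGj
  ext t z
  have hGj' := congrFun (congrFun hGj t) z
  have key : ∀ Q R T : S.externalSymmetries hS hμ,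
      N Q (S.bracket hS hμ R T) t z + varyFunctional T (N Q R) t z =
        (dvaryF 0 T.1 (modifiedBracket μ S.σ (G R) (G Q)) t z -
          dvaryF 0 (commutator R.1 T.1) (G Q) t z +
          pairing μ (funcDeriv μ (G Q) t z) (commutator R.1 T.1 t z)) +
        dvaryF 0 Q.1 (G (S.bracket hS hμ R T)) t z - dvaryF 0 T.1 (G (S.bracket hS hμ Q R)) t z -
        G (S.bracket hS hμ Q (S.bracket hS hμ R T)) t z := by
    intro Q R T
    have hB := hμ.isLocalFunctional_modifiedBracket S.σ (hGl R) (hGl Q)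
    rw [varyFunctional_eq_dvaryF, hN, hN, modifiedBracket_eq S.σ (G (S.bracket hS hμ R T)) (G Q),
      ← hX, ← hX]
    simp only [Pi.add_apply, Pi.sub_apply]
    have h : dvaryF 0 T.1 (modifiedBracket μ S.σ (G R) (G Q) - G (S.bracket hS hμ Q R)) t z =
        dvaryF 0 T.1 (modifiedBracket μ S.σ (G R) (G Q)) t z -
          dvaryF 0 T.1 (G (S.bracket hS hμ Q R)) t z := hμ.dirDerivF_sub_fn hB (hGl _) _ _ _ _
    rw [h]
    change _ - dvaryF 0 (commutator R.1 T.1) (G Q) t z +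
      pairing μ (funcDeriv μ (G Q) t z) (commutator R.1 T.1 t z) - _ + _ = _
    ring
  have hc := hμ.modifiedBracket_cyclic hS.skew (hGl Q₁) (hGl Q₂) (hGl Q₃) (hX Q₁) (hX Q₂) (hX Q₃)
      t z
  simp only [Pi.add_apply, Pi.zero_apply] at hGj' ⊢
  rw [key, key, key]
  linarith

end LieAlgebra

end BoundarySources

end

theorem mainTheorem5 {n : ℕ} [NeZero n] {M : Type*} [TopologicalSpace M] [T2Space M] [CompactSpace M]
    [ChartedSpace (EuclideanHalfSpace n) M] [IsManifold (𝓡∂ n) ∞ M]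
    (hM : ((𝓡∂ n).boundary M).Nonempty)
    [MeasurableSpace M] [BorelSpace M] (μ : Measure M)
    (hμ : BoundarySources.IsSmoothDensity (n := n) μ)
    {ι κ : Type*} [Fintype ι] [DecidableEq ι]
    (S : BoundarySources.System n M ι κ) (hS : S.IsRegular μ) :
    -- the external symmetries form a Lie algebra, with the commutator as its bracket
    ∃ 𝒢 : Submodule ℝ (BoundarySources.Variation n M ι),
      (∀ Q, Q ∈ 𝒢 ↔ S.IsExternalSymmetry μ Q) ∧
    ∃ br : 𝒢 →ₗ[ℝ] 𝒢 →ₗ[ℝ] 𝒢,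
      (∀ Q₁ Q₂ : 𝒢, (br Q₁ Q₂ : BoundarySources.Variation n M ι)
        = BoundarySources.commutator (Q₁ : BoundarySources.Variation n M ι) Q₂) ∧
      (∀ Q, br Q Q = 0) ∧
      (∀ Q₁ Q₂ Q₃, br Q₁ (br Q₂ Q₃) + br Q₂ (br Q₃ Q₁) + br Q₃ (br Q₁ Q₂) = 0) ∧
      -- the modified bracket of generators generates the commutator
      (∀ (Q₁ Q₂ : 𝒢) (G₁ G₂ : BoundarySources.Functional n M ι),
        S.IsGenerator μ Q₁ G₁ → S.IsGenerator μ Q₂ G₂ →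
        S.IsGenerator μ (br Q₁ Q₂) (BoundarySources.modifiedBracket μ S.σ G₂ G₁)) ∧
      -- the external symmetries have generators, which can be chosen linearly
      (∃ G : 𝒢 →ₗ[ℝ] BoundarySources.Functional n M ι, ∀ Q : 𝒢, S.IsGenerator μ Q (G Q)) ∧
      -- each such choice is an extended representation
      ∀ G : 𝒢 →ₗ[ℝ] BoundarySources.Functional n M ι, (∀ Q : 𝒢, S.IsGenerator μ Q (G Q)) →
        ∃ K : 𝒢 → 𝒢 → BoundarySources.Current n M ι,
          (∀ Q₁ Q₂, BoundarySources.IsLocalCurrent (K Q₁ Q₂) ∧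
            BoundarySources.modifiedBracket μ S.σ (G Q₂) (G Q₁)
              = G (br Q₁ Q₂) + BoundarySources.boundaryTerm μ (K Q₁ Q₂) ∧
            S.InternallyInvariant μ (BoundarySources.boundaryTerm μ (K Q₁ Q₂)) ∧
            K Q₁ Q₂ = -K Q₂ Q₁) ∧
          ∀ Q₁ Q₂ Q₃ : 𝒢,
            (BoundarySources.boundaryTerm μ (K Q₁ (br Q₂ Q₃))
              + BoundarySources.varyFunctional Q₃ (BoundarySources.boundaryTerm μ (K Q₁ Q₂)))
            + (BoundarySources.boundaryTerm μ (K Q₂ (br Q₃ Q₁))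
              + BoundarySources.varyFunctional Q₁ (BoundarySources.boundaryTerm μ (K Q₂ Q₃)))
            + (BoundarySources.boundaryTerm μ (K Q₃ (br Q₁ Q₂))
              + BoundarySources.varyFunctional Q₂ (BoundarySources.boundaryTerm μ (K Q₃ Q₁))) = 0 := by
  classical
  refine ⟨S.externalSymmetries hS hμ, fun _ => Iff.rfl, S.bracket hS hμ, fun _ _ => rfl, fun Q => ?_,
    fun Q₁ Q₂ Q₃ => Subtype.ext (BoundarySources.commutator_jacobi Q₁.2.1 Q₂.2.1 Q₃.2.1),
    fun Q₁ Q₂ G₁ G₂ h₁ h₂ => hS.isGenerator_modifiedBracket hμ h₂ h₁,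
    hS.exists_linear_generator hμ, fun G hG => ?_⟩
  · exact Subtype.ext (sub_self _)
  have hswap : ∀ Q R, S.bracket hS hμ R Q = -S.bracket hS hμ Q R := fun Q R =>
    Subtype.ext (BoundarySources.commutator_swap _ _)
  choose K hK hKN hKi using fun Q R => hS.exists_boundaryTerm_of_isGenerator hμ hM
    (hS.isGenerator_modifiedBracket hμ (hG R) (hG Q)) (hG (S.bracket hS hμ Q R))
  -- the boundary terms are antisymmetric, hence unchanged when the currents are antisymmetrized
  have hbt : ∀ Q R, BoundarySources.boundaryTerm μ ((1 / 2 : ℝ) • (K Q R + (-1 : ℝ) • K R Q)) =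
      BoundarySources.modifiedBracket μ S.σ (G R) (G Q) - G (S.bracket hS hμ Q R) := by
    intro Q R
    rw [hμ.boundaryTerm_smul, hμ.boundaryTerm_add, hμ.boundaryTerm_smul, ← hKN, ← hKN, hswap Q R,
      map_neg, hμ.modifiedBracket_swap hS.skew (G Q) (G R)]
    module
  refine ⟨fun Q R => (1 / 2 : ℝ) • (K Q R + (-1 : ℝ) • K R Q), fun Q R => ⟨?_, ?_, ?_, ?_⟩,
    hS.cocycle hμ hG hbt⟩
  · exact ((hK Q R).add ((hK R Q).smul _)).smul _
  · rw [hbt, add_sub_cancel]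
  · rw [hbt]
    exact hKi Q R
  · module
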